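/- **Setting.** Let $\tau\in\mathbb C$ with $\operatorname{Im}\tau>0$. A *string state* is a pair $(n,m)\in\mathbb Z^2$, $n\neq0$, written $\tilde\theta_n[\tilde p]$ with $\tilde p=m/n\in\mathbb R$; put $p=\tilde p \bmod 1\in\mathbb R/\mathbb Z$. Its degree is $\deg=0$ if $n>0$ and $\deg=1$ if $n<0$. The morphisms between line bundles on $E_\tau=\mathbb C/(\mathbb Z+\tau\mathbb Z)$ whose degrees differ by $n\ne0$ form the complex vector space with basis $\theta_n[p]$, $p\in\mathbb R/\mathbb Z$, $np=0$. Here $\theta_n[p]$ stands for the theta function $\theta\begin{bmatrix}p\\0\end{bmatrix}(nz,n\tau)$ if $n>0$, and for the harmonic form $\overline{\theta\begin{bmatrix}p\\0\end{bmatrix}(-nz,-n\tau)}\,e^{2\pi \operatorname{Im}(\tau)\, n z_2^2}\,d\bar z$ ($z=z_1+\tau z_2$, $z_1,z_2\in\mathbb R$) if $n<0$. **Input.** Let $d\ge1$, let $n_0,\dots,n_d$ be pairwise distinct integers, $n_{i,j}=n_j-n_i$, and let $p_{i-1,i}=m_{i-1,i}/n_{i-1,i}$ with $m_{i-1,i}\in\mathbb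 Z$ ($1\le i\le d$). A *lift* is a choice of $\tilde p_{i-1,i}=\tilde m_{i-1,i}/n_{i-1,i}=p_{i-1,i}-\alpha_{i-1,i}$, $\alpha_{i-1,i}\in\mathbb Z$. For a lift and $i<j$ put $\tilde m_{i,j}=\sum_{i<k\le j}\tilde m_{k-1,k}$, $\tilde p_{i,j}=\tilde m_{i,j}/n_{i,j}$, and $\deg_{i,j}=0$ or $1$ as $n_{i,j}>0$ or $n_{i,j}<0$. The input is in *general position* if, for every lift and all $i<j<k$ with $\deg_{i,j}+\deg_{j,k}=\deg_{i,k}+1$, one has $\tilde p_{i,j}\ne\tilde p_{j,k}$. **Feynman diagrams.** For a lift, $\mathcal F(\tilde p_{0,d};\tilde p_{0,1},\dots,\tilde p_{d-1,d})$ is the set of planar rooted trees with $d$ ordered incoming external edges, whose internal vertices have at least two incoming edges and are placed at points of $\mathbb R$, whose $i$-th incoming external edge starts at $\tilde p_{i-1,i}$, whose outgoing external edge ends at $\tilde p_{0,d}$, and whose internal edges have positive length. An edge carries the sums $n,m$ of the numbers $n_{i-1,i},\tilde m_{i-1,i}$ of the incoming states above it, and at the point $y$ of the edge one puts $v=ny-m$.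 It is required that at both ends of each edge $v$ has the direction of the displacement $\Delta$ along the edge, i.e. $v\Delta\ge0$. (So an incoming external edge with $n<0$, and the outgoing one if $n>0$, has length zero: it *cannot propagate*.) The dimension of $\mathcal F$ at a diagram is $d-1$ (the number of trivalent vertices after resolving vertices of higher valence) minus the number of external edges that cannot propagate. $\mathcal F_0$ is the zero-dimensional part. The correlation function $\langle\tilde p_{0,d};\tilde p_{0,1},\dots,\tilde p_{d-1,d}\rangle_{\tilde\delta}$ of $\tilde\delta\in\mathcal F_0$ is the coefficient obtained by multiplying the incoming states along the tree by the rule $$\tilde\theta_{n}\!\left[\tfrac{a}{n}\right]\tilde\theta_{n'}\!\left[\tfrac{a'}{n'}\right]=\exp\!\Big(\pi i\tau\tfrac{(n'a-na')^2}{nn'(n+n')}\Big)\,\tilde\theta_{n+n'}\!\left[\tfrac{a+a'}{n+n'}\right].$$ **Operations.** For a function $\tilde\delta\mapsto|\tilde\delta|\in\mathbb Z$ on diagrams (with their external states), put $$m_d(p_{0,1},\dots,p_{d-1,d})=\sum_{\alpha_{1,2},\dots,\alpha_{d-1,d}\in\mathbb Z}\ \sum_{\tilde\delta\in\mathcal F_0(\tilde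 p_{0,d};\tilde p_{0,1},\dots,\tilde p_{d-1,d})}(-1)^{|\tilde\delta|}\langle\tilde p_{0,d};\tilde p_{0,1},\dots,\tilde p_{d-1,d}\rangle_{\tilde\delta}\ \theta_{n_{0,d}}[\tilde p_{0,d}],\qquad \alpha_{0,1}=0,$$ and extend $m_d$ multilinearly (in the basis $\theta_n[r/n]$, $0\le r<|n|$). **Theorem ($A_\infty$ relation).** There is a choice of signs $\tilde\delta\mapsto|\tilde\delta|\in\mathbb Z$, depending on the diagram only, such that for every $\tau$ with $\operatorname{Im}\tau>0$, every $d\ge1$ and every input $(n_0,\dots,n_d;\,p_{0,1},\dots,p_{d-1,d})$ in general position: the sets $\mathcal F_0$ of all lifts with $\alpha_{0,1}=0$ are finite, the series defining $m_d(p_{0,1},\dots,p_{d-1,d})$ converges absolutely, and $$\sum_{1\le p\le d,\ 0\le q\le d-p}(-1)^{\deg(p_{0,1})+\cdots+\deg(p_{q-1,q})-q}\;m_{d-p+1}\big(p_{0,1},\dots,p_{q-1,q},\,m_p(p_{q,q+1},\dots,p_{p+q-1,p+q}),\,p_{p+q,p+q+1},\dots,p_{d-1,d}\big)=0$$ in the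 space of morphisms with basis $\theta_{n_{0,d}}[p]$, and hence also for the sections (or forms) that the $\theta_{n_{0,d}}[p]$ stand for. -/

import Mathlib

open scoped BigOperators

noncomputable section

/-! ### String states -/

/-- The string state `θ̃_n[m/n]` in the universal cover of the configuration space: `n ≠ 0` is the
difference of the degrees of two line bundles, and `m / n` is the characteristic. -/
@[ext] structure StringState where
  n : ℤ
  m : ℤ

namespace StringState

/-- The point `p̃ = m / n` of the universal cover `ℝ` of the configuration space `ℝ / ℤ`. -/
def pos (s : StringState) : ℝ := (s.m : ℝ) / (s.n : ℝ)

/-- The degree: `0` for `n > 0` (classes in `H^{0,0}`), `1` for `n < 0` (classes in `H^{0,1}`). -/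
def deg (s : StringState) : ℤ := if s.n < 0 then 1 else 0

/-- The preserved numbers `n` and `m` add up at a local interaction. -/
def fuse (s t : StringState) : StringState := ⟨s.n + t.n, s.m + t.m⟩

/-- The state that comes out of a sequence of incoming states: `n_{0,d} = ∑ n_{i-1,i}` and
`m_{0,d} = ∑ m_{i-1,i}`. -/
def total (l : List StringState) : StringState :=
  ⟨(l.map StringState.n).sum, (l.map StringState.m).sum⟩

/-- The propagator of the state `s` from `a` to `b`. At the point `y` the state is written
`θ̃_n[(m + v) / n]` with `v = n y - m`; both `v` at `a` and `v` at `b` must have the direction of the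
displacement `b - a`. -/
def Propagates (s : StringState) (a b : ℝ) : Prop :=
  0 ≤ (b - a) * ((s.n : ℝ) * a - (s.m : ℝ)) ∧ 0 ≤ (b - a) * ((s.n : ℝ) * b - (s.m : ℝ))

end StringState

open StringState

/-! ### Feynman diagrams in the configuration space -/

/-- Planar trees built from three point interactions. `ext s` is an external incoming state, and
`join y A B` is the local interaction, at the point `y`, of the state that comes out of `A` with the
state that comes out of `B`. -/
inductive FeynmanDiagram where
  | ext (s : StringState) : FeynmanDiagram
  | join (y : ℝ) (A B : FeynmanDiagram) : FeynmanDiagram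

namespace FeynmanDiagram

/-- The external incoming states, in their order. -/
def inputs : FeynmanDiagram → List StringState
  | ext s => [s]
  | join _ A B => A.inputs ++ B.inputs

/-- The state that comes out of the diagram. -/
def state : FeynmanDiagram → StringState
  | ext s => s
  | join _ A B => A.state.fuse B.state

/-- The point from which the state that comes out of the diagram starts to propagate. -/
def start : FeynmanDiagram → ℝ
  | ext s => s.pos
  | join y _ _ => y

/-- The last vertex of the diagram is an interaction at the point `y`. -/
def JoinsAt (y : ℝ) : FeynmanDiagram → Prop
  | ext _ => False
  | join y' _ _ => y' = y

/-- The conditions at the vertices and on the edges: every state propagates to the vertex at which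
it interacts.

Interactions joined by an edge of length zero form one vertex of higher valence, whatever the order
in which they are carried out. So that each diagram occurs once, such a vertex is always
bracketed to the left: the second factor of an interaction at `y` is not itself an interaction
at `y`. -/
def Valid : FeynmanDiagram → Prop
  | ext _ => True
  | join y A B =>
      A.Valid ∧ B.Valid ∧ A.state.Propagates A.start y ∧ B.state.Propagates B.start y ∧
        ¬ B.JoinsAt y

/-- The number of interactions. -/
def interactions : FeynmanDiagram → ℤ
  | ext _ => 0
  | join _ A B => A.interactions + B.interactions + 1

/-- The number of the external incoming states that cannot propagate (those with `n < 0`). -/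
def fixedInputs : FeynmanDiagram → ℤ
  | ext s => if s.n < 0 then 1 else 0
  | join _ A B => A.fixedInputs + B.fixedInputs

/-- The dimension of the moduli space at a diagram: each interaction has one parameter, its position,
and each external state that cannot propagate (an incoming one with `n < 0`, the outgoing one
if `n > 0`) fixes the position of the interaction that it takes part in. -/
def dim (δ : FeynmanDiagram) : ℤ :=
  δ.interactions - δ.fixedInputs - (if 0 < δ.state.n then 1 else 0)

/-- The correlation function `< p̃_{0,d}; p̃_{0,1}, …, p̃_{d-1,d} >_δ`: the coefficient that is produced by
the products
`θ̃_{n₁}[m₁/n₁] θ̃_{n₂}[m₂/n₂]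
  = exp(π i τ (n₂ m₁ - n₁ m₂)² / (n₁ n₂ (n₁ + n₂))) θ̃_{n₁+n₂}[(m₁+m₂)/(n₁+n₂)]`
at the interactions of the diagram. -/
def corr (τ : ℂ) : FeynmanDiagram → ℂ
  | ext _ => 1
  | join _ A B =>
      A.corr τ * B.corr τ *
        Complex.exp (Real.pi * Complex.I * τ *
          (((B.state.n : ℂ) * A.state.m - (A.state.n : ℂ) * B.state.m) ^ 2 /
            ((A.state.n : ℂ) * B.state.n * ((A.state.n : ℂ) + B.state.n))))

end FeynmanDiagram

/-- The moduli space `F(p̃_{0,d}; p̃_{0,1}, …, p̃_{d-1,d})` of the Feynman diagrams with the incoming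
states `l`, in this order, and the outgoing state `total l` at the point `p̃_{0,d} = (total l).pos`. -/
def Feynman (l : List StringState) : Set FeynmanDiagram :=
  {δ | δ.inputs = l ∧ δ.Valid ∧ δ.state.Propagates δ.start (total l).pos}

/-- The `k`-dimensional part `F_k` of the moduli space. -/
def FeynmanOfDim (k : ℤ) (l : List StringState) : Set FeynmanDiagram :=
  {δ | δ ∈ Feynman l ∧ δ.dim = k}

/-! ### Lifts, general position -/

/-- `l'` has the same `n_{i-1,i}` as `l`, and its characteristics are those of `l` modulo `1`:
`p̃_{i-1,i} = m_{i-1,i} / n_{i-1,i} - α_{i-1,i}` with `α_{i-1,i} ∈ ℤ`. -/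
def IsLift (l' l : List StringState) : Prop :=
  List.Forall₂ (fun s' s => s'.n = s.n ∧ ∃ α : ℤ, s'.m = s.m - s.n * α) l' l

/-- The lifts of `l` with `α_{0,1} = 0`. -/
def Lifts (l : List StringState) : Set (List StringState) :=
  {l' | IsLift l' l ∧ l'.head? = l.head?}

/-- The degrees `n_0, …, n_d` of the line bundles are pairwise distinct: `n_{i,j} = n_j - n_i`, the
sum over the block from `i` to `j`, is not `0` for `i < j`. -/
def DistinctDegrees (l : List StringState) : Prop :=
  ∀ a b c : List StringState, l = a ++ b ++ c → b ≠ [] → (total b).n ≠ 0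

/-- General position: for all lifts and all `i < j < k` with
`deg_{i,j} + deg_{j,k} = deg_{i,k} + 1`, the points `p̃_{i,j}` and `p̃_{j,k}` differ. -/
def GeneralPosition (l : List StringState) : Prop :=
  ∀ l' : List StringState, IsLift l' l →
    ∀ a b c e : List StringState, l' = a ++ b ++ c ++ e → b ≠ [] → c ≠ [] →
      (total b).deg + (total c).deg = (total (b ++ c)).deg + 1 →
        (total b).pos ≠ (total c).pos

/-! ### The operations -/

/-- The elements of the space of morphisms with the basis `θ_n[p]`, where `p ∈ ℝ / ℤ` and `n p = 0`,
are given by their coefficients. This is the basis element `θ_n[p]`. -/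
def basisElt (p : UnitAddCircle) : UnitAddCircle → ℂ := Pi.single p 1

/-- The contribution of one lift to `m_d`:
`∑_{δ ∈ F_0} (-1)^{|δ|} < p̃_{0,d}; p̃_{0,1}, …, p̃_{d-1,d} >_δ θ_{n_{0,d}}[p̃_{0,d}]`. -/
def mTerm (σ : FeynmanDiagram → ℤ) (τ : ℂ) (l : List StringState) : UnitAddCircle → ℂ :=
  ∑ᶠ δ ∈ FeynmanOfDim 0 l,
    ((-1 : ℂ) ^ σ δ * δ.corr τ) • basisElt (((total l).pos : ℝ) : UnitAddCircle)

/-- `m_d(p_{0,1}, …, p_{d-1,d})`, with the signs `(-1)^{σ δ}`. -/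
def mOp (σ : FeynmanDiagram → ℤ) (τ : ℂ) (l : List StringState) : UnitAddCircle → ℂ :=
  ∑' l' : Lifts l, mTerm σ τ l'

/-- `m(l₁, x, l₃)` for a morphism `x` between line bundles whose degrees differ by `n`, by linearity
in `x = ∑ x(r/n) θ_n[r/n]`, where `r = 0, …, |n| - 1`. -/
def mInsert (σ : FeynmanDiagram → ℤ) (τ : ℂ) (l₁ : List StringState) (n : ℤ)
    (x : UnitAddCircle → ℂ) (l₃ : List StringState) : UnitAddCircle → ℂ :=
  ∑ r ∈ Finset.range n.natAbs,
    x (((⟨n, r⟩ : StringState).pos : ℝ) : UnitAddCircle) •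
      mOp σ τ (l₁ ++ [(⟨n, r⟩ : StringState)] ++ l₃)

/-! ### The theta functions -/

/-- The theta function with characteristics `a`, `b`. -/
def thetaChar (a : ℝ) (b z τ : ℂ) : ℂ :=
  ∑' k : ℤ, Complex.exp (Real.pi * Complex.I * ((k : ℂ) + a) ^ 2 * τ +
    2 * Real.pi * Complex.I * ((k : ℂ) + a) * (z + b))

/-- The function represented by the basis element `θ_n[p]`: the section `θ[p; 0](n z, n τ)` for `n > 0`,
and, for `n < 0`, the coefficient of `d z̄` in the harmonic form
`conj (θ[p; 0](-n z, -n τ)) exp(2 π t n z₂²) d z̄`, where `t = Im τ`, `z = z₁ + τ z₂`. -/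
def basisSection (τ : ℂ) (n : ℤ) (p : ℝ) (z : ℂ) : ℂ :=
  if 0 < n then thetaChar p 0 (n * z) (n * τ)
  else (starRingEnd ℂ) (thetaChar p 0 (-n * z) (-n * τ)) *
    Complex.exp (2 * Real.pi * τ.im * n * (z.im / τ.im) ^ 2)

/-- The function represented by the morphism `x = ∑ x(r/n) θ_n[r/n]`. -/
def toSection (τ : ℂ) (n : ℤ) (x : UnitAddCircle → ℂ) (z : ℂ) : ℂ :=
  ∑ r ∈ Finset.range n.natAbs,
    x (((⟨n, r⟩ : StringState).pos : ℝ) : UnitAddCircle) *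
      basisSection τ n (⟨n, r⟩ : StringState).pos z

end

/-! The combinatorics of a single lift is separated from the summation over lifts.

For a fixed lift the diagrams are the trees of a homotopy transfer. Think of differential forms on
the configuration space `ℝ`. A state with `n < 0` is represented by a delta 1-form at its point, in
the complex with compact supports, which retracts onto a line by integration. A state with `n > 0`
is represented by the constant function 1, in the complex of all forms, which retracts onto a line
by evaluation at the point of the state. The homotopies are primitives. The forms are an associative
differential graded algebra, so the transferred operations, given by sums over planar trees with a
homotopy on each internal edge, satisfy the `A∞` relation (`HomotopyData.substSum_coeff`). Products
of delta forms and step functions at coinciding points are not defined, so `ℝ` is replaced by a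
subdivided line. Each point becomes an edge in the right order (`exists_compat`), forms become
integer cochains, and the cup product is strictly associative (`lineData`).

The transferred coefficient of a list is the signed number of its zero-dimensional diagrams
(`signedCount_eq_coef`). Counting degrees, it can be nonzero only for one input with `n > 0` and
outgoing `n < 0`, or for two inputs with `n > 0` and outgoing `n > 0`; these are also the cases of
dimension zero (`dim_eq`). Inputs with `n < 0` cannot move. With one input `P` of positive `n`, the
state therefore travels in one direction and absorbs its neighbours at their own points, where they
have velocity zero. The velocity keeps its sign, and the points met on each side of `P` are monotone
(`RGood`, `LGood`). With two such inputs, two travelling states meet at the outgoing point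
(`RGood₂`, `LGood₂`). Hence there is at most one diagram, and its existence is a set of inequalities
between points. The same inequalities come out of the tree sums (`coef_one`, `coef_two`) and of the
diagrams (`exists_valid_one_iff`, `exists_valid_two_iff`). General position removes the coincidences
that would spoil this, and the sign can be read off from the inputs alone. The outcome is the
quadratic relation `signedCount_relation`.

The correlation function is `exp(π i τ area)`, where the area depends only on the inputs and is
additive under substitution of a block (`corr_eq`, `weight_subst`). All terms of the relation for
one lift therefore carry the same weight. For convergence, the energy `∑ nᵢ (y - pᵢ)²` grows along
each edge by at least the square of its length and equals the area at the outgoing point. The area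
thus bounds the squared distances of the inputs, and the series is dominated by a Gaussian one
(`norm_amplitude_le`).

Finally, a composition of two operations is a sum over lifts normalised at the inner block, whereas
the relation needs lifts normalised at the first input. Both are systems of representatives modulo
simultaneous integer translation, under which all terms are invariant (`IsSection`). Each
composition becomes a series over the same set of lifts, and the total vanishes lift by lift. -/

noncomputable section

/-! ### Sums over the splittings of a list -/

/-- The sum of `f a b` over all splittings `l = a ++ b`. -/
def splitSum {X A : Type*} [AddCommMonoid A] (f : List X → List X → A) (l : List X) : A :=
  ∑ k ∈ Finset.range (l.length + 1), f (l.take k) (l.drop k)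

section SplitSum

variable {X A B : Type*} [AddCommMonoid A] [AddCommMonoid B]

@[simp] theorem splitSum_nil (f : List X → List X → A) : splitSum f [] = f [] [] := by
  simp [splitSum]

theorem splitSum_cons (f : List X → List X → A) (x : X) (l : List X) :
    splitSum f (x :: l) = f [] (x :: l) + splitSum (fun a b => f (x :: a) b) l := by
  simp only [splitSum, List.length_cons]
  rw [Finset.sum_range_succ']
  simp [add_comm]

theorem splitSum_congr {f g : List X → List X → A} {l : List X}
    (h : ∀ a b, a ++ b = l → f a b = g a b) : splitSum f l = splitSum g l :=
  Finset.sum_congr rfl fun _ _ => h _ _ (List.take_append_drop _ _)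

theorem splitSum_eq_zero {f : List X → List X → A} {l : List X}
    (h : ∀ a b, a ++ b = l → f a b = 0) : splitSum f l = 0 :=
  Finset.sum_eq_zero fun _ _ => h _ _ (List.take_append_drop _ _)

theorem splitSum_add (f g : List X → List X → A) (l : List X) :
    splitSum (fun a b => f a b + g a b) l = splitSum f l + splitSum g l :=
  Finset.sum_add_distrib

theorem map_splitSum {F : Type*} [FunLike F A B] [AddMonoidHomClass F A B] (φ : F)
    (f : List X → List X → A) (l : List X) :
    φ (splitSum f l) = splitSum (fun a b => φ (f a b)) l :=
  map_sum φ _ _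

theorem splitSum_comm {Y : Type*} (f : List X → List X → List Y → List Y → A) (l : List X)
    (l' : List Y) :
    splitSum (fun a b => splitSum (fun c d => f a b c d) l') l =
      splitSum (fun c d => splitSum (fun a b => f a b c d) l) l' :=
  Finset.sum_comm

theorem splitSum_assoc (f : List X → List X → List X → A) (l : List X) :
    splitSum (fun a r => splitSum (fun b c => f a b c) r) l =
      splitSum (fun u c => splitSum (fun a b => f a b c) u) l := by
  induction l generalizing f with
  | nil => simp
  | cons x l ih =>
    rw [splitSum_cons, splitSum_cons, splitSum_cons, splitSum_nil, ih]
    simp only [splitSum_cons, splitSum_add]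
    abel

theorem splitSum_append_cons (f : List X → List X → A) (a : List X) (t : X) (c : List X) :
    splitSum f (a ++ t :: c) =
      splitSum (fun a₁ a₂ => f a₁ (a₂ ++ t :: c)) a +
        splitSum (fun c₁ c₂ => f (a ++ t :: c₁) c₂) c := by
  induction a generalizing f with
  | nil => simp [splitSum_cons]
  | cons x a ih =>
    simp only [List.cons_append, splitSum_cons, ih]
    abel

theorem splitSum_eq_left (f : List X → List X → A) (l : List X)
    (h : ∀ x a b, x :: a ++ b = l → f (x :: a) b = 0) : splitSum f l = f [] l := by
  cases l with
  | nil => simp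
  | cons x l =>
    rw [splitSum_cons, splitSum_eq_zero, add_zero]
    rintro a b rfl
    exact h _ _ _ rfl

theorem splitSum_eq_right (f : List X → List X → A) (l : List X)
    (h : ∀ a x b, a ++ x :: b = l → f a (x :: b) = 0) : splitSum f l = f l [] := by
  induction l generalizing f with
  | nil => simp
  | cons x l ih =>
    rw [splitSum_cons, h [] x l rfl, zero_add]
    exact ih (fun a b => f (x :: a) b) fun a y b e => h (x :: a) y b (by simp [e])

end SplitSum

theorem splitSum_mul_right {X A : Type*} [Ring A] (f : List X → List X → A) (l : List X) (a : A) :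
    splitSum f l * a = splitSum (fun u v => f u v * a) l := Finset.sum_mul _ _ _

theorem splitSum_mul_left {X A : Type*} [Ring A] (f : List X → List X → A) (l : List X) (a : A) :
    a * splitSum f l = splitSum (fun u v => a * f u v) l := Finset.mul_sum _ _ _

theorem splitSum_sub {X A : Type*} [AddCommGroup A] (f g : List X → List X → A) (l : List X) :
    splitSum (fun a b => f a b - g a b) l = splitSum f l - splitSum g l :=
  Finset.sum_sub_distrib _ _

theorem splitSum_neg {X A : Type*} [AddCommGroup A] (f : List X → List X → A) (l : List X) :
    splitSum (fun a b => -f a b) l = -splitSum f l :=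
  Finset.sum_neg_distrib _

theorem splitSum_zsmul {X A : Type*} [AddCommGroup A] (n : ℤ) (f : List X → List X → A)
    (l : List X) : splitSum (fun a b => n • f a b) l = n • splitSum f l :=
  Finset.smul_sum.symm

/-! ### Homotopy transfer -/

/-- Homotopy retractions, one for each `s : X`, of a differential graded ring `A` (whose grading is
recorded by the involution `inv`) onto the line spanned by `incl s`. -/
structure HomotopyData (X A : Type*) [Ring A] where
  /-- the label of the composition of a sequence of labels -/
  tot : List X → X
  /-- the sign of a label -/
  sgn : X → ℤ
  /-- the grading involution -/
  inv : A →+* A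
  /-- the differential -/
  d : A →+ A
  /-- the representative of the generator -/
  incl : X → A
  /-- the homotopy -/
  h : X → A →+ A
  /-- the projection -/
  proj : X → A →+ ℤ
  /-- the support condition -/
  K : X → AddSubgroup A
  tot_single : ∀ s, tot [s] = s
  tot_subst : ∀ a b c, b ≠ [] → tot (a ++ tot b :: c) = tot (a ++ b ++ c)
  sgn_sq : ∀ s, sgn s * sgn s = 1
  inv_inv : ∀ a, inv (inv a) = a
  d_mul : ∀ a b, d (a * b) = d a * b + inv a * d b
  d_inv : ∀ a, d (inv a) = -inv (d a)
  incl_mem : ∀ s, incl s ∈ K s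
  -- The involution appears because tree products have the form `inv x * y`. The homotopy identities
  -- below are demanded only on `K`, which is what compact supports require.
  mul_mem : ∀ l l' x y, l ≠ [] → l' ≠ [] → x ∈ K (tot l) → y ∈ K (tot l') →
    inv x * y ∈ K (tot (l ++ l'))
  h_mem : ∀ s a, a ∈ K s → h s a ∈ K s
  d_incl : ∀ s, d (incl s) = 0
  inv_incl : ∀ s, inv (incl s) = -(sgn s • incl s)
  homotopy : ∀ s a, a ∈ K s → d (h s a) + h s (d a) = a - proj s a • incl s
  proj_d : ∀ s a, a ∈ K s → proj s (d a) = 0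
  inv_h : ∀ s a, inv (h s a) = -h s (inv a)

namespace HomotopyData

variable {X A : Type*} [Ring A] (H : HomotopyData X A)

/-- The sum over planar trees, with the homotopy applied at the root, up to a bounded depth. -/
def morAux : ℕ → List X → A
  | 0, _ => 0
  | _ + 1, [] => 0
  | _ + 1, [s] => H.incl s
  | k + 1, x :: y :: t =>
      -H.h (H.tot (x :: y :: t)) (splitSum (fun a b => H.inv (morAux k a) * morAux k b) (x :: y :: t))

/-- The components of the `A∞` morphism from the transferred structure to `A`. -/
def mor (l : List X) : A := H.morAux l.length l

/-- The sum over planar trees, before the homotopy is applied at the root. -/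
def pre (l : List X) : A := splitSum (fun a b => H.inv (H.mor a) * H.mor b) l

/-- The coefficient of the transferred operation. -/
def coeff (l : List X) : ℤ := H.proj (H.tot l) (H.pre l)

/-- The Koszul sign of a sequence. -/
def sign (l : List X) : ℤ := (l.map H.sgn).prod

theorem morAux_nil (k : ℕ) : H.morAux k [] = 0 := by cases k <;> rfl

/-- Depth beyond the length is immaterial: both parts of a proper splitting are shorter, and an
empty part contributes `0`. -/
theorem morAux_succ (k : ℕ) (l : List X) (hl : l.length ≤ k) :
    H.morAux (k + 1) l = H.morAux k l := by
  induction k generalizing l with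
  | zero =>
    obtain rfl : l = [] := List.length_eq_zero_iff.mp (by omega)
    rfl
  | succ k ih =>
    match l, hl with
    | [], _ => rfl
    | [s], _ => rfl
    | x :: y :: t, hl =>
      rw [morAux, morAux]
      congr 2
      refine splitSum_congr fun a b hab => ?_
      rcases eq_or_ne a [] with rfl | ha
      · simp [morAux_nil]
      rcases eq_or_ne b [] with rfl | hb
      · simp [morAux_nil]
      have := congrArg List.length hab
      rw [List.length_append] at this
      have h1 := List.length_pos_of_ne_nil ha
      have h2 := List.length_pos_of_ne_nil hb
      rw [ih a (by omega), ih b (by omega)]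

theorem morAux_eq (k : ℕ) (l : List X) (hl : l.length ≤ k) : H.morAux k l = H.mor l := by
  induction k, hl using Nat.le_induction with
  | base => rfl
  | succ k hk ih => rw [H.morAux_succ k l hk, ih]

@[simp] theorem mor_nil : H.mor [] = 0 := rfl

@[simp] theorem mor_single (s : X) : H.mor [s] = H.incl s := rfl

theorem mor_eq (l : List X) (hl : 2 ≤ l.length) : H.mor l = -H.h (H.tot l) (H.pre l) := by
  match l, hl with
  | x :: y :: t, _ =>
    rw [mor, List.length_cons, morAux, pre]
    congr 2
    refine splitSum_congr fun a b hab => ?_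
    rcases eq_or_ne a [] with rfl | ha
    · simp [morAux_nil]
    rcases eq_or_ne b [] with rfl | hb
    · simp [morAux_nil]
    have := congrArg List.length hab
    rw [List.length_append, List.length_cons] at this
    have h1 := List.length_pos_of_ne_nil ha
    have h2 := List.length_pos_of_ne_nil hb
    rw [morAux_eq _ _ _ (by omega), morAux_eq _ _ _ (by omega)]

@[simp] theorem pre_nil : H.pre [] = 0 := by simp [pre]

@[simp] theorem pre_single (s : X) : H.pre [s] = 0 := by simp [pre, splitSum_cons]

@[simp] theorem coeff_nil : H.coeff [] = 0 := by simp [coeff]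

@[simp] theorem coeff_single (s : X) : H.coeff [s] = 0 := by simp [coeff]

theorem sign_append (a b : List X) : H.sign (a ++ b) = H.sign a * H.sign b := by simp [sign]

theorem sign_sq (a : List X) : H.sign a * H.sign a = 1 := by
  induction a with
  | nil => rfl
  | cons x a ih =>
    have : H.sign (x :: a) = H.sgn x * H.sign a := by simp [sign]
    rw [this, mul_mul_mul_comm, H.sgn_sq, ih, one_mul]

/-- To compare two sums over splittings it suffices to compare the terms of the splittings into two
nonempty parts. -/
theorem splitSum_congr_proper {f f' : List X → List X → A} {l : List X}
    (h0 : ∀ b, f [] b = f' [] b) (h0' : ∀ a, f a [] = f' a [])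
    (h : ∀ a b, a ≠ [] → b ≠ [] → a.length < l.length → b.length < l.length → a ++ b = l →
      f a b = f' a b) :
    splitSum f l = splitSum f' l := by
  refine splitSum_congr fun a b hab => ?_
  rcases eq_or_ne a [] with rfl | ha
  · exact h0 b
  rcases eq_or_ne b [] with rfl | hb
  · exact h0' a
  have := congrArg List.length hab
  rw [List.length_append] at this
  have h1 := List.length_pos_of_ne_nil ha
  have h2 := List.length_pos_of_ne_nil hb
  exact h a b ha hb (by omega) (by omega) hab

/-- The homotopy anticommutes with `inv` and `inv` is multiplicative, so tree sums are homogeneous,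
with a parity fixed by the inputs. This converts the involution in the Leibniz rule into the Koszul
sign of the inputs passed over. -/
theorem inv_mor (l : List X) : H.inv (H.mor l) = -(H.sign l • H.mor l) ∧
    H.inv (H.pre l) = H.sign l • H.pre l := by
  induction hn : l.length using Nat.strong_induction_on generalizing l with
  | _ n ih =>
    subst hn
    have hpre : H.inv (H.pre l) = H.sign l • H.pre l := by
      rw [pre, map_splitSum, ← splitSum_zsmul]
      refine splitSum_congr_proper (by simp) (by simp) ?_
      rintro a b - - ha hb rfl
      rw [map_mul, (ih _ ha a rfl).1, (ih _ hb b rfl).1, map_neg, map_zsmul, sign_append, mul_smul]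
      simp only [neg_mul_neg, smul_mul_assoc, mul_smul_comm, (ih _ ha a rfl).1]
      rw [smul_comm]
    refine ⟨?_, hpre⟩
    rcases Nat.lt_or_ge l.length 2 with h2 | h2
    · match l, h2 with
      | [], _ => simp
      | [s], _ => simp [sign, H.inv_incl]
    · rw [H.mor_eq l h2, map_neg, H.inv_h, hpre, map_zsmul]
      simp

theorem mor_mem (l : List X) (hl : l ≠ []) :
    H.mor l ∈ H.K (H.tot l) ∧ H.pre l ∈ H.K (H.tot l) := by
  induction hn : l.length using Nat.strong_induction_on generalizing l with
  | _ n ih =>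
    subst hn
    have hpre : H.pre l ∈ H.K (H.tot l) := by
      rw [pre, splitSum]
      refine AddSubgroup.sum_mem (H.K (H.tot l)) fun k _ => ?_
      rcases eq_or_ne (l.take k) [] with ha | ha
      · simp [ha]
      rcases eq_or_ne (l.drop k) [] with hb | hb
      · simp [hb]
      have := congrArg List.length (List.take_append_drop k l)
      rw [List.length_append] at this
      have h1 := List.length_pos_of_ne_nil ha
      have h2 := List.length_pos_of_ne_nil hb
      have := H.mul_mem _ _ _ _ ha hb (ih _ (by omega) _ ha rfl).1 (ih _ (by omega) _ hb rfl).1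
      rwa [List.take_append_drop] at this
    refine ⟨?_, hpre⟩
    rcases Nat.lt_or_ge l.length 2 with h2 | h2
    · match l, h2 with
      | [s], _ => simpa [H.tot_single] using H.incl_mem s
    · rw [H.mor_eq l h2]
      exact neg_mem (H.h_mem _ _ hpre)

/-- The sum of `sign a * coeff b * F (a, tot b, c)` over all `l = a ++ b ++ c`. -/
def substSum {B : Type*} [AddCommGroup B] (F : List X → B) (l : List X) : B :=
  splitSum (fun a r => splitSum (fun b c => (H.sign a * H.coeff b) • F (a ++ H.tot b :: c)) r) l

theorem substSum_nil {B : Type*} [AddCommGroup B] (F : List X → B) : H.substSum F [] = 0 := by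
  simp [substSum]

theorem map_substSum {B C : Type*} [AddCommGroup B] [AddCommGroup C] (φ : B →+ C)
    (F : List X → B) (l : List X) : φ (H.substSum F l) = H.substSum (fun u => φ (F u)) l := by
  simp only [substSum, map_splitSum, map_zsmul]

/-- Inserting an operation acts on a product of two trees as a derivation: the replaced block lies
in the left or in the right factor. In the second case the sign of the skipped factor cancels
against `inv`, leaving a minus sign. -/
theorem substSum_pre (l : List X) : H.substSum H.pre l =
    splitSum (fun a b => H.inv (H.substSum H.mor a) * H.mor b - H.mor a * H.substSum H.mor b) l := by
  have e1 : ∀ a b c, (H.sign a * H.coeff b) • H.pre (a ++ H.tot b :: c) =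
      splitSum (fun c₁ c₂ => (H.sign a * H.coeff b) •
        (H.inv (H.mor (a ++ H.tot b :: c₁)) * H.mor c₂)) c +
      splitSum (fun a₁ a₂ => (H.sign a * H.coeff b) •
        (H.inv (H.mor a₁) * H.mor (a₂ ++ H.tot b :: c))) a := fun a b c => by
    rw [pre, splitSum_append_cons, smul_add, splitSum_zsmul, splitSum_zsmul, add_comm]
  have e2 : H.substSum H.pre l =
      splitSum (fun a r => splitSum (fun b c => splitSum (fun c₁ c₂ => (H.sign a * H.coeff b) •
        (H.inv (H.mor (a ++ H.tot b :: c₁)) * H.mor c₂)) c) r) l +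
      splitSum (fun a r => splitSum (fun a₁ a₂ => splitSum (fun b c => (H.sign a * H.coeff b) •
        (H.inv (H.mor a₁) * H.mor (a₂ ++ H.tot b :: c))) r) a) l := by
    rw [← splitSum_add]
    refine splitSum_congr fun a r _ => ?_
    rw [splitSum_comm (fun a₁ a₂ b c => (H.sign a * H.coeff b) •
        (H.inv (H.mor a₁) * H.mor (a₂ ++ H.tot b :: c))), ← splitSum_add]
    exact splitSum_congr fun b c _ => e1 a b c
  have e3 : ∀ a r, splitSum (fun b c => splitSum (fun c₁ c₂ => (H.sign a * H.coeff b) •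
        (H.inv (H.mor (a ++ H.tot b :: c₁)) * H.mor c₂)) c) r =
      splitSum (fun u c₂ => splitSum (fun b c₁ => (H.sign a * H.coeff b) •
        (H.inv (H.mor (a ++ H.tot b :: c₁)) * H.mor c₂)) u) r := fun a r =>
    splitSum_assoc (fun b c₁ c₂ => (H.sign a * H.coeff b) •
        (H.inv (H.mor (a ++ H.tot b :: c₁)) * H.mor c₂)) r
  have e4 : splitSum (fun a r => splitSum (fun a₁ a₂ => splitSum (fun b c =>
        (H.sign a * H.coeff b) • (H.inv (H.mor a₁) * H.mor (a₂ ++ H.tot b :: c))) r) a) l =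
      splitSum (fun a₁ u => splitSum (fun a₂ r => splitSum (fun b c =>
        (H.sign (a₁ ++ a₂) * H.coeff b) •
          (H.inv (H.mor a₁) * H.mor (a₂ ++ H.tot b :: c))) r) u) l := by
    rw [splitSum_assoc]
    refine splitSum_congr fun a r _ => splitSum_congr fun a₁ a₂ h => ?_
    rw [h]
  rw [e2, splitSum_congr fun a r _ => e3 a r,
    splitSum_assoc (fun a u c₂ => splitSum (fun b c₁ => (H.sign a * H.coeff b) •
        (H.inv (H.mor (a ++ H.tot b :: c₁)) * H.mor c₂)) u), e4, ← splitSum_add]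
  refine splitSum_congr fun a b _ => ?_
  rw [sub_eq_add_neg]
  congr 1
  · simp only [substSum, map_splitSum, map_zsmul, splitSum_mul_right, smul_mul_assoc]
  · simp only [substSum, splitSum_mul_left, mul_smul_comm, ← splitSum_neg, (H.inv_mor a).1,
      sign_append]
    refine splitSum_congr fun a₂ r _ => splitSum_congr fun b' c _ => ?_
    rw [neg_mul, smul_mul_assoc, smul_neg, smul_smul]
    congr 2
    linear_combination (H.sign a₂ * H.coeff b') * H.sign_sq a

/-- Only the splitting with both outer parts empty survives. It is the term of `substSum H.mor` in
which `mor` is evaluated on a single label. -/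
theorem substSum_incl (l : List X) :
    splitSum (fun a r => splitSum (fun b c => (H.sign a * H.coeff b) •
      (if a = [] ∧ c = [] then H.incl (H.tot b) else 0)) r) l = H.coeff l • H.incl (H.tot l) := by
  rw [splitSum_eq_left _ _ fun x a b _ => splitSum_eq_zero fun _ _ _ => by simp,
    splitSum_eq_right _ _ fun a x b _ => by simp]
  simp [sign]

/-- The morphism equations, and the derivative of the sum over trees. -/
theorem d_mor_add_pre (l : List X) (hl : l ≠ []) :
    H.d (H.mor l) + H.pre l = H.substSum H.mor l ∧ H.d (H.pre l) = -H.substSum H.pre l := by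
  induction hn : l.length using Nat.strong_induction_on generalizing l with
  | _ n ih =>
    subst hn
    have hpre : H.d (H.pre l) = -H.substSum H.pre l := by
      -- The corrections from replacing `d mor` by `substSum mor - pre` cancel by associativity:
      -- both sides are the sum over three parts of `mor * inv mor * mor`.
      have key : splitSum (fun a b => H.inv (H.pre a) * H.mor b) l =
          splitSum (fun a b => H.mor a * H.pre b) l := by
        simp only [pre, map_splitSum, splitSum_mul_right, splitSum_mul_left]
        rw [splitSum_assoc]
        simp only [map_mul, H.inv_inv, mul_assoc]
      rw [substSum_pre, ← splitSum_neg, ← sub_zero (H.d _), ← sub_eq_zero.mpr key, ← splitSum_sub]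
      rw [sub_eq_iff_eq_add, ← splitSum_add]
      conv_lhs => rw [pre, map_splitSum]
      refine splitSum_congr_proper (by simp [substSum_nil]) (by simp [substSum_nil]) ?_
      rintro a b ha hb ha' hb' -
      rw [H.d_mul, H.d_inv, H.inv_inv, eq_sub_of_add_eq (ih _ ha' a ha rfl).1,
        eq_sub_of_add_eq (ih _ hb' b hb rfl).1, map_sub]
      noncomm_ring
    refine ⟨?_, hpre⟩
    rcases Nat.lt_or_ge l.length 2 with h2 | h2
    · match l, h2 with
      | [s], _ => simp [substSum, splitSum_cons, H.d_incl]
    · have hm := H.homotopy _ _ (H.mor_mem l hl).2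
      -- On a single label `mor` is the generator and `pre` is `0`; on longer lists `mor = -h pre`.
      -- The exceptional term is the projection part of the homotopy identity.
      have e : H.substSum H.mor l =
          -H.substSum (fun u => H.h (H.tot l) (H.pre u)) l + H.coeff l • H.incl (H.tot l) := by
        rw [← substSum_incl, substSum, substSum, ← splitSum_neg, ← splitSum_add]
        refine splitSum_congr fun a r har => ?_
        rw [← splitSum_neg, ← splitSum_add]
        refine splitSum_congr fun b c hbc => ?_
        rcases eq_or_ne b [] with rfl | hb
        · simp
        rw [← smul_neg, ← smul_add]
        congr 1
        subst hbc har
        have ht := H.tot_subst a b c hb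
        rw [List.append_assoc] at ht
        split_ifs with h
        · obtain ⟨rfl, rfl⟩ := h
          simp
        · rw [← ht, H.mor_eq, add_zero]
          have : 0 < a.length + c.length := by
            by_contra h0
            exact h ⟨List.length_eq_zero_iff.mp (by omega), List.length_eq_zero_iff.mp (by omega)⟩
          simp only [List.length_append, List.length_cons]
          omega
      rw [e, H.mor_eq l h2, map_neg, ← H.map_substSum (H.h (H.tot l)) H.pre,
        ← map_neg (H.h (H.tot l)), ← hpre]
      rw [← sub_eq_zero] at hm ⊢
      rw [← neg_eq_zero, ← hm, coeff]
      abel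

/-- **The `A∞` relation** of the transferred operations. -/
theorem substSum_coeff (l : List X) (hl : l ≠ []) : H.substSum H.coeff l = 0 := by
  -- Project `d pre = -substSum pre`. The left side dies, and since a substitution does not change
  -- `tot`, one projection computes all the coefficients on the right.
  have h := H.proj_d _ _ (H.mor_mem l hl).2
  rw [(H.d_mor_add_pre l hl).2, map_neg, neg_eq_zero, H.map_substSum] at h
  rw [← h]
  refine splitSum_congr fun a r har => splitSum_congr fun b c hbc => ?_
  rcases eq_or_ne b [] with rfl | hb
  · simp
  subst hbc har
  have ht := H.tot_subst a b c hb
  rw [List.append_assoc] at ht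
  simp only [coeff, ht]

end HomotopyData

end

noncomputable section

open StringState

/-! ### Cochains on a subdivided line -/

/-- A cochain on the half line with vertices and edges numbered by `ℕ`; the edge `e` joins the
vertices `e` and `e + 1`. -/
@[ext] structure Cochain where
  /-- the values on the vertices -/
  f : ℕ → ℤ
  /-- the values on the edges -/
  w : ℕ → ℤ

namespace Cochain

instance : Zero Cochain := ⟨⟨0, 0⟩⟩
instance : One Cochain := ⟨⟨1, 0⟩⟩
instance : Add Cochain := ⟨fun a b => ⟨a.f + b.f, a.w + b.w⟩⟩
instance : Neg Cochain := ⟨fun a => ⟨-a.f, -a.w⟩⟩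
instance : Sub Cochain := ⟨fun a b => ⟨a.f - b.f, a.w - b.w⟩⟩
-- The cup product: on an edge, a vertex function is read at the initial vertex when it is the left
-- factor and at the terminal vertex when it is the right factor. This is associative but not
-- commutative, and it is what decides ties between coinciding points.
instance : Mul Cochain := ⟨fun a b => ⟨a.f * b.f, fun e => a.f e * b.w e + a.w e * b.f (e + 1)⟩⟩

@[simp] theorem zero_f (j) : (0 : Cochain).f j = 0 := rfl
@[simp] theorem zero_w (j) : (0 : Cochain).w j = 0 := rfl
@[simp] theorem one_f (j) : (1 : Cochain).f j = 1 := rfl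
@[simp] theorem one_w (j) : (1 : Cochain).w j = 0 := rfl
@[simp] theorem add_f (a b : Cochain) (j) : (a + b).f j = a.f j + b.f j := rfl
@[simp] theorem add_w (a b : Cochain) (j) : (a + b).w j = a.w j + b.w j := rfl
@[simp] theorem neg_f (a : Cochain) (j) : (-a).f j = -a.f j := rfl
@[simp] theorem neg_w (a : Cochain) (j) : (-a).w j = -a.w j := rfl
@[simp] theorem sub_f (a b : Cochain) (j) : (a - b).f j = a.f j - b.f j := rfl
@[simp] theorem sub_w (a b : Cochain) (j) : (a - b).w j = a.w j - b.w j := rfl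
@[simp] theorem mul_f (a b : Cochain) (j) : (a * b).f j = a.f j * b.f j := rfl
@[simp] theorem mul_w (a b : Cochain) (e) :
    (a * b).w e = a.f e * b.w e + a.w e * b.f (e + 1) := rfl

instance : Ring Cochain where
  add_assoc _ _ _ := by ext <;> simp [add_assoc]
  zero_add _ := by ext <;> simp
  add_zero _ := by ext <;> simp
  add_comm _ _ := by ext <;> simp [add_comm]
  left_distrib _ _ _ := by ext <;> simp <;> ring
  right_distrib _ _ _ := by ext <;> simp <;> ring
  zero_mul _ := by ext <;> simp
  mul_zero _ := by ext <;> simp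
  mul_assoc _ _ _ := by ext <;> simp <;> ring
  one_mul _ := by ext <;> simp
  mul_one _ := by ext <;> simp
  neg_add_cancel _ := by ext <;> simp
  sub_eq_add_neg _ _ := by ext <;> simp [sub_eq_add_neg]
  nsmul := nsmulRec
  zsmul := zsmulRec

/-- The value at a vertex. -/
def evalF (j : ℕ) : Cochain →+ ℤ := ⟨⟨fun a => a.f j, rfl⟩, fun _ _ => rfl⟩

/-- The value on an edge. -/
def evalW (j : ℕ) : Cochain →+ ℤ := ⟨⟨fun a => a.w j, rfl⟩, fun _ _ => rfl⟩

@[simp] theorem zsmul_f (k : ℤ) (a : Cochain) (j) : (k • a).f j = k * a.f j :=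
  map_zsmul (evalF j) k a

@[simp] theorem zsmul_w (k : ℤ) (a : Cochain) (j) : (k • a).w j = k * a.w j :=
  map_zsmul (evalW j) k a

/-- The grading involution. -/
def inv : Cochain →+* Cochain where
  toFun a := ⟨a.f, -a.w⟩
  map_one' := by ext <;> simp
  map_mul' _ _ := by ext <;> simp; ring
  map_zero' := by ext <;> simp
  map_add' _ _ := by ext <;> simp; ring

@[simp] theorem inv_f (a : Cochain) (j) : (inv a).f j = a.f j := rfl
@[simp] theorem inv_w (a : Cochain) (j) : (inv a).w j = -a.w j := rfl

/-- The coboundary. -/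
def d : Cochain →+ Cochain where
  toFun a := ⟨0, fun e => a.f (e + 1) - a.f e⟩
  map_zero' := by ext <;> simp
  map_add' _ _ := by ext <;> simp; ring

@[simp] theorem d_f (a : Cochain) (j) : (d a).f j = 0 := rfl
@[simp] theorem d_w (a : Cochain) (e) : (d a).w e = a.f (e + 1) - a.f e := rfl

/-- The sum over the first `j` edges. -/
def psum (a : Cochain) (j : ℕ) : ℤ := ∑ i ∈ Finset.range j, a.w i

theorem psum_succ (a : Cochain) (j : ℕ) : a.psum (j + 1) = a.psum j + a.w j :=
  Finset.sum_range_succ _ _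

@[simp] theorem psum_zero_idx (a : Cochain) : a.psum 0 = 0 := rfl

@[simp] theorem psum_add (a b : Cochain) (j : ℕ) : (a + b).psum j = a.psum j + b.psum j := by
  simp [psum, Finset.sum_add_distrib]

@[simp] theorem psum_zero (j : ℕ) : (0 : Cochain).psum j = 0 := by simp [psum]

@[simp] theorem psum_inv (a : Cochain) (j : ℕ) : (inv a).psum j = -a.psum j := by simp [psum]

@[simp] theorem psum_d (a : Cochain) (j : ℕ) : (d a).psum j = a.f j - a.f 0 := by
  induction j with
  | zero => simp
  | succ j ih => rw [psum_succ, ih, d_w]; ring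

/-- The homotopy: integration from the base vertex `r + 1`, or, with compact support, subtracting
the integral concentrated at the edge `r`. -/
def hom (c : Prop) [Decidable c] (r N : ℕ) : Cochain →+ Cochain where
  toFun a := ⟨fun j => a.psum j - if c then (if r < j then a.psum N else 0) else a.psum (r + 1), 0⟩
  map_zero' := by ext <;> simp
  map_add' a b := by ext <;> simp; split_ifs <;> ring

theorem hom_f (c : Prop) [Decidable c] (r N : ℕ) (a : Cochain) (j) : (hom c r N a).f j =
    a.psum j - if c then (if r < j then a.psum N else 0) else a.psum (r + 1) := rfl

@[simp] theorem hom_w (c : Prop) [Decidable c] (r N : ℕ) (a : Cochain) (j) :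
    (hom c r N a).w j = 0 := rfl

/-- The projection. -/
def proj (c : Prop) [Decidable c] (r N : ℕ) : Cochain →+ ℤ where
  toFun a := if c then a.psum N else a.f (r + 1)
  map_zero' := by simp
  map_add' _ _ := by split_ifs <;> simp

theorem proj_apply (c : Prop) [Decidable c] (r N : ℕ) (a : Cochain) :
    proj c r N a = if c then a.psum N else a.f (r + 1) := rfl

/-- The representative of the generator. -/
def gen (c : Prop) [Decidable c] (r : ℕ) : Cochain :=
  if c then ⟨0, Pi.single r 1⟩ else 1

/-- The cochains with support in the interior of `[0, N]`. -/
def compact (N : ℕ) : AddSubgroup Cochain where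
  carrier := {a | a.f 0 = 0 ∧ (∀ j, N ≤ j → a.f j = 0) ∧ ∀ j, N ≤ j → a.w j = 0}
  zero_mem' := by simp
  add_mem' := by
    rintro a b ⟨h1, h2, h3⟩ ⟨h1', h2', h3'⟩
    exact ⟨by simp [h1, h1'], fun j hj => by simp [h2 j hj, h2' j hj],
      fun j hj => by simp [h3 j hj, h3' j hj]⟩
  neg_mem' := by
    rintro a ⟨h1, h2, h3⟩
    exact ⟨by simp [h1], fun j hj => by simp [h2 j hj], fun j hj => by simp [h3 j hj]⟩

theorem psum_of_mem_compact {N : ℕ} {a : Cochain} (ha : a ∈ compact N) {j : ℕ} (hj : N ≤ j) :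
    a.psum j = a.psum N := by
  induction j, hj using Nat.le_induction with
  | base => rfl
  | succ j hj ih => rw [psum_succ, ih, ha.2.2 j hj, add_zero]

theorem inv_mem_compact {N : ℕ} {a : Cochain} (ha : a ∈ compact N) : inv a ∈ compact N :=
  ⟨by simp [ha.1], fun j hj => by simp [ha.2.1 j hj], fun j hj => by simp [ha.2.2 j hj]⟩

theorem mul_mem_compact_left {N : ℕ} {a : Cochain} (b : Cochain) (ha : a ∈ compact N) :
    a * b ∈ compact N :=
  ⟨by simp [ha.1], fun j hj => by simp [ha.2.1 j hj],
    fun j hj => by simp [ha.2.1 j hj, ha.2.2 j hj]⟩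

theorem mul_mem_compact_right {N : ℕ} {a : Cochain} (b : Cochain) (ha : a ∈ compact N) :
    b * a ∈ compact N :=
  ⟨by simp [ha.1], fun j hj => by simp [ha.2.1 j hj],
    fun j hj => by simp [ha.2.1 (j + 1) (by omega), ha.2.2 j hj]⟩

end Cochain

namespace StringState

theorem total_n (l : List StringState) : (total l).n = (l.map StringState.n).sum := rfl

theorem total_m (l : List StringState) : (total l).m = (l.map StringState.m).sum := rfl

@[simp] theorem total_single (s : StringState) : total [s] = s := by ext <;> simp [total_n, total_m]

theorem total_append (a b : List StringState) : total (a ++ b) = (total a).fuse (total b) := by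
  ext <;> simp [fuse, total_n, total_m]

theorem total_subst (a b c : List StringState) : total (a ++ total b :: c) = total (a ++ b ++ c) := by
  ext <;> simp [total_n, total_m]

end StringState

/-- The homotopy data attached to an order `r` of the points of the states: the cochains with compact
support if `n < 0`, all cochains otherwise. -/
def lineData (r : StringState → ℕ) (N : ℕ) (hr : ∀ s, r s < N) :
    HomotopyData StringState Cochain where
  tot := total
  sgn s := if s.n < 0 then 1 else -1
  inv := Cochain.inv
  d := Cochain.d
  incl s := Cochain.gen (s.n < 0) (r s)
  h s := Cochain.hom (s.n < 0) (r s) N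
  proj s := Cochain.proj (s.n < 0) (r s) N
  K s := if s.n < 0 then Cochain.compact N else ⊤
  tot_single := total_single
  tot_subst a b c _ := total_subst a b c
  sgn_sq s := by split_ifs <;> rfl
  inv_inv a := by ext <;> simp
  d_mul a b := by ext <;> simp; ring
  d_inv a := by ext <;> simp
  incl_mem s := by
    have := hr s
    split_ifs with h
    · refine ⟨by simp [Cochain.gen, h], fun j hj => by simp [Cochain.gen, h], fun j hj => ?_⟩
      simp only [Cochain.gen, if_pos h]
      exact Pi.single_eq_of_ne (by omega) _
    · trivial
  -- A negative sum has a negative summand, and the cochains with compact support form an ideal.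
  mul_mem l l' x y _ _ hx hy := by
    split_ifs with h
    · rw [total_append] at h
      by_cases h1 : (total l).n < 0
      · rw [if_pos h1] at hx
        exact Cochain.mul_mem_compact_left _ (Cochain.inv_mem_compact hx)
      · have h2 : (total l').n < 0 := by
          simp only [fuse] at h
          omega
        rw [if_pos h2] at hy
        exact Cochain.mul_mem_compact_right _ hy
    · trivial
  h_mem s a ha := by
    have := hr s
    split_ifs with h
    · rw [if_pos h] at ha
      refine ⟨by simp [Cochain.hom_f, h], fun j hj => ?_, fun j hj => by simp⟩
      rw [Cochain.hom_f, if_pos h, if_pos (by omega), Cochain.psum_of_mem_compact ha hj, sub_self]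
    · trivial
  d_incl s := by ext <;> simp [Cochain.gen] <;> split_ifs <;> simp
  inv_incl s := by ext <;> simp [Cochain.gen] <;> split_ifs <;> simp
  homotopy s a ha := by
    split_ifs at ha with h
    · ext j
      · simp only [Cochain.add_f, Cochain.d_f, Cochain.hom_f, Cochain.psum_d, if_pos h,
          Cochain.sub_f, Cochain.zsmul_f, Cochain.gen, ha.1, ha.2.1 N le_rfl]
        simp
      · simp only [Cochain.add_w, Cochain.d_w, Cochain.hom_f, Cochain.psum_succ, if_pos h,
          Cochain.sub_w, Cochain.zsmul_w, Cochain.gen, Cochain.proj_apply, Cochain.hom_w,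
          Pi.single_apply]
        -- The subtracted step function jumps only across the edge `r s`, which produces the
        -- multiple of the generator there.
        rcases lt_trichotomy j (r s) with hj | hj | hj
        · rw [if_neg (by omega), if_neg (by omega), if_neg (by omega)]; ring
        · rw [if_pos (by omega), if_neg (by omega), if_pos (by omega)]; ring
        · rw [if_pos (by omega), if_pos (by omega), if_neg (by omega)]; ring
    · ext j
      · simp only [Cochain.add_f, Cochain.d_f, Cochain.hom_f, Cochain.psum_d, if_neg h,
          Cochain.sub_f, Cochain.zsmul_f, Cochain.gen, Cochain.proj_apply, Cochain.one_f]
        ring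
      · simp only [Cochain.add_w, Cochain.d_w, Cochain.hom_f, Cochain.psum_succ, if_neg h,
          Cochain.sub_w, Cochain.zsmul_w, Cochain.gen, Cochain.one_w, Cochain.hom_w]
        ring
  proj_d s a ha := by
    split_ifs at ha with h
    · simp only [Cochain.proj_apply, if_pos h, Cochain.psum_d, ha.1, ha.2.1 N le_rfl, sub_self]
    · simp [Cochain.proj_apply, h]
  inv_h s a := by
    ext j
    · simp only [Cochain.inv_f, Cochain.neg_f, Cochain.hom_f, Cochain.psum_inv]
      split_ifs <;> ring
    · simp

end

/-! ### Tree sums on the subdivided line, by the number of inputs with `n > 0`. -/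

noncomputable section

open StringState

theorem Cochain.splitSum_f {X : Type*} (F : List X → List X → Cochain) (l : List X) (j : ℕ) :
    (splitSum F l).f j = splitSum (fun a b => (F a b).f j) l :=
  map_splitSum (Cochain.evalF j) F l

theorem Cochain.splitSum_w {X : Type*} (F : List X → List X → Cochain) (l : List X) (j : ℕ) :
    (splitSum F l).w j = splitSum (fun a b => (F a b).w j) l :=
  map_splitSum (Cochain.evalW j) F l

/-- All states have `n < 0`. -/
def AllNeg (l : List StringState) : Prop := ∀ s ∈ l, s.n < 0

/-- The number of states that do not have `n < 0`. -/
def numPos (l : List StringState) : ℕ := l.countP fun s => ¬ s.n < 0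

theorem numPos_append (a b : List StringState) : numPos (a ++ b) = numPos a + numPos b :=
  List.countP_append

theorem numPos_eq_zero {l : List StringState} : numPos l = 0 ↔ AllNeg l := by
  simp [numPos, AllNeg, List.countP_eq_zero]

theorem AllNeg.numPos {l : List StringState} (h : AllNeg l) : numPos l = 0 := numPos_eq_zero.mpr h

@[simp] theorem numPos_nil : numPos [] = 0 := rfl

theorem numPos_cons (s : StringState) (l : List StringState) :
    numPos (s :: l) = numPos l + if s.n < 0 then 0 else 1 := by
  by_cases h : s.n < 0 <;> simp [numPos, h, not_le.mpr, List.countP_cons]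

theorem exists_of_numPos_pos {l : List StringState} (h : 0 < numPos l) :
    ∃ L P R, l = L ++ P :: R ∧ AllNeg L ∧ ¬ P.n < 0 := by
  induction l with
  | nil => simp at h
  | cons s l ih =>
    by_cases hs : s.n < 0
    · obtain ⟨L, P, R, rfl, hL, hP⟩ := ih (by rw [numPos_cons, if_pos hs] at h; exact h)
      exact ⟨s :: L, P, R, rfl, by simpa [AllNeg, hs] using hL, hP⟩
    · exact ⟨[], s, l, rfl, by simp [AllNeg], hs⟩

theorem exists_of_numPos_eq_one {l : List StringState} (h : numPos l = 1) :
    ∃ L P R, l = L ++ P :: R ∧ AllNeg L ∧ ¬ P.n < 0 ∧ AllNeg R := by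
  obtain ⟨L, P, R, rfl, hL, hP⟩ := exists_of_numPos_pos (h ▸ one_pos)
  rw [numPos_append, hL.numPos, numPos_cons, if_neg hP] at h
  exact ⟨L, P, R, rfl, hL, hP, numPos_eq_zero.mp (by omega)⟩

theorem exists_of_numPos_eq_two {l : List StringState} (h : numPos l = 2) :
    ∃ L P M Q R, l = L ++ P :: (M ++ Q :: R) ∧ AllNeg L ∧ ¬ P.n < 0 ∧ AllNeg M ∧ ¬ Q.n < 0 ∧
      AllNeg R := by
  obtain ⟨L, P, R', rfl, hL, hP⟩ := exists_of_numPos_pos (by omega : 0 < numPos l)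
  rw [numPos_append, hL.numPos, numPos_cons, if_neg hP] at h
  obtain ⟨M, Q, R, rfl, hM, hQ, hR⟩ := exists_of_numPos_eq_one (by omega : numPos R' = 1)
  exact ⟨L, P, M, Q, R, rfl, hL, hP, hM, hQ, hR⟩

namespace LineModel

variable (r : StringState → ℕ) (N : ℕ) (hr : ∀ s, r s < N)

/-- The sum over trees with the homotopy applied at the root. -/
abbrev G (l : List StringState) : Cochain := (lineData r N hr).mor l

/-- The sum over trees. -/
abbrev Lam (l : List StringState) : Cochain := (lineData r N hr).pre l

theorem G_single (s : StringState) : G r N hr [s] = Cochain.gen (s.n < 0) (r s) := rfl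

theorem G_eq {l : List StringState} (hl : 2 ≤ l.length) :
    G r N hr l = -Cochain.hom ((total l).n < 0) (r (total l)) N (Lam r N hr l) :=
  (lineData r N hr).mor_eq l hl

theorem Lam_eq (l : List StringState) :
    Lam r N hr l = splitSum (fun a b => Cochain.inv (G r N hr a) * G r N hr b) l := rfl

theorem Lam_eq_zero {l : List StringState}
    (h : ∀ a b, a ≠ [] → b ≠ [] → a.length < l.length → b.length < l.length → a ++ b = l →
      Cochain.inv (G r N hr a) * G r N hr b = 0) : Lam r N hr l = 0 := by
  rw [Lam_eq]
  refine (HomotopyData.splitSum_congr_proper (f' := fun _ _ => 0) (by simp) (by simp) h).trans ?_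
  exact splitSum_eq_zero fun _ _ _ => rfl

/-- Trees vanish unless the number of inputs with `n > 0` is one, or the tree is trivial. -/
theorem G_class (l : List StringState) :
    (2 ≤ numPos l → G r N hr l = 0) ∧ (numPos l = 1 → ∀ e, (G r N hr l).w e = 0) ∧
      (numPos l = 0 → (∀ j, (G r N hr l).f j = 0) ∧ (2 ≤ l.length → G r N hr l = 0)) := by
  -- An input with `n < 0` has degree 1, any other degree 0, and each join brings one homotopy of
  -- degree `-1`. So `G l` has degree `1 - numPos l`, and a nontrivial tree on inputs of degree 1
  -- alone already contains a product of two 1-cochains.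
  induction hn : l.length using Nat.strong_induction_on generalizing l with
  | _ n ih =>
    subst hn
    rcases Nat.lt_or_ge l.length 2 with h2 | h2
    · match l, h2 with
      | [], _ => simp
      | [s], _ =>
        rw [G_single]
        by_cases hs : s.n < 0
        · simp [numPos_cons, hs, Cochain.gen]
        · simp [numPos_cons, hs, Cochain.gen]
    · have hG := G_eq r N hr h2
      have h0 : Lam r N hr l = 0 → G r N hr l = 0 := fun h => by rw [hG, h, map_zero, neg_zero]
      refine ⟨fun hp => ?_, fun _ e => by rw [hG]; simp, fun hp => ?_⟩
      · rcases Nat.lt_or_ge 2 (numPos l) with h3 | h3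
        · refine h0 (Lam_eq_zero r N hr fun a b _ _ ha hb hab => ?_)
          rw [← hab, numPos_append] at h3
          rcases Nat.lt_or_ge 1 (numPos a) with h4 | h4
          · rw [(ih _ ha a rfl).1 h4]; simp
          · rw [(ih _ hb b rfl).1 (by omega)]; simp
        -- Here `numPos l = 2`: the product is a 0-cochain, and the homotopy annihilates it.
        · have hw : ∀ e, (Lam r N hr l).w e = 0 := fun e => by
            rw [Lam_eq, Cochain.splitSum_w]
            refine (HomotopyData.splitSum_congr_proper (f' := fun _ _ => 0) (by simp) (by simp)
              fun a b _ _ ha hb hab => ?_).trans (splitSum_eq_zero fun _ _ _ => rfl)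
            rw [← hab, numPos_append] at h3 hp
            rcases lt_trichotomy (numPos a) 1 with h4 | h4 | h4
            · rw [(ih _ hb b rfl).1 (by omega)]; simp
            · simp [(ih _ ha a rfl).2.1 h4 e, (ih _ hb b rfl).2.1 (by omega) e]
            · rw [(ih _ ha a rfl).1 (by omega)]; simp
          have hps : ∀ j, (Lam r N hr l).psum j = 0 := fun j => by simp [Cochain.psum, hw]
          rw [hG]
          ext j
          · simp [Cochain.hom_f, hps]
          · simp
      · have : G r N hr l = 0 := by
          refine h0 (Lam_eq_zero r N hr fun a b _ _ ha hb hab => ?_)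
          rw [← hab, numPos_append] at hp
          have h4 := (ih _ ha a rfl).2.2 (by omega)
          have h5 := (ih _ hb b rfl).2.2 (by omega)
          ext e
          · simp [h4.1]
          · simp [h4.1, h5.1]
        exact ⟨fun j => by rw [this]; rfl, fun _ => this⟩

theorem G_neg {l : List StringState} (h : AllNeg l) (hl : 2 ≤ l.length) : G r N hr l = 0 :=
  ((G_class r N hr l).2.2 h.numPos).2 hl

/-- The coefficient of a list. -/
abbrev coef (l : List StringState) : ℤ := (lineData r N hr).coeff l

theorem coef_eq (l : List StringState) : coef r N hr l =
    if (total l).n < 0 then (Lam r N hr l).psum N else (Lam r N hr l).f (r (total l) + 1) := rfl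

/-- The product at the root has degree `2 - numPos l`, while the projection reads degree 1 for
outgoing `n < 0` and degree 0 otherwise. -/
theorem coef_eq_zero {l : List StringState}
    (h : ¬ (numPos l = 1 ∧ (total l).n < 0)) (h' : ¬ (numPos l = 2 ∧ ¬ (total l).n < 0)) :
    coef r N hr l = 0 := by
  have hf : numPos l ≠ 2 → ∀ j, (Lam r N hr l).f j = 0 := fun h2 j => by
    rw [Lam_eq, Cochain.splitSum_f]
    refine splitSum_eq_zero fun a b hab => ?_
    rw [← hab, numPos_append] at h2
    have ha := G_class r N hr a
    have hb := G_class r N hr b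
    by_cases h4 : 2 ≤ numPos a
    · simp [ha.1 h4]
    by_cases h5 : 2 ≤ numPos b
    · simp [hb.1 h5]
    by_cases h6 : numPos a = 0
    · simp [(ha.2.2 h6).1]
    · simp [(hb.2.2 (by omega)).1]
  have hw : numPos l ≠ 1 → ∀ j, (Lam r N hr l).w j = 0 := fun h2 j => by
    rw [Lam_eq, Cochain.splitSum_w]
    refine splitSum_eq_zero fun a b hab => ?_
    rw [← hab, numPos_append] at h2
    have ha := G_class r N hr a
    have hb := G_class r N hr b
    by_cases h4 : 2 ≤ numPos a
    · simp [ha.1 h4]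
    by_cases h5 : 2 ≤ numPos b
    · simp [hb.1 h5]
    by_cases h6 : numPos a = 0
    · simp [(ha.2.2 h6).1, (hb.2.2 (by omega)).1]
    · simp [ha.2.1 (by omega), hb.2.1 (by omega)]
  rw [coef_eq]
  split_ifs with hn
  · exact Finset.sum_eq_zero fun j _ => hw (fun e => h ⟨e, hn⟩) j
  · exact hf (fun e => h' ⟨e, hn⟩) _

/-- The part of a tree sum in which the first input is absorbed last. -/
def leftPart (P : StringState) (R : List StringState) : List StringState → ℕ → ℤ
  | [], _ => 0
  | x :: L, e => if e = r x then -(G r N hr (L ++ P :: R)).f (e + 1) else 0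

/-- A tree on two or more inputs with `n < 0` vanishes, so the left factor can avoid `P` only as the
single first input. Its delta cochain reads the rest at the terminal vertex `e + 1`, with a sign
from `inv`. -/
theorem Lam_one (L : List StringState) (P : StringState) (R : List StringState) (hL : AllNeg L)
    (e : ℕ) : (Lam r N hr (L ++ P :: R)).w e = leftPart r N hr P R L e +
      (splitSum (fun a b => (Cochain.inv (G r N hr (L ++ P :: a)) * G r N hr b).w e) R) := by
  rw [Lam_eq, Cochain.splitSum_w, splitSum_append_cons]
  congr 1
  match L, hL with
  | [], _ => simp [leftPart]
  | x :: L, hL =>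
    have hx : x.n < 0 := hL x (by simp)
    rw [splitSum_cons, splitSum_eq_left]
    · simp only [Cochain.mul_w, HomotopyData.mor_nil, map_zero, Cochain.zero_w,
        zero_mul, G_single, Cochain.inv_f, Cochain.inv_w, leftPart, Cochain.gen, if_pos hx,
        Pi.single_apply, zero_add, Pi.zero_apply]
      split_ifs <;> simp
    · rintro y a b rfl
      rw [G_neg r N hr (l := x :: y :: a) (fun s hs => hL s (by simp at hs ⊢; tauto)) (by simp)]
      simp

/-- Likewise only the last input can be split off on the right. Now the rest is read at the initial
vertex `e`, without a sign. -/
theorem Lam_right_concat (L : List StringState) (P : StringState) (R : List StringState)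
    (z : StringState) (hR : AllNeg (R ++ [z])) (e : ℕ) :
    (splitSum (fun a b => (Cochain.inv (G r N hr (L ++ P :: a)) * G r N hr b).w e) (R ++ [z])) =
      if e = r z then (G r N hr (L ++ P :: R)).f e else 0 := by
  have hz : z.n < 0 := hR z (by simp)
  rw [splitSum_append_cons, splitSum_eq_right]
  · simp only [splitSum_nil, Cochain.mul_w, HomotopyData.mor_nil, Cochain.zero_f, Cochain.zero_w,
      mul_zero, List.nil_append, G_single, Cochain.inv_f, Cochain.inv_w, Cochain.gen, if_pos hz,
      Pi.single_apply, Pi.zero_apply]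
    split_ifs <;> simp
  · rintro a y b rfl
    rw [G_neg r N hr (l := y :: b ++ [z]) (fun s hs => hR s (by simp at hs ⊢; tauto)) (by simp)]
    simp

end LineModel

end

noncomputable section

open StringState

/-! ### Generic lists of states -/

namespace StringState

/-- The velocity `v = n y - m` of the state `s` at the point `y`. -/
def vel (s : StringState) (y : ℝ) : ℝ := (s.n : ℝ) * y - (s.m : ℝ)

theorem vel_fuse (s t : StringState) (y : ℝ) : (s.fuse t).vel y = s.vel y + t.vel y := by
  simp only [vel, fuse]; push_cast; ring

theorem vel_eq {s : StringState} (h : s.n ≠ 0) (y : ℝ) : s.vel y = (s.n : ℝ) * (y - s.pos) := by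
  have : (s.n : ℝ) ≠ 0 := by exact_mod_cast h
  rw [vel, pos]; field_simp

theorem vel_pos {s : StringState} (h : s.n ≠ 0) : s.vel s.pos = 0 := by
  rw [vel_eq h, sub_self, mul_zero]

theorem vel_append (a b : List StringState) (y : ℝ) :
    (total (a ++ b)).vel y = (total a).vel y + (total b).vel y := by
  rw [total_append, vel_fuse]

theorem vel_cons (s : StringState) (b : List StringState) (y : ℝ) :
    (total (s :: b)).vel y = s.vel y + (total b).vel y := by
  rw [← List.singleton_append, vel_append, total_single]

theorem n_append (a b : List StringState) : (total (a ++ b)).n = (total a).n + (total b).n := by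
  rw [total_append]; rfl

theorem n_cons (s : StringState) (b : List StringState) :
    (total (s :: b)).n = s.n + (total b).n := by
  rw [← List.singleton_append, n_append, total_single]

theorem vel_pos_iff_of_neg {s : StringState} (h : s.n < 0) {y : ℝ} : 0 < s.vel y ↔ y < s.pos := by
  have : (s.n : ℝ) < 0 := by exact_mod_cast h
  rw [vel_eq h.ne]
  constructor
  · intro h'; by_contra h2; nlinarith
  · intro h'; nlinarith

theorem vel_neg_iff_of_neg {s : StringState} (h : s.n < 0) {y : ℝ} : s.vel y < 0 ↔ s.pos < y := by
  have : (s.n : ℝ) < 0 := by exact_mod_cast h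
  rw [vel_eq h.ne]
  constructor
  · intro h'; by_contra h2; nlinarith
  · intro h'; nlinarith

theorem vel_pos_iff_of_pos {s : StringState} (h : 0 < s.n) {y : ℝ} : 0 < s.vel y ↔ s.pos < y := by
  have : (0 : ℝ) < s.n := by exact_mod_cast h
  rw [vel_eq h.ne']
  constructor
  · intro h'; by_contra h2; nlinarith
  · intro h'; nlinarith

theorem vel_neg_iff_of_pos {s : StringState} (h : 0 < s.n) {y : ℝ} : s.vel y < 0 ↔ y < s.pos := by
  have : (0 : ℝ) < s.n := by exact_mod_cast h
  rw [vel_eq h.ne']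
  constructor
  · intro h'; by_contra h2; nlinarith
  · intro h'; nlinarith

theorem vel_eq_zero_iff {s : StringState} (h : s.n ≠ 0) {y : ℝ} : s.vel y = 0 ↔ y = s.pos := by
  have : (s.n : ℝ) ≠ 0 := by exact_mod_cast h
  rw [vel_eq h, mul_eq_zero, sub_eq_zero]
  tauto

end StringState

/-- A sequence of states with pairwise distinct degrees of the line bundles, and in general position
without regard to its other lifts. -/
structure Generic (l : List StringState) : Prop where
  distinct : DistinctDegrees l
  pos_ne : ∀ a b c e : List StringState, l = a ++ b ++ c ++ e → b ≠ [] → c ≠ [] →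
    (total b).deg + (total c).deg = (total (b ++ c)).deg + 1 → (total b).pos ≠ (total c).pos

namespace Generic

variable {l b c : List StringState}

theorem sub (h : Generic l) (hb : b <:+: l) : Generic b := by
  obtain ⟨u, v, rfl⟩ := hb
  refine ⟨fun a d e he => h.distinct (u ++ a) d (e ++ v) (by simp [he]),
    fun a d e f he => h.pos_ne (u ++ a) d e (f ++ v) (by simp [he])⟩

theorem left (h : Generic (b ++ c)) : Generic b := h.sub ⟨[], c, by simp⟩

theorem right (h : Generic (b ++ c)) : Generic c := h.sub ⟨b, [], by simp⟩

theorem tail {x : StringState} (h : Generic (x :: c)) : Generic c := h.sub ⟨[x], [], by simp⟩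

theorem n_ne (h : Generic l) (hl : l ≠ []) : (total l).n ≠ 0 := h.distinct [] l [] (by simp) hl

theorem n_pos_of (h : Generic l) (hl : l ≠ []) (hn : ¬ (total l).n < 0) : 0 < (total l).n := by
  have := h.n_ne hl
  omega

theorem mem_n_ne (h : Generic l) {s : StringState} (hs : s ∈ l) : s.n ≠ 0 := by
  obtain ⟨u, v, rfl⟩ := List.append_of_mem hs
  have := h.distinct u [s] v (by simp) (by simp)
  rwa [total_single] at this

/-- The degrees satisfy `1 + 1 = 1 + 1`. -/
theorem ne_of_neg (h : Generic (b ++ c)) (hb : (total b).n < 0) (hc : (total c).n < 0)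
    (hb' : b ≠ []) (hc' : c ≠ []) : (total b).pos ≠ (total c).pos := by
  refine h.pos_ne [] b c [] (by simp) hb' hc' ?_
  have := n_append b c
  rw [deg, deg, deg, if_pos hb, if_pos hc, if_pos (by omega)]

/-- The degrees satisfy `1 + 0 = 0 + 1`. This and `ne_of_neg` exhaust general position: a negative
and a positive block with negative sum may lie at the same point, as may two positive blocks. -/
theorem ne_of_pos (h : Generic (b ++ c)) (hn : 0 < (total (b ++ c)).n)
    (hbc : (total b).n < 0 ∨ (total c).n < 0)
    (hb' : b ≠ []) (hc' : c ≠ []) : (total b).pos ≠ (total c).pos := by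
  refine h.pos_ne [] b c [] (by simp) hb' hc' ?_
  have := n_append b c
  rw [deg, deg, deg, if_neg (c := (total (b ++ c)).n < 0) (by omega)]
  rcases hbc with h1 | h1
  · rw [if_pos h1, if_neg (by omega)]; rfl
  · rw [if_pos h1, if_neg (by omega)]

end Generic

/-- The map `r` reflects the order of the points of the sub-blocks of `l`. -/
def Compat (r : StringState → ℕ) (l : List StringState) : Prop :=
  ∀ b c, b <:+: l → c <:+: l → b ≠ [] → c ≠ [] →
    (r (total b) < r (total c) ↔ (total b).pos < (total c).pos)

theorem singleton_infix {X : Type*} {s : X} {l : List X} (h : s ∈ l) : [s] <:+: l := by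
  obtain ⟨u, v, rfl⟩ := List.append_of_mem h
  exact ⟨u, v, by simp⟩

namespace Compat

variable {r : StringState → ℕ} {l b : List StringState}

theorem sub (h : Compat r l) (hb : b <:+: l) : Compat r b :=
  fun c d hc hd => h c d (hc.trans hb) (hd.trans hb)

theorem lt (h : Compat r l) {s t : StringState} (hs : s ∈ l) (ht : t ∈ l) :
    r s < r t ↔ s.pos < t.pos := by
  simpa using h [s] [t] (singleton_infix hs) (singleton_infix ht) (by simp) (by simp)

theorem lt_total (h : Compat r l) {s : StringState} (hs : s ∈ l) (hb : b <:+: l) (hb' : b ≠ []) :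
    r s < r (total b) ↔ s.pos < (total b).pos := by
  simpa using h [s] b (singleton_infix hs) hb (by simp) hb'

theorem total_lt (h : Compat r l) {s : StringState} (hs : s ∈ l) (hb : b <:+: l) (hb' : b ≠ []) :
    r (total b) < r s ↔ (total b).pos < s.pos := by
  simpa using h b [s] hb (singleton_infix hs) hb' (by simp)

end Compat

/-! ### Trees with one incoming state with `n > 0` -/

/-- The points increase along the list. -/
def Inc (l : List StringState) : Prop := l.Pairwise fun a b => a.pos < b.pos

/-- The points decrease along the list. -/
def Dec (l : List StringState) : Prop := l.Pairwise fun a b => b.pos < a.pos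

/-- The state `P` can move to the right, absorbing the states `L` on its left and `R` on its right,
and what comes out moves on to the right. -/
def RGood (L : List StringState) (P : StringState) (R : List StringState) : Prop :=
  Dec (L ++ [P]) ∧ Inc (P :: R) ∧ ((total (L ++ P :: R)).n < 0 →
    ∀ s ∈ L ++ P :: R, s.pos < (total (L ++ P :: R)).pos)

/-- The mirror image of `RGood`. -/
def LGood (L : List StringState) (P : StringState) (R : List StringState) : Prop :=
  Inc (L ++ [P]) ∧ Dec (P :: R) ∧ ((total (L ++ P :: R)).n < 0 →
    ∀ s ∈ L ++ P :: R, (total (L ++ P :: R)).pos < s.pos)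

/-- What comes out of `L, P, R` moves to the right through the point `y`. -/
def RReach (L : List StringState) (P : StringState) (R : List StringState) (y : ℝ) : Prop :=
  RGood L P R ∧ (∀ s ∈ L ++ P :: R, s.pos ≤ y) ∧ 0 < (total (L ++ P :: R)).vel y

/-- What comes out of `L, P, R` moves to the left through the point `y`. -/
def LReach (L : List StringState) (P : StringState) (R : List StringState) (y : ℝ) : Prop :=
  LGood L P R ∧ (∀ s ∈ L ++ P :: R, y ≤ s.pos) ∧ (total (L ++ P :: R)).vel y < 0

/-- Each velocity is `n (y - pos)` with `n < 0`, hence it decreases when the point is moved left to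
the common bound `p`. -/
theorem AllNeg.le_vel {l : List StringState} (hl : AllNeg l) {p : ℝ} (h : ∀ s ∈ l, p ≤ s.pos)
    (y : ℝ) : ((total l).n : ℝ) * (y - p) ≤ (total l).vel y := by
  induction l with
  | nil => simp [total, vel]
  | cons s l ih =>
    have hs := hl s (by simp)
    have hs' : (s.n : ℝ) < 0 := by exact_mod_cast hs
    have := ih (fun t ht => hl t (by simp [ht])) fun t ht => h t (by simp [ht])
    rw [vel_cons, n_cons, vel_eq hs.ne]
    push_cast
    nlinarith [h s (by simp)]

theorem AllNeg.vel_le {l : List StringState} (hl : AllNeg l) {p : ℝ} (h : ∀ s ∈ l, s.pos ≤ p)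
    (y : ℝ) : (total l).vel y ≤ ((total l).n : ℝ) * (y - p) := by
  induction l with
  | nil => simp [total, vel]
  | cons s l ih =>
    have hs := hl s (by simp)
    have hs' : (s.n : ℝ) < 0 := by exact_mod_cast hs
    have := ih (fun t ht => hl t (by simp [ht])) fun t ht => h t (by simp [ht])
    rw [vel_cons, n_cons, vel_eq hs.ne]
    push_cast
    nlinarith [h s (by simp)]

section OnePositive

variable {L R : List StringState} {P : StringState}

theorem Dec.lt_of_mem (h : Dec (L ++ [P])) {s : StringState} (hs : s ∈ L) : P.pos < s.pos :=
  (List.pairwise_append.mp h).2.2 s hs P (by simp)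

theorem Inc.lt_of_mem (h : Inc (L ++ [P])) {s : StringState} (hs : s ∈ L) : s.pos < P.pos :=
  (List.pairwise_append.mp h).2.2 s hs P (by simp)

theorem Inc.lt_of_mem_tail (h : Inc (P :: R)) {s : StringState} (hs : s ∈ R) : P.pos < s.pos :=
  (List.pairwise_cons.mp h).1 s hs

theorem Dec.lt_of_mem_tail (h : Dec (P :: R)) {s : StringState} (hs : s ∈ R) : s.pos < P.pos :=
  (List.pairwise_cons.mp h).1 s hs

/-- `P` is the leftmost input, so all states with `n < 0` may be moved to `P.pos`, where the
velocity of `P` is given exactly. -/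
theorem RGood.le_vel (h : RGood L P R) (hL : AllNeg L) (hR : AllNeg R) (hP : 0 < P.n) (y : ℝ) :
    ((total (L ++ P :: R)).n : ℝ) * (y - P.pos) ≤ (total (L ++ P :: R)).vel y := by
  have h1 := hL.le_vel (p := P.pos) (fun s hs => (h.1.lt_of_mem hs).le) y
  have h2 := hR.le_vel (p := P.pos) (fun s hs => (h.2.1.lt_of_mem_tail hs).le) y
  rw [vel_append, vel_cons, n_append, n_cons, vel_eq hP.ne']
  push_cast
  linarith

theorem LGood.vel_le (h : LGood L P R) (hL : AllNeg L) (hR : AllNeg R) (hP : 0 < P.n) (y : ℝ) :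
    (total (L ++ P :: R)).vel y ≤ ((total (L ++ P :: R)).n : ℝ) * (y - P.pos) := by
  have h1 := hL.vel_le (p := P.pos) (fun s hs => (h.1.lt_of_mem hs).le) y
  have h2 := hR.vel_le (p := P.pos) (fun s hs => (h.2.1.lt_of_mem_tail hs).le) y
  rw [vel_append, vel_cons, n_append, n_cons, vel_eq hP.ne']
  push_cast
  linarith

/-- In the right moving case the velocity is positive at each input different from `P`. -/
theorem RGood.vel_pos (h : RGood L P R) (hg : Generic (L ++ P :: R)) (hL : AllNeg L)
    (hR : AllNeg R) (hP : 0 < P.n) {s : StringState} (hs : s ∈ L ∨ s ∈ R) :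
    0 < (total (L ++ P :: R)).vel s.pos := by
  by_cases hn : (total (L ++ P :: R)).n < 0
  · rw [vel_pos_iff_of_neg hn]
    exact h.2.2 hn s (by simp; tauto)
  · have hn' := hg.n_pos_of (by simp) hn
    have h1 : (0 : ℝ) < (total (L ++ P :: R)).n := by exact_mod_cast hn'
    have h2 : P.pos < s.pos := by
      rcases hs with hs | hs
      exacts [h.1.lt_of_mem hs, h.2.1.lt_of_mem_tail hs]
    have := h.le_vel hL hR hP s.pos
    nlinarith

theorem LGood.vel_neg (h : LGood L P R) (hg : Generic (L ++ P :: R)) (hL : AllNeg L)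
    (hR : AllNeg R) (hP : 0 < P.n) {s : StringState} (hs : s ∈ L ∨ s ∈ R) :
    (total (L ++ P :: R)).vel s.pos < 0 := by
  by_cases hn : (total (L ++ P :: R)).n < 0
  · rw [vel_neg_iff_of_neg hn]
    exact h.2.2 hn s (by simp; tauto)
  · have hn' := hg.n_pos_of (by simp) hn
    have h1 : (0 : ℝ) < (total (L ++ P :: R)).n := by exact_mod_cast hn'
    have h2 : s.pos < P.pos := by
      rcases hs with hs | hs
      exacts [h.1.lt_of_mem hs, h.2.1.lt_of_mem_tail hs]
    have := h.vel_le hL hR hP s.pos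
    nlinarith

/-- A state that moves to the right absorbs a state `x` on its left. -/
theorem RReach.cons {x : StringState} (h : RReach L P R x.pos) (hg : Generic (x :: L ++ P :: R))
    (hx : x.n < 0) (hL : AllNeg L) (hP : 0 < P.n) : RReach (x :: L) P R x.pos := by
  obtain ⟨⟨hd, hi, -⟩, hle, hv⟩ := h
  -- At its own point `x` has velocity zero, so absorbing it there leaves the velocity unchanged.
  have hv' : 0 < (total (x :: L ++ P :: R)).vel x.pos := by
    rw [List.cons_append, vel_cons, StringState.vel_pos hx.ne, zero_add]
    exact hv
  have hPx : L = [] → P.pos < x.pos := by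
    rintro rfl
    refine lt_of_le_of_ne (hle P (by simp)) fun e => ?_
    match R with
    | [] => simp [← e, StringState.vel_pos hP.ne'] at hv
    | z :: R =>
      have := hi.lt_of_mem_tail (s := z) (by simp)
      linarith [hle z (by simp)]
  have hdec : Dec (x :: L ++ [P]) := by
    refine List.pairwise_cons.mpr ⟨?_, hd⟩
    match L, hPx, hd, hL with
    | [], hPx, _, _ => simpa using hPx rfl
    | t :: L, _, hd, hL =>
      have ht : t.pos < x.pos := by
        -- Neighbouring states with `n < 0` have distinct points by general position, so the weak
        -- order is strict.
        refine lt_of_le_of_ne (hle t (by simp)) fun e => ?_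
        have := (hg.sub (b := [x] ++ [t]) ⟨[], L ++ P :: R, by simp⟩).ne_of_neg
          (by simpa using hx) (by simpa using hL t (by simp)) (by simp) (by simp)
        simp [e] at this
      intro s hs
      rcases List.mem_cons.mp (show s ∈ t :: (L ++ [P]) from hs) with rfl | hs
      · exact ht
      · exact ((List.pairwise_cons.mp hd).1 s hs).trans ht
  refine ⟨⟨hdec, hi, fun hn s hs => ?_⟩, fun s hs => ?_, hv'⟩
  · rw [vel_pos_iff_of_neg hn] at hv'
    refine lt_of_le_of_lt ?_ hv'
    rw [List.cons_append, List.mem_cons] at hs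
    rcases hs with rfl | hs
    exacts [le_rfl, hle s hs]
  · rw [List.cons_append, List.mem_cons] at hs
    rcases hs with rfl | hs
    exacts [le_rfl, hle s hs]

theorem LReach.cons {x : StringState} (h : LReach L P R x.pos) (hg : Generic (x :: L ++ P :: R))
    (hx : x.n < 0) (hL : AllNeg L) (hP : 0 < P.n) : LReach (x :: L) P R x.pos := by
  obtain ⟨⟨hd, hi, -⟩, hle, hv⟩ := h
  have hv' : (total (x :: L ++ P :: R)).vel x.pos < 0 := by
    rw [List.cons_append, vel_cons, StringState.vel_pos hx.ne, zero_add]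
    exact hv
  have hPx : L = [] → x.pos < P.pos := by
    rintro rfl
    refine lt_of_le_of_ne (hle P (by simp)) fun e => ?_
    match R with
    | [] => simp [e, StringState.vel_pos hP.ne'] at hv
    | z :: R =>
      have := hi.lt_of_mem_tail (s := z) (by simp)
      linarith [hle z (by simp)]
  have hdec : Inc (x :: L ++ [P]) := by
    refine List.pairwise_cons.mpr ⟨?_, hd⟩
    match L, hPx, hd, hL with
    | [], hPx, _, _ => simpa using hPx rfl
    | t :: L, _, hd, hL =>
      have ht : x.pos < t.pos := by
        refine lt_of_le_of_ne (hle t (by simp)) fun e => ?_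
        have := (hg.sub (b := [x] ++ [t]) ⟨[], L ++ P :: R, by simp⟩).ne_of_neg
          (by simpa using hx) (by simpa using hL t (by simp)) (by simp) (by simp)
        simp [e] at this
      intro s hs
      rcases List.mem_cons.mp (show s ∈ t :: (L ++ [P]) from hs) with rfl | hs
      · exact ht
      · exact ht.trans ((List.pairwise_cons.mp hd).1 s hs)
  refine ⟨⟨hdec, hi, fun hn s hs => ?_⟩, fun s hs => ?_, hv'⟩
  · rw [vel_neg_iff_of_neg hn] at hv'
    refine lt_of_lt_of_le hv' ?_
    rw [List.cons_append, List.mem_cons] at hs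
    rcases hs with rfl | hs
    exacts [le_rfl, hle s hs]
  · rw [List.cons_append, List.mem_cons] at hs
    rcases hs with rfl | hs
    exacts [le_rfl, hle s hs]

/-- A state that moves to the right absorbs a state `z` on its right. -/
theorem RReach.concat {z : StringState} (h : RReach L P R z.pos)
    (hg : Generic (L ++ P :: (R ++ [z]))) (hz : z.n < 0) (hR : AllNeg R) (hP : 0 < P.n) :
    RReach L P (R ++ [z]) z.pos := by
  obtain ⟨⟨hd, hi, -⟩, hle, hv⟩ := h
  have hv' : 0 < (total (L ++ P :: (R ++ [z]))).vel z.pos := by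
    rw [← List.cons_append, ← List.append_assoc, vel_append, total_single,
      StringState.vel_pos hz.ne, add_zero]
    exact hv
  have hPx : R = [] → P.pos < z.pos := by
    rintro rfl
    refine lt_of_le_of_ne (hle P (by simp)) fun e => ?_
    match L with
    | [] => simp [← e, StringState.vel_pos hP.ne'] at hv
    | t :: L =>
      have := hd.lt_of_mem (s := t) (by simp)
      linarith [hle t (by simp)]
  have hinc : Inc (P :: R ++ [z]) := by
    refine List.pairwise_append.mpr ⟨hi, by simp, ?_⟩
    rcases List.eq_nil_or_concat' R with rfl | ⟨R, t, rfl⟩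
    · simpa using hPx rfl
    · have ht : t.pos < z.pos := by
        refine lt_of_le_of_ne (hle t (by simp)) fun e => ?_
        have := (hg.sub (b := [t] ++ [z]) ⟨L ++ P :: R, [], by simp⟩).ne_of_neg
          (by simpa using hR t (by simp)) (by simpa using hz) (by simp) (by simp)
        simp [e] at this
      intro s hs u hu
      obtain rfl : u = z := by simpa using hu
      rw [← List.cons_append, List.mem_append, List.mem_singleton] at hs
      rcases hs with hs | rfl
      · rw [Inc, ← List.cons_append] at hi
        exact ((List.pairwise_append.mp hi).2.2 s hs t (by simp)).trans ht
      · exact ht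
  have hmem : ∀ s ∈ L ++ P :: (R ++ [z]), s.pos ≤ z.pos := fun s hs => by
    rw [← List.cons_append, ← List.append_assoc, List.mem_append, List.mem_singleton] at hs
    rcases hs with hs | rfl
    exacts [hle s hs, le_rfl]
  refine ⟨⟨hd, hinc, fun hn s hs => ?_⟩, hmem, hv'⟩
  rw [vel_pos_iff_of_neg hn] at hv'
  exact lt_of_le_of_lt (hmem s hs) hv'

theorem LReach.concat {z : StringState} (h : LReach L P R z.pos)
    (hg : Generic (L ++ P :: (R ++ [z]))) (hz : z.n < 0) (hR : AllNeg R) (hP : 0 < P.n) :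
    LReach L P (R ++ [z]) z.pos := by
  obtain ⟨⟨hd, hi, -⟩, hle, hv⟩ := h
  have hv' : (total (L ++ P :: (R ++ [z]))).vel z.pos < 0 := by
    rw [← List.cons_append, ← List.append_assoc, vel_append, total_single,
      StringState.vel_pos hz.ne, add_zero]
    exact hv
  have hPx : R = [] → z.pos < P.pos := by
    rintro rfl
    refine lt_of_le_of_ne (hle P (by simp)) fun e => ?_
    match L with
    | [] => simp [e, StringState.vel_pos hP.ne'] at hv
    | t :: L =>
      have := hd.lt_of_mem (s := t) (by simp)
      linarith [hle t (by simp)]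
  have hinc : Dec (P :: R ++ [z]) := by
    refine List.pairwise_append.mpr ⟨hi, by simp, ?_⟩
    rcases List.eq_nil_or_concat' R with rfl | ⟨R, t, rfl⟩
    · simpa using hPx rfl
    · have ht : z.pos < t.pos := by
        refine lt_of_le_of_ne (hle t (by simp)) fun e => ?_
        have := (hg.sub (b := [t] ++ [z]) ⟨L ++ P :: R, [], by simp⟩).ne_of_neg
          (by simpa using hR t (by simp)) (by simpa using hz) (by simp) (by simp)
        simp [e] at this
      intro s hs u hu
      obtain rfl : u = z := by simpa using hu
      rw [← List.cons_append, List.mem_append, List.mem_singleton] at hs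
      rcases hs with hs | rfl
      · rw [Dec, ← List.cons_append] at hi
        exact ht.trans ((List.pairwise_append.mp hi).2.2 s hs t (by simp))
      · exact ht
  have hmem : ∀ s ∈ L ++ P :: (R ++ [z]), z.pos ≤ s.pos := fun s hs => by
    rw [← List.cons_append, ← List.append_assoc, List.mem_append, List.mem_singleton] at hs
    rcases hs with hs | rfl
    exacts [hle s hs, le_rfl]
  refine ⟨⟨hd, hinc, fun hn s hs => ?_⟩, hmem, hv'⟩
  rw [vel_neg_iff_of_neg hn] at hv'
  exact lt_of_lt_of_le hv' (hmem s hs)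

/-- The inputs before the absorption of `x` are good. -/
theorem RGood.of_cons {x : StringState} (h : RGood (x :: L) P R) (hg : Generic (x :: L ++ P :: R))
    (hL : AllNeg (x :: L)) (hR : AllNeg R) (hP : 0 < P.n)
    (hle : ∀ s ∈ L ++ P :: R, s.pos ≤ x.pos) : RReach L P R x.pos := by
  have hv := h.vel_pos hg hL hR hP (s := x) (by simp)
  rw [List.cons_append, vel_cons, StringState.vel_pos (hL x (by simp)).ne, zero_add] at hv
  refine ⟨⟨(List.pairwise_cons.mp h.1).2, h.2.1, fun hn s hs => ?_⟩, hle, hv⟩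
  rw [vel_pos_iff_of_neg hn] at hv
  exact lt_of_le_of_lt (hle s hs) hv

theorem LGood.of_cons {x : StringState} (h : LGood (x :: L) P R) (hg : Generic (x :: L ++ P :: R))
    (hL : AllNeg (x :: L)) (hR : AllNeg R) (hP : 0 < P.n)
    (hle : ∀ s ∈ L ++ P :: R, x.pos ≤ s.pos) : LReach L P R x.pos := by
  have hv := h.vel_neg hg hL hR hP (s := x) (by simp)
  rw [List.cons_append, vel_cons, StringState.vel_pos (hL x (by simp)).ne, zero_add] at hv
  refine ⟨⟨(List.pairwise_cons.mp h.1).2, h.2.1, fun hn s hs => ?_⟩, hle, hv⟩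
  rw [vel_neg_iff_of_neg hn] at hv
  exact lt_of_lt_of_le hv (hle s hs)

theorem RGood.of_concat {z : StringState} (h : RGood L P (R ++ [z]))
    (hg : Generic (L ++ P :: (R ++ [z]))) (hL : AllNeg L) (hR : AllNeg (R ++ [z])) (hP : 0 < P.n)
    (hle : ∀ s ∈ L ++ P :: R, s.pos ≤ z.pos) : RReach L P R z.pos := by
  have hv := h.vel_pos hg hL hR hP (s := z) (by simp)
  rw [← List.cons_append, ← List.append_assoc, vel_append, total_single,
      StringState.vel_pos (hR z (by simp)).ne, add_zero] at hv
  refine ⟨⟨h.1, (List.pairwise_append.mp (show (P :: R ++ [z]).Pairwise _ from h.2.1)).1, fun hn s hs => ?_⟩, hle, hv⟩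
  rw [vel_pos_iff_of_neg hn] at hv
  exact lt_of_le_of_lt (hle s hs) hv

theorem LGood.of_concat {z : StringState} (h : LGood L P (R ++ [z]))
    (hg : Generic (L ++ P :: (R ++ [z]))) (hL : AllNeg L) (hR : AllNeg (R ++ [z])) (hP : 0 < P.n)
    (hle : ∀ s ∈ L ++ P :: R, z.pos ≤ s.pos) : LReach L P R z.pos := by
  have hv := h.vel_neg hg hL hR hP (s := z) (by simp)
  rw [← List.cons_append, ← List.append_assoc, vel_append, total_single,
      StringState.vel_pos (hR z (by simp)).ne, add_zero] at hv
  refine ⟨⟨h.1, (List.pairwise_append.mp (show (P :: R ++ [z]).Pairwise _ from h.2.1)).1, fun hn s hs => ?_⟩, hle, hv⟩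
  rw [vel_neg_iff_of_neg hn] at hv
  exact lt_of_lt_of_le hv (hle s hs)

/-- The extreme point is at one of the ends, or at both. -/
theorem exists_extreme (hd : Dec (L ++ [P])) (hi : Inc (P :: R)) (hLR : L ≠ [] ∨ R ≠ []) :
    (∃ x L', L = x :: L' ∧ ∀ s ∈ L' ++ P :: R, s.pos < x.pos) ∨
    (∃ x L' z R', L = x :: L' ∧ R = R' ++ [z] ∧ x.pos = z.pos ∧
      ∀ s ∈ L' ++ P :: R', s.pos < x.pos) ∨
    ∃ z R', R = R' ++ [z] ∧ ∀ s ∈ L ++ P :: R', s.pos < z.pos := by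
  have hL : ∀ x L', L = x :: L' → ∀ s ∈ L' ++ [P], s.pos < x.pos := by
    rintro x L' rfl
    exact (List.pairwise_cons.mp hd).1
  have hR : ∀ z R', R = R' ++ [z] → ∀ s ∈ P :: R', s.pos < z.pos := by
    rintro z R' rfl s hs
    exact (List.pairwise_append.mp (show (P :: R' ++ [z]).Pairwise _ from hi)).2.2 s hs z (by simp)
  match L, List.eq_nil_or_concat' R with
  | [], .inl hR0 => simp [hR0] at hLR
  | x :: L', .inl hR0 => exact .inl ⟨x, L', rfl, by rw [hR0]; exact hL x L' rfl⟩
  | [], .inr ⟨R', z, hz⟩ => exact .inr (.inr ⟨z, R', hz, hR z R' hz⟩)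
  | x :: L', .inr ⟨R', z, hz⟩ =>
    have h1 := hL x L' rfl
    have h2 := hR z R' hz
    rcases lt_trichotomy z.pos x.pos with h | h | h
    · refine .inl ⟨x, L', rfl, fun s hs => ?_⟩
      rw [hz] at hs
      have : s ∈ L' ++ [P] ∨ s ∈ P :: R' ∨ s = z := by simp at hs ⊢; tauto
      rcases this with hs | hs | rfl
      exacts [h1 s hs, (h2 s hs).trans h, h]
    · refine .inr (.inl ⟨x, L', z, R', rfl, hz, h.symm, fun s hs => ?_⟩)
      have : s ∈ L' ++ [P] ∨ s ∈ P :: R' := by simp at hs ⊢; tauto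
      rcases this with hs | hs
      exacts [h1 s hs, (h2 s hs).trans_eq h]
    · refine .inr (.inr ⟨z, R', hz, fun s hs => ?_⟩)
      have : s = x ∨ s ∈ L' ++ [P] ∨ s ∈ P :: R' := by simp at hs ⊢; tauto
      rcases this with rfl | hs | hs
      exacts [h, (h1 s hs).trans h, h2 s hs]

theorem exists_extreme' (hd : Inc (L ++ [P])) (hi : Dec (P :: R)) (hLR : L ≠ [] ∨ R ≠ []) :
    (∃ x L', L = x :: L' ∧ ∀ s ∈ L' ++ P :: R, x.pos < s.pos) ∨
    (∃ x L' z R', L = x :: L' ∧ R = R' ++ [z] ∧ x.pos = z.pos ∧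
      ∀ s ∈ L' ++ P :: R', x.pos < s.pos) ∨
    ∃ z R', R = R' ++ [z] ∧ ∀ s ∈ L ++ P :: R', z.pos < s.pos := by
  have hL : ∀ x L', L = x :: L' → ∀ s ∈ L' ++ [P], x.pos < s.pos := by
    rintro x L' rfl
    exact (List.pairwise_cons.mp hd).1
  have hR : ∀ z R', R = R' ++ [z] → ∀ s ∈ P :: R', z.pos < s.pos := by
    rintro z R' rfl s hs
    exact (List.pairwise_append.mp (show (P :: R' ++ [z]).Pairwise _ from hi)).2.2 s hs z (by simp)
  match L, List.eq_nil_or_concat' R with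
  | [], .inl hR0 => simp [hR0] at hLR
  | x :: L', .inl hR0 => exact .inl ⟨x, L', rfl, by rw [hR0]; exact hL x L' rfl⟩
  | [], .inr ⟨R', z, hz⟩ => exact .inr (.inr ⟨z, R', hz, hR z R' hz⟩)
  | x :: L', .inr ⟨R', z, hz⟩ =>
    have h1 := hL x L' rfl
    have h2 := hR z R' hz
    rcases lt_trichotomy z.pos x.pos with h | h | h
    · refine .inr (.inr ⟨z, R', hz, fun s hs => ?_⟩)
      have : s = x ∨ s ∈ L' ++ [P] ∨ s ∈ P :: R' := by simp at hs ⊢; tauto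
      rcases this with rfl | hs | hs
      exacts [h, h.trans (h1 s hs), h2 s hs]
    · refine .inr (.inl ⟨x, L', z, R', rfl, hz, h.symm, fun s hs => ?_⟩)
      have : s ∈ L' ++ [P] ∨ s ∈ P :: R' := by simp at hs ⊢; tauto
      rcases this with hs | hs
      exacts [h1 s hs, h.symm.trans_lt (h2 s hs)]
    · refine .inl ⟨x, L', rfl, fun s hs => ?_⟩
      rw [hz] at hs
      have : s ∈ L' ++ [P] ∨ s ∈ P :: R' ∨ s = z := by simp at hs ⊢; tauto
      rcases this with hs | hs | rfl
      exacts [h1 s hs, h.trans (h2 s hs), h]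

end OnePositive

end

/-! ### Closed form of the tree sums with one input with `n > 0`. -/

noncomputable section

open StringState

namespace LineModel

variable (r : StringState → ℕ)

/-- What comes out of `L, P, R` moves to the right through the vertex `j`. -/
def CutR (L : List StringState) (P : StringState) (R : List StringState) (j : ℕ) : Prop :=
  RGood L P R ∧ (∀ s ∈ L ++ P :: R, r s < j) ∧
    ((total (L ++ P :: R)).n < 0 → j ≤ r (total (L ++ P :: R)))

/-- What comes out of `L, P, R` moves to the left through the vertex `j`. -/
def CutL (L : List StringState) (P : StringState) (R : List StringState) (j : ℕ) : Prop :=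
  LGood L P R ∧ (∀ s ∈ L ++ P :: R, j ≤ r s) ∧
    ((total (L ++ P :: R)).n < 0 → r (total (L ++ P :: R)) < j)

open Classical in
/-- The closed form of the tree sum with one input with `n > 0`. -/
def closedForm (L : List StringState) (P : StringState) (R : List StringState) (j : ℕ) : ℤ :=
  (if CutR r L P R j then (-1) ^ R.length else 0) + if CutL r L P R j then (-1) ^ L.length else 0

variable {r} {L R : List StringState} {P : StringState}

/-- The vertex read by an absorption on the left lies just to the right of `x`, so for motion to the
right an input at the point of `x` counts as already passed. The excluded case is a bare `P` at the
point of `x`, where the velocity is zero. -/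
theorem cutR_cons {x : StringState} (hg : Generic (x :: L ++ P :: R))
    (hc : Compat r (x :: L ++ P :: R)) (hL : AllNeg (x :: L)) (hR : AllNeg R) (hP : 0 < P.n)
    (hLR : L ≠ [] ∨ R ≠ [] ∨ x.pos ≠ P.pos) :
    CutR r L P R (r x + 1) ↔ RReach (x :: L) P R x.pos := by
  have hx := hL x (by simp)
  have hL' : AllNeg L := fun s hs => hL s (by simp [hs])
  have htl : L ++ P :: R <:+: x :: L ++ P :: R := ⟨[x], [], by simp⟩
  have hmem : ∀ s ∈ L ++ P :: R, r s < r x + 1 ↔ s.pos ≤ x.pos := fun s hs => by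
    rw [Nat.lt_add_one_iff, ← not_lt, ← not_lt, hc.lt (by simp) (htl.subset hs)]
  have hlt := hc.lt_total (s := x) (by simp) htl (by simp)
  constructor
  · rintro ⟨h, h1, h2⟩
    have hle : ∀ s ∈ L ++ P :: R, s.pos ≤ x.pos := fun s hs => (hmem s hs).mp (h1 s hs)
    refine RReach.cons ⟨h, hle, ?_⟩ hg hx hL' hP
    by_cases hn : (total (L ++ P :: R)).n < 0
    · rw [vel_pos_iff_of_neg hn, ← hlt]
      exact h2 hn
    · have hn' := hg.tail.n_pos_of (by simp) hn
      have h3 : (0 : ℝ) < (total (L ++ P :: R)).n := by exact_mod_cast hn'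
      have h4 : P.pos < x.pos := by
        refine lt_of_le_of_ne (hle P (by simp)) fun e => ?_
        match L, R, hLR with
        | t :: L, _, _ =>
          linarith [h.1.lt_of_mem (s := t) (by simp), hle t (by simp)]
        | [], t :: R, _ =>
          linarith [h.2.1.lt_of_mem_tail (s := t) (by simp), hle t (by simp)]
        | [], [], h => simp [e] at h
      have := h.le_vel hL' hR hP x.pos
      nlinarith
  · rintro ⟨h, h1, h2⟩
    obtain ⟨h3, h4, h5⟩ := h.of_cons hg hL hR hP fun s hs => h1 s (by simp at hs ⊢; tauto)
    refine ⟨h3, fun s hs => (hmem s hs).mpr (h4 s hs), fun hn => ?_⟩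
    rw [vel_pos_iff_of_neg hn, ← hlt] at h5
    exact h5

/-- From the same vertex, for motion to the left, all other inputs must lie strictly beyond `x`. The
opposite choices hold in `cutR_concat` and `cutL_concat`, so when the outermost inputs on both sides
share a point exactly one of the two absorptions counts. -/
theorem cutL_cons {x : StringState} (hg : Generic (x :: L ++ P :: R))
    (hc : Compat r (x :: L ++ P :: R)) (hL : AllNeg (x :: L)) (hR : AllNeg R) (hP : 0 < P.n) :
    CutL r L P R (r x + 1) ↔ LReach (x :: L) P R x.pos ∧ ∀ s ∈ L ++ P :: R, x.pos < s.pos := by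
  have hx := hL x (by simp)
  have hL' : AllNeg L := fun s hs => hL s (by simp [hs])
  have htl : L ++ P :: R <:+: x :: L ++ P :: R := ⟨[x], [], by simp⟩
  have hmem : ∀ s ∈ L ++ P :: R, r x + 1 ≤ r s ↔ x.pos < s.pos := fun s hs => by
    rw [Nat.add_one_le_iff, hc.lt (by simp) (htl.subset hs)]
  have hlt : r (total (L ++ P :: R)) < r x + 1 ↔ (total (L ++ P :: R)).pos ≤ x.pos := by
    rw [Nat.lt_add_one_iff, ← not_lt, ← not_lt, hc.lt_total (by simp) htl (by simp)]
  constructor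
  · rintro ⟨h, h1, h2⟩
    have hle : ∀ s ∈ L ++ P :: R, x.pos < s.pos := fun s hs => (hmem s hs).mp (h1 s hs)
    refine ⟨LReach.cons ⟨h, fun s hs => (hle s hs).le, ?_⟩ hg hx hL' hP, hle⟩
    by_cases hn : (total (L ++ P :: R)).n < 0
    · rw [vel_neg_iff_of_neg hn]
      refine lt_of_le_of_ne (hlt.mp (h2 hn)) fun e => ?_
      have := Generic.ne_of_neg (b := [x]) (c := L ++ P :: R) (by simpa using hg)
        (by simpa using hx) hn (by simp) (by simp)
      simp [e] at this
    · have hn' := hg.tail.n_pos_of (by simp) hn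
      have h3 : (0 : ℝ) < (total (L ++ P :: R)).n := by exact_mod_cast hn'
      have := h.vel_le hL' hR hP x.pos
      nlinarith [hle P (by simp)]
  · rintro ⟨⟨h, h1, h2⟩, h0⟩
    obtain ⟨h3, h4, h5⟩ := h.of_cons hg hL hR hP fun s hs => h1 s (by simp at hs ⊢; tauto)
    refine ⟨h3, fun s hs => (hmem s hs).mpr (h0 s hs), fun hn => ?_⟩
    rw [vel_neg_iff_of_neg hn] at h5
    exact hlt.mpr h5.le

/-- An absorption on the right is read at the vertex just to the left of `z`, so for motion to the
right inputs at the point of `z` are excluded. -/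
theorem cutR_concat {z : StringState} (hg : Generic (L ++ P :: (R ++ [z])))
    (hc : Compat r (L ++ P :: (R ++ [z]))) (hL : AllNeg L) (hR : AllNeg (R ++ [z]))
    (hP : 0 < P.n) :
    CutR r L P R (r z) ↔
      RReach L P (R ++ [z]) z.pos ∧ ∀ s ∈ L ++ P :: R, s.pos < z.pos := by
  have hz := hR z (by simp)
  have hR' : AllNeg R := fun s hs => hR s (by simp [hs])
  have htl : L ++ P :: R <:+: L ++ P :: (R ++ [z]) := ⟨[], [z], by simp⟩
  have hmem : ∀ s ∈ L ++ P :: R, r s < r z ↔ s.pos < z.pos := fun s hs => by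
    rw [hc.lt (htl.subset hs) (by simp)]
  have hlt : r z ≤ r (total (L ++ P :: R)) ↔ z.pos ≤ (total (L ++ P :: R)).pos := by
    rw [← not_lt, ← not_lt, hc.total_lt (by simp) htl (by simp)]
  constructor
  · rintro ⟨h, h1, h2⟩
    have hle : ∀ s ∈ L ++ P :: R, s.pos < z.pos := fun s hs => (hmem s hs).mp (h1 s hs)
    refine ⟨RReach.concat ⟨h, fun s hs => (hle s hs).le, ?_⟩ hg hz hR' hP, hle⟩
    by_cases hn : (total (L ++ P :: R)).n < 0
    · rw [vel_pos_iff_of_neg hn]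
      refine lt_of_le_of_ne (hlt.mp (h2 hn)) fun e => ?_
      have := Generic.ne_of_neg (b := L ++ P :: R) (c := [z]) (by simpa using hg) hn
        (by simpa using hz) (by simp) (by simp)
      simp [e] at this
    · have hn' := (hg.sub htl).n_pos_of (by simp) hn
      have h3 : (0 : ℝ) < (total (L ++ P :: R)).n := by exact_mod_cast hn'
      have := h.le_vel hL hR' hP z.pos
      nlinarith [hle P (by simp)]
  · rintro ⟨⟨h, h1, h2⟩, h0⟩
    obtain ⟨h3, h4, h5⟩ := h.of_concat hg hL hR hP fun s hs => h1 s (by simp at hs ⊢; tauto)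
    refine ⟨h3, fun s hs => (hmem s hs).mpr (h0 s hs), fun hn => ?_⟩
    rw [vel_pos_iff_of_neg hn] at h5
    exact hlt.mpr h5.le

theorem cutL_concat {z : StringState} (hg : Generic (L ++ P :: (R ++ [z])))
    (hc : Compat r (L ++ P :: (R ++ [z]))) (hL : AllNeg L) (hR : AllNeg (R ++ [z]))
    (hP : 0 < P.n) (hLR : L ≠ [] ∨ R ≠ [] ∨ z.pos ≠ P.pos) :
    CutL r L P R (r z) ↔ LReach L P (R ++ [z]) z.pos := by
  have hz := hR z (by simp)
  have hR' : AllNeg R := fun s hs => hR s (by simp [hs])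
  have htl : L ++ P :: R <:+: L ++ P :: (R ++ [z]) := ⟨[], [z], by simp⟩
  have hmem : ∀ s ∈ L ++ P :: R, r z ≤ r s ↔ z.pos ≤ s.pos := fun s hs => by
    rw [← not_lt, ← not_lt, hc.lt (htl.subset hs) (by simp)]
  have hlt := hc.total_lt (s := z) (by simp) htl (by simp)
  constructor
  · rintro ⟨h, h1, h2⟩
    have hle : ∀ s ∈ L ++ P :: R, z.pos ≤ s.pos := fun s hs => (hmem s hs).mp (h1 s hs)
    refine LReach.concat ⟨h, hle, ?_⟩ hg hz hR' hP
    by_cases hn : (total (L ++ P :: R)).n < 0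
    · rw [vel_neg_iff_of_neg hn, ← hlt]
      exact h2 hn
    · have hn' := (hg.sub htl).n_pos_of (by simp) hn
      have h3 : (0 : ℝ) < (total (L ++ P :: R)).n := by exact_mod_cast hn'
      have h4 : z.pos < P.pos := by
        refine lt_of_le_of_ne (hle P (by simp)) fun e => ?_
        match L, R, hLR with
        | t :: L, _, _ =>
          linarith [h.1.lt_of_mem (s := t) (by simp), hle t (by simp)]
        | [], t :: R, _ =>
          linarith [h.2.1.lt_of_mem_tail (s := t) (by simp), hle t (by simp)]
        | [], [], h => simp [e] at h
      have := h.vel_le hL hR' hP z.pos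
      nlinarith
  · rintro ⟨h, h1, h2⟩
    obtain ⟨h3, h4, h5⟩ := h.of_concat hg hL hR hP fun s hs => h1 s (by simp at hs ⊢; tauto)
    refine ⟨h3, fun s hs => (hmem s hs).mpr (h4 s hs), fun hn => ?_⟩
    rw [vel_neg_iff_of_neg hn, ← hlt] at h5
    exact h5

/-- Any input besides `P` lies to the right of `P` in one case and to the left in the other. -/
theorem not_rGood_and_lGood (hLR : L ≠ [] ∨ R ≠ []) (h : RGood L P R) (h' : LGood L P R) :
    False := by
  match L, R, hLR with
  | t :: L, _, _ =>
    linarith [h.1.lt_of_mem (s := t) (by simp), h'.1.lt_of_mem (s := t) (by simp)]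
  | [], t :: R, _ =>
    linarith [h.2.1.lt_of_mem_tail (s := t) (by simp), h'.2.1.lt_of_mem_tail (s := t) (by simp)]
  | [], [], h => simp at h

variable (r) (N : ℕ) (hr : ∀ s, r s < N)

/-- The shape of the tree sum with one input with `n > 0`, before the last propagation. -/
structure LamForm (L : List StringState) (P : StringState) (R : List StringState) : Prop where
  right : RGood L P R → ∃ t, (t ∈ L ∨ t ∈ R) ∧ (∀ s ∈ L ++ P :: R, s.pos ≤ t.pos) ∧
    ∀ e, (Lam r N hr (L ++ P :: R)).w e = if e = r t then -(-1) ^ R.length else 0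
  left : LGood L P R → ∃ t, (t ∈ L ∨ t ∈ R) ∧ (∀ s ∈ L ++ P :: R, t.pos ≤ s.pos) ∧
    ∀ e, (Lam r N hr (L ++ P :: R)).w e = if e = r t then (-1) ^ L.length else 0
  zero : ¬ RGood L P R → ¬ LGood L P R → ∀ e, (Lam r N hr (L ++ P :: R)).w e = 0

set_option maxHeartbeats 1000000 in
open Classical in
-- The input absorbed last is the farthest one. `exists_extreme` finds it at one end of the list, or
-- at both ends with a tie. Of the two summands of `Lam_one` exactly one survives, on the edge of
-- that input; an absorption on the left changes the sign of the shorter tree sum, one on the right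
-- does not.
theorem lamForm (hg : Generic (L ++ P :: R)) (hc : Compat r (L ++ P :: R)) (hL : AllNeg L)
    (hR : AllNeg R) (hP : 0 < P.n) (hLR : L ≠ [] ∨ R ≠ [])
    (hnt : 2 ≤ L.length + R.length ∨ ∀ s, s ∈ L ∨ s ∈ R → s.pos ≠ P.pos)
    (ih1 : ∀ x L', L = x :: L' → ∀ j, (G r N hr (L' ++ P :: R)).f j = closedForm r L' P R j)
    (ih2 : ∀ z R', R = R' ++ [z] → ∀ j, (G r N hr (L ++ P :: R')).f j = closedForm r L P R' j) :
    LamForm r N hr L P R := by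
  have hA : ∀ x L', L = x :: L' → ∀ e, leftPart r N hr P R L e = if e = r x then
      -((if RReach L P R x.pos then (-1) ^ R.length else 0) +
        if LReach L P R x.pos ∧ ∀ s ∈ L' ++ P :: R, x.pos < s.pos then (-1) ^ L'.length else 0)
      else 0 := by
    rintro x L' rfl e
    rw [leftPart]
    refine ite_congr rfl (fun he => ?_) fun _ => rfl
    rw [ih1 x L' rfl, closedForm, he, if_congr (cutR_cons hg hc hL hR hP ?_) rfl rfl,
      if_congr (cutL_cons hg hc hL hR hP) rfl rfl]
    rcases hnt with h | h
    · match L', R with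
      | _ :: _, _ => simp
      | [], _ :: _ => simp
      | [], [] => simp at h
    · exact .inr (.inr (h x (by simp)))
  have hB : ∀ z R', R = R' ++ [z] → ∀ e, splitSum
      (fun a b => (Cochain.inv (G r N hr (L ++ P :: a)) * G r N hr b).w e) R = if e = r z then
      ((if RReach L P R z.pos ∧ ∀ s ∈ L ++ P :: R', s.pos < z.pos then (-1) ^ R'.length else 0) +
        if LReach L P R z.pos then (-1) ^ L.length else 0)
      else 0 := by
    rintro z R' rfl e
    rw [Lam_right_concat _ _ _ _ _ _ _ hR]
    refine ite_congr rfl (fun he => ?_) fun _ => rfl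
    rw [ih2 z R' rfl, closedForm, he, if_congr (cutR_concat hg hc hL hR hP) rfl rfl,
      if_congr (cutL_concat hg hc hL hR hP ?_) rfl rfl]
    rcases hnt with h | h
    · match L, R' with
      | _ :: _, _ => simp
      | [], _ :: _ => simp
      | [], [] => simp at h
    · exact .inr (.inr (h z (by simp)))
  have hA0 : (∀ x L', L = x :: L' → ¬ RReach L P R x.pos ∧
      ¬ (LReach L P R x.pos ∧ ∀ s ∈ L' ++ P :: R, x.pos < s.pos)) →
      ∀ e, leftPart r N hr P R L e = 0 := by
    intro h e
    have : L = [] ∨ ∃ x L', L = x :: L' := by cases L <;> simp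
    rcases this with hl | ⟨x, L', hl⟩
    · rw [hl]; rfl
    · rw [hA x L' hl, if_neg (h x L' hl).1, if_neg (h x L' hl).2]
      simp
  have hB0 : (∀ z R', R = R' ++ [z] →
      ¬ (RReach L P R z.pos ∧ ∀ s ∈ L ++ P :: R', s.pos < z.pos) ∧ ¬ LReach L P R z.pos) →
      ∀ e, splitSum (fun a b => (Cochain.inv (G r N hr (L ++ P :: a)) * G r N hr b).w e) R = 0 := by
    intro h e
    rcases List.eq_nil_or_concat' R with hl | ⟨R', z, hl⟩
    · rw [hl]; simp
    · rw [hB z R' hl, if_neg (h z R' hl).1, if_neg (h z R' hl).2]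
      simp
  refine ⟨fun h => ?_, fun h => ?_, fun h h' e => ?_⟩
  · have hl : ∀ y, ¬ LReach L P R y := fun y hy => not_rGood_and_lGood hLR h hy.1
    have top : ∀ t, t ∈ L ∨ t ∈ R → (∀ s ∈ L ++ P :: R, s.pos ≤ t.pos) → RReach L P R t.pos :=
      fun t ht hle => ⟨h, hle, h.vel_pos hg hL hR hP ht⟩
    rcases exists_extreme h.1 h.2.1 hLR with ⟨x, L', hL', hx⟩ | ⟨x, L', z, R', hL', hR', hxz, hx⟩ |
      ⟨z, R', hR', hz⟩
    · have hle : ∀ s ∈ L ++ P :: R, s.pos ≤ x.pos := fun s hs => by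
        rw [hL', List.cons_append, List.mem_cons] at hs
        rcases hs with rfl | hs
        exacts [le_rfl, (hx s hs).le]
      have hxL : x ∈ L := by simp [hL']
      refine ⟨x, .inl hxL, hle, fun e => ?_⟩
      rw [Lam_one _ _ _ _ _ _ hL, hA x L' hL', hB0, if_pos (top x (.inl hxL) hle),
        if_neg (c := LReach L P R x.pos ∧ ∀ s ∈ L' ++ P :: R, x.pos < s.pos) fun h' => hl _ h'.1]
      · simp
      · refine fun z R' hR' => ⟨fun h' => ?_, hl _⟩
        have := h'.2 x (by simp [hL'])
        linarith [hle z (by simp [hR'])]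
    · have hle : ∀ s ∈ L ++ P :: R, s.pos ≤ x.pos := fun s hs => by
        have : s = x ∨ s = z ∨ s ∈ L' ++ P :: R' := by rw [hL', hR'] at hs; simp at hs ⊢; tauto
        rcases this with rfl | rfl | hs
        exacts [le_rfl, hxz.ge, (hx s hs).le]
      have hxL : x ∈ L := by simp [hL']
      refine ⟨x, .inl hxL, hle, fun e => ?_⟩
      rw [Lam_one _ _ _ _ _ _ hL, hA x L' hL', hB0, if_pos (top x (.inl hxL) hle),
        if_neg (c := LReach L P R x.pos ∧ ∀ s ∈ L' ++ P :: R, x.pos < s.pos) fun h' => hl _ h'.1]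
      · simp
      · refine fun z R' hR' => ⟨fun h' => ?_, hl _⟩
        have := h'.2 x (by simp [hL'])
        linarith [hle z (by simp [hR'])]
    · have hle : ∀ s ∈ L ++ P :: R, s.pos ≤ z.pos := fun s hs => by
        have : s = z ∨ s ∈ L ++ P :: R' := by rw [hR'] at hs; simp at hs ⊢; tauto
        rcases this with rfl | hs
        exacts [le_rfl, (hz s hs).le]
      have hzR : z ∈ R := by simp [hR']
      refine ⟨z, .inr hzR, hle, fun e => ?_⟩
      rw [Lam_one _ _ _ _ _ _ hL, hB z R' hR', hA0,
        if_pos (c := RReach L P R z.pos ∧ ∀ s ∈ L ++ P :: R', s.pos < z.pos)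
          ⟨top z (.inr hzR) hle, hz⟩, if_neg (hl _), hR']
      · simp [pow_succ]
      · refine fun x L' hL' => ⟨fun h' => ?_, fun h' => hl _ h'.1⟩
        have := h'.2.1 z (by simp [hR'])
        linarith [hz x (by simp [hL'])]
  · have hl : ∀ y, ¬ RReach L P R y := fun y hy => not_rGood_and_lGood hLR hy.1 h
    have top : ∀ t, t ∈ L ∨ t ∈ R → (∀ s ∈ L ++ P :: R, t.pos ≤ s.pos) → LReach L P R t.pos :=
      fun t ht hle => ⟨h, hle, h.vel_neg hg hL hR hP ht⟩
    rcases exists_extreme' h.1 h.2.1 hLR with ⟨x, L', hL', hx⟩ | ⟨x, L', z, R', hL', hR', hxz, hx⟩ |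
      ⟨z, R', hR', hz⟩
    · have hle : ∀ s ∈ L ++ P :: R, x.pos ≤ s.pos := fun s hs => by
        rw [hL', List.cons_append, List.mem_cons] at hs
        rcases hs with rfl | hs
        exacts [le_rfl, (hx s hs).le]
      have hxL : x ∈ L := by simp [hL']
      refine ⟨x, .inl hxL, hle, fun e => ?_⟩
      rw [Lam_one _ _ _ _ _ _ hL, hA x L' hL', hB0,
        if_pos (c := LReach L P R x.pos ∧ ∀ s ∈ L' ++ P :: R, x.pos < s.pos)
          ⟨top x (.inl hxL) hle, hx⟩, if_neg (hl _), hL']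
      · simp [pow_succ]
      · refine fun z R' hR' => ⟨fun h' => hl _ h'.1, fun h' => ?_⟩
        have := h'.2.1 x (by simp [hL'])
        linarith [hx z (by simp [hR'])]
    · have hle : ∀ s ∈ L ++ P :: R, z.pos ≤ s.pos := fun s hs => by
        have : s = x ∨ s = z ∨ s ∈ L' ++ P :: R' := by rw [hL', hR'] at hs; simp at hs ⊢; tauto
        rcases this with rfl | rfl | hs
        exacts [hxz.ge, le_rfl, hxz.symm.trans_le (hx s hs).le]
      have hzR : z ∈ R := by simp [hR']
      refine ⟨z, .inr hzR, hle, fun e => ?_⟩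
      rw [Lam_one _ _ _ _ _ _ hL, hB z R' hR', hA0, if_pos (top z (.inr hzR) hle),
        if_neg (c := RReach L P R z.pos ∧ ∀ s ∈ L ++ P :: R', s.pos < z.pos) fun h' => hl _ h'.1]
      · simp
      · refine fun x L' hL' => ⟨hl _, fun h' => ?_⟩
        have := h'.2 z (by simp [hR'])
        linarith [hle x (by simp [hL'])]
    · have hle : ∀ s ∈ L ++ P :: R, z.pos ≤ s.pos := fun s hs => by
        have : s = z ∨ s ∈ L ++ P :: R' := by rw [hR'] at hs; simp at hs ⊢; tauto
        rcases this with rfl | hs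
        exacts [le_rfl, (hz s hs).le]
      have hzR : z ∈ R := by simp [hR']
      refine ⟨z, .inr hzR, hle, fun e => ?_⟩
      rw [Lam_one _ _ _ _ _ _ hL, hB z R' hR', hA0, if_pos (top z (.inr hzR) hle),
        if_neg (c := RReach L P R z.pos ∧ ∀ s ∈ L ++ P :: R', s.pos < z.pos) fun h' => hl _ h'.1]
      · simp
      · refine fun x L' hL' => ⟨hl _, fun h' => ?_⟩
        have := h'.2 z (by simp [hR'])
        linarith [hz x (by simp [hL'])]
  · rw [Lam_one _ _ _ _ _ _ hL, hA0, hB0, add_zero]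
    · exact fun z R' _ => ⟨fun h1 => h h1.1.1, fun h1 => h' h1.1⟩
    · exact fun x L' _ => ⟨fun h1 => h h1.1, fun h1 => h' h1.1.1⟩

theorem psum_single {a : Cochain} {t : ℕ} {c : ℤ} (h : ∀ e, a.w e = if e = t then c else 0)
    (j : ℕ) : a.psum j = if t < j then c else 0 := by
  simp [Cochain.psum, h]

/-- If the last absorption is at the point of `P`, then there is only one. -/
theorem exists_tie (hLR : L ≠ [] ∨ R ≠ [])
    (h : ¬ (2 ≤ L.length + R.length ∨ ∀ s, s ∈ L ∨ s ∈ R → s.pos ≠ P.pos)) :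
    (∃ x, L = [x] ∧ R = [] ∧ x.pos = P.pos) ∨ ∃ z, L = [] ∧ R = [z] ∧ z.pos = P.pos := by
  push Not at h
  obtain ⟨h1, s, hs, h2⟩ := h
  match L, R with
  | [x], [] =>
    obtain rfl : s = x := by simpa using hs
    exact .inl ⟨s, rfl, rfl, h2⟩
  | [], [z] =>
    obtain rfl : s = z := by simpa using hs
    exact .inr ⟨s, rfl, rfl, h2⟩
  | [], [] => simp at hLR
  | _ :: _ :: _, _ => simp only [List.length_cons] at h1; omega
  | [_], _ :: _ => simp only [List.length_cons] at h1; omega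
  | [], _ :: _ :: _ => simp only [List.length_cons] at h1; omega

open Classical in
-- A bare `P` moves in both directions. `CutR` holds to the right of its edge and `CutL` to the
-- left, so together they give the constant function 1.
theorem closedForm_single (hP : 0 < P.n) (j : ℕ) : closedForm r [] P [] j = 1 := by
  have h1 : RGood [] P [] := ⟨by simp [Dec], by simp [Inc], by simp; omega⟩
  have h2 : LGood [] P [] := ⟨by simp [Inc], by simp [Dec], by simp; omega⟩
  have h3 : CutR r [] P [] j ↔ r P < j := by
    simp only [CutR, h1, true_and, List.nil_append, total_single]
    simp; omega
  have h4 : CutL r [] P [] j ↔ j ≤ r P := by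
    simp only [CutL, h2, true_and, List.nil_append, total_single]
    simp; omega
  rw [closedForm, if_congr h3 rfl rfl, if_congr h4 rfl rfl]
  split_ifs <;> first | omega | simp

open Classical in
/-- The closed form of the tree sum with one input with `n > 0`, and its shape before the last
propagation. -/
theorem G_f_eq (hg : Generic (L ++ P :: R)) (hc : Compat r (L ++ P :: R)) (hL : AllNeg L)
    (hR : AllNeg R) (hP : 0 < P.n) (j : ℕ) :
    (G r N hr (L ++ P :: R)).f j = closedForm r L P R j := by
  induction hn : L.length + R.length using Nat.strong_induction_on generalizing L R j with
  | _ n ih =>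
    subst hn
    by_cases hLR : L ≠ [] ∨ R ≠ []
    swap
    · push Not at hLR
      obtain ⟨rfl, rfl⟩ := hLR
      rw [closedForm_single r hP, List.nil_append, G_single, Cochain.gen, if_neg (c := P.n < 0) (by omega)]
      simp
    have hlen : 2 ≤ (L ++ P :: R).length := by
      simp only [List.length_append, List.length_cons]
      rcases hLR with h | h <;> have := List.length_pos_of_ne_nil h <;> omega
    have hG := congrArg (fun a => a.f j) (G_eq r N hr hlen)
    simp only [Cochain.neg_f, Cochain.hom_f] at hG
    have hmem : ∀ s, s ∈ L ∨ s ∈ R → s ∈ L ++ P :: R := by simp; tauto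
    by_cases hnt : 2 ≤ L.length + R.length ∨ ∀ s, s ∈ L ∨ s ∈ R → s.pos ≠ P.pos
    · have hF : LamForm r N hr L P R := by
        refine lamForm r N hr hg hc hL hR hP hLR hnt ?_ ?_
        · rintro x L' rfl j
          exact ih _ (by simp) hg.tail (hc.sub ⟨[x], [], by simp⟩)
            (fun s hs => hL s (by simp [hs])) hR j rfl
        · rintro z R' rfl j
          exact ih _ (by simp) (hg.sub ⟨[], [z], by simp⟩) (hc.sub ⟨[], [z], by simp⟩)
            hL (fun s hs => hR s (by simp [hs])) j rfl
      rw [hG, closedForm]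
      by_cases h1 : RGood L P R
      · have h2 : ¬ LGood L P R := fun h2 => not_rGood_and_lGood hLR h1 h2
        obtain ⟨t, ht, hle, hw⟩ := hF.right h1
        have htt := hc.lt_total (hmem t ht) (List.infix_refl _) (by simp)
        have htt' := hc.total_lt (hmem t ht) (List.infix_refl _) (by simp)
        -- The sign of the velocity at the last absorbed input decides on which side of it the
        -- outgoing point lies, and thus where the primitive of the delta cochain on the edge `r t`
        -- is supported.
        have hv := h1.vel_pos hg hL hR hP ht
        have hcut : CutR r L P R j ↔
            r t < j ∧ ((total (L ++ P :: R)).n < 0 → j ≤ r (total (L ++ P :: R))) := by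
          refine ⟨fun h => ⟨h.2.1 t (hmem t ht), h.2.2⟩, fun h => ⟨h1, fun s hs => ?_, h.2⟩⟩
          have : ¬ r t < r s := by rw [hc.lt (hmem t ht) hs]; exact not_lt.mpr (hle s hs)
          omega
        rw [if_neg (c := CutL r L P R j) (fun h => h2 h.1), if_congr hcut rfl rfl,
          psum_single hw, psum_single hw, psum_single hw, if_pos (hr t)]
        by_cases hn : (total (L ++ P :: R)).n < 0
        · rw [vel_pos_iff_of_neg hn, ← htt] at hv
          simp only [hn, if_true, true_imp_iff]
          split_ifs <;> omega
        · rw [vel_pos_iff_of_pos (hg.n_pos_of (by simp) hn), ← htt'] at hv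
          simp only [hn, if_false, false_imp_iff, and_true]
          rw [if_neg (c := r t < r (total (L ++ P :: R)) + 1) (by omega)]
          split_ifs <;> simp
      by_cases h2 : LGood L P R
      · obtain ⟨t, ht, hle, hw⟩ := hF.left h2
        have htt := hc.lt_total (hmem t ht) (List.infix_refl _) (by simp)
        have htt' := hc.total_lt (hmem t ht) (List.infix_refl _) (by simp)
        have hv := h2.vel_neg hg hL hR hP ht
        have hcut : CutL r L P R j ↔
            j ≤ r t ∧ ((total (L ++ P :: R)).n < 0 → r (total (L ++ P :: R)) < j) := by
          refine ⟨fun h => ⟨h.2.1 t (hmem t ht), h.2.2⟩, fun h => ⟨h2, fun s hs => ?_, h.2⟩⟩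
          have : ¬ r s < r t := by rw [hc.lt hs (hmem t ht)]; exact not_lt.mpr (hle s hs)
          omega
        rw [if_neg (c := CutR r L P R j) (fun h => h1 h.1), if_congr hcut rfl rfl,
          psum_single hw, psum_single hw, psum_single hw, if_pos (hr t)]
        by_cases hn : (total (L ++ P :: R)).n < 0
        · rw [vel_neg_iff_of_neg hn, ← htt'] at hv
          simp only [hn, if_true, true_imp_iff]
          split_ifs <;> omega
        · rw [vel_neg_iff_of_pos (hg.n_pos_of (by simp) hn), ← htt] at hv
          simp only [hn, if_false, false_imp_iff, and_true]
          rw [if_pos (c := r t < r (total (L ++ P :: R)) + 1) (by omega)]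
          split_ifs <;> omega
      · have hw := hF.zero h1 h2
        have hps : ∀ i, (Lam r N hr (L ++ P :: R)).psum i = 0 := fun i => by
          simp [Cochain.psum, hw]
        rw [if_neg (c := CutR r L P R j) (fun h => h1 h.1),
          if_neg (c := CutL r L P R j) (fun h => h2 h.1), hps, hps, hps]
        simp
    -- The tie: a single input at the point of `P`. General position forces outgoing `n < 0`, and
    -- the outgoing point is the same one. The homotopy then subtracts a step on the very edge
    -- carrying the product, so the tree sum is zero, as is the closed form.
    · have hw : ∃ t c, (t ∈ L ∨ t ∈ R) ∧ t.pos = P.pos ∧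
          (total (L ++ P :: R)).n < 0 ∧ (total (L ++ P :: R)).pos = t.pos ∧ ∀ e,
          (Lam r N hr (L ++ P :: R)).w e = if e = r t then c else 0 := by
        rcases exists_tie hLR hnt with ⟨x, rfl, rfl, hx⟩ | ⟨z, rfl, rfl, hz⟩
        · have hxn := hL x (by simp)
          have hn : (total ([x] ++ [P])).n < 0 := by
            by_contra hn
            exact hg.ne_of_pos (hg.n_pos_of (by simp) hn) (.inl (by simpa using hxn)) (by simp)
              (by simp) (by simpa using hx)
          refine ⟨x, -1, by simp, hx, hn, ?_, fun e => ?_⟩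
          · rw [eq_comm, ← vel_eq_zero_iff hn.ne, vel_append, total_single, total_single,
              StringState.vel_pos hxn.ne, hx, StringState.vel_pos hP.ne', add_zero]
          · rw [Lam_one _ _ _ _ _ _ hL, leftPart, List.nil_append, G_single, Cochain.gen,
              if_neg (c := P.n < 0) (by omega)]
            simp
        · have hzn := hR z (by simp)
          have hn : (total ([P] ++ [z])).n < 0 := by
            by_contra hn
            exact Generic.ne_of_pos (b := [P]) (c := [z]) hg (hg.n_pos_of (by simp) hn)
              (.inr (by simpa using hzn)) (by simp) (by simp) (by simpa using hz.symm)
          refine ⟨z, 1, by simp, hz, hn, ?_, fun e => ?_⟩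
          · change (total ([P] ++ [z])).pos = z.pos
            rw [eq_comm, ← vel_eq_zero_iff hn.ne]
            rw [vel_append, total_single, total_single,
              StringState.vel_pos hzn.ne, hz, StringState.vel_pos hP.ne', add_zero]
          · rw [Lam_one _ _ _ _ _ _ hL, leftPart]
            have := Lam_right_concat r N hr [] P [] z (by simpa using hR) e
            rw [List.nil_append] at this
            rw [this, List.nil_append, G_single, Cochain.gen, if_neg (c := P.n < 0) (by omega)]
            simp
      obtain ⟨t, c, ht, htP, hn, hpos, hw⟩ := hw
      have h1 : ¬ RGood L P R := fun h => by
        rcases ht with ht | ht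
        · linarith [h.1.lt_of_mem ht]
        · linarith [h.2.1.lt_of_mem_tail ht]
      have h2 : ¬ LGood L P R := fun h => by
        rcases ht with ht | ht
        · linarith [h.1.lt_of_mem ht]
        · linarith [h.2.1.lt_of_mem_tail ht]
      have htt := hc.lt_total (hmem t ht) (List.infix_refl _) (by simp)
      have htt' := hc.total_lt (hmem t ht) (List.infix_refl _) (by simp)
      rw [hpos] at htt htt'
      simp only [lt_self_iff_false, iff_false, not_lt] at htt htt'
      rw [hG, closedForm, if_neg (c := CutR r L P R j) (fun h => h1 h.1),
        if_neg (c := CutL r L P R j) (fun h => h2 h.1), psum_single hw,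
        psum_single hw, if_pos hn, if_pos (hr t), le_antisymm htt htt']
      simp

open Classical in
/-- The coefficient of a list with one state with `n > 0`. -/
theorem coef_one (hg : Generic (L ++ P :: R)) (hc : Compat r (L ++ P :: R)) (hL : AllNeg L)
    (hR : AllNeg R) (hP : 0 < P.n) (hn : (total (L ++ P :: R)).n < 0) :
    coef r N hr (L ++ P :: R) = if L.length + R.length = 1 then (-1) ^ L.length
      else if RGood L P R then -(-1) ^ R.length else if LGood L P R then (-1) ^ L.length else 0 := by
  have hLR : L ≠ [] ∨ R ≠ [] := by
    by_contra h
    push Not at h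
    obtain ⟨rfl, rfl⟩ := h
    rw [List.nil_append, total_single] at hn
    omega
  rw [coef_eq, if_pos hn]
  split_ifs with h1 h2 h3
  -- For two inputs no homotopy is applied before the projection, so the coefficient is the same for
  -- all relative positions, coinciding points included.
  · match L, R, h1 with
    | [x], [], _ =>
      rw [psum_single (t := r x) (c := -1), if_pos (hr x)]
      · simp
      · intro e
        rw [Lam_one _ _ _ _ _ _ hL, leftPart, List.nil_append, G_single, Cochain.gen,
          if_neg (c := P.n < 0) (by omega)]
        simp
    | [], [z], _ =>
      rw [psum_single (t := r z) (c := 1), if_pos (hr z)]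
      · simp
      · intro e
        rw [Lam_one _ _ _ _ _ _ hL, leftPart]
        have := Lam_right_concat r N hr [] P [] z (by simpa using hR) e
        rw [List.nil_append] at this
        rw [this, List.nil_append, G_single, Cochain.gen, if_neg (c := P.n < 0) (by omega)]
        simp
    | [], [], h => simp at h
    | _ :: _ :: _, _, h => simp only [List.length_cons] at h; omega
    | [_], _ :: _, h => simp only [List.length_cons, List.length_nil] at h; omega
    | [], _ :: _ :: _, h => simp only [List.length_cons] at h; omega
  all_goals
    have h0 : 2 ≤ L.length + R.length := by
      rcases hLR with h | h <;> have := List.length_pos_of_ne_nil h <;> omega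
    have hF : LamForm r N hr L P R := by
      refine lamForm r N hr hg hc hL hR hP hLR (.inl h0) ?_ ?_
      · rintro x L' rfl j
        exact G_f_eq r N hr hg.tail (hc.sub ⟨[x], [], by simp⟩)
          (fun s hs => hL s (by simp [hs])) hR hP j
      · rintro z R' rfl j
        exact G_f_eq r N hr (hg.sub ⟨[], [z], by simp⟩) (hc.sub ⟨[], [z], by simp⟩)
          hL (fun s hs => hR s (by simp [hs])) hP j
  · obtain ⟨t, -, -, hw⟩ := hF.right h2
    rw [psum_single hw, if_pos (hr t)]
  · obtain ⟨t, -, -, hw⟩ := hF.left h3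
    rw [psum_single hw, if_pos (hr t)]
  · simp [Cochain.psum, hF.zero h2 h3]

end LineModel

end

/-! ### Two inputs with `n > 0` that meet at the outgoing point. -/

noncomputable section

open StringState

/-- Two states `P`, `Q` move towards each other, `P` to the right, and meet at the point of the
outgoing state. -/
def RGood₂ (L : List StringState) (P : StringState) (M : List StringState) (Q : StringState)
    (R : List StringState) : Prop :=
  Dec (L ++ [P]) ∧ Inc (P :: M ++ [Q]) ∧ Dec (Q :: R) ∧
    (∀ s ∈ L ++ [P], s.pos < (total (L ++ P :: (M ++ Q :: R))).pos) ∧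
    ∀ s ∈ Q :: R, (total (L ++ P :: (M ++ Q :: R))).pos < s.pos

/-- The mirror image of `RGood₂`. -/
def LGood₂ (L : List StringState) (P : StringState) (M : List StringState) (Q : StringState)
    (R : List StringState) : Prop :=
  Inc (L ++ [P]) ∧ Dec (P :: M ++ [Q]) ∧ Inc (Q :: R) ∧
    (∀ s ∈ L ++ [P], (total (L ++ P :: (M ++ Q :: R))).pos < s.pos) ∧
    ∀ s ∈ Q :: R, s.pos < (total (L ++ P :: (M ++ Q :: R))).pos

section TwoPositive

variable {L M₁ M₂ R : List StringState} {P Q : StringState}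

/-- No state on the left is absorbed at the point of the outgoing state. -/
theorem Generic.head_ne {x : StringState} {l : List StringState} (hg : Generic (x :: l)) (hl : l ≠ [])
    (hx : x.n < 0) (hn : 0 < (total (x :: l)).n) : x.pos ≠ (total (x :: l)).pos := by
  intro e
  have hne := hg.tail.n_ne hl
  have h0 : (total (x :: l)).vel x.pos = 0 := by rw [e, StringState.vel_pos hn.ne']
  rw [vel_cons, StringState.vel_pos hx.ne, zero_add, vel_eq_zero_iff hne] at h0
  exact Generic.ne_of_pos (b := [x]) (c := l) hg hn (.inl (by simpa using hx)) (by simp) hl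
    (by simpa using h0)

theorem Generic.last_ne {x : StringState} {l : List StringState} (hg : Generic (l ++ [x]))
    (hl : l ≠ []) (hx : x.n < 0) (hn : 0 < (total (l ++ [x])).n) :
    x.pos ≠ (total (l ++ [x])).pos := by
  intro e
  have hne := hg.left.n_ne hl
  have h0 : (total (l ++ [x])).vel x.pos = 0 := by rw [e, StringState.vel_pos hn.ne']
  rw [vel_append, total_single, StringState.vel_pos hx.ne, add_zero, vel_eq_zero_iff hne] at h0
  exact hg.ne_of_pos hn (.inr (by simpa using hx)) hl (by simp) (by simpa using h0.symm)

theorem inc_append_iff {l l' : List StringState} : Inc (l ++ l') ↔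
    Inc l ∧ Inc l' ∧ ∀ a ∈ l, ∀ b ∈ l', a.pos < b.pos := List.pairwise_append

theorem dec_append_iff {l l' : List StringState} : Dec (l ++ l') ↔
    Dec l ∧ Dec l' ∧ ∀ a ∈ l, ∀ b ∈ l', b.pos < a.pos := List.pairwise_append

/-- The conditions under which two states moving towards each other meet at the outgoing point. -/
theorem rGood₂_iff (hg : Generic (L ++ P :: (M₁ ++ M₂ ++ Q :: R)))
    (hn : 0 < (total (L ++ P :: (M₁ ++ M₂ ++ Q :: R))).n) (hL : AllNeg L) (hM₁ : AllNeg M₁)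
    (hM₂ : AllNeg M₂) (hR : AllNeg R) (hP : 0 < P.n) (hQ : 0 < Q.n) {y : ℝ}
    (hy : y = (total (L ++ P :: (M₁ ++ M₂ ++ Q :: R))).pos) :
    (RGood L P M₁ ∧ (∀ s ∈ L ++ P :: M₁, s.pos ≤ y) ∧
      ((total (L ++ P :: M₁)).n < 0 → y < (total (L ++ P :: M₁)).pos)) ∧
      (LGood M₂ Q R ∧ (∀ s ∈ M₂ ++ Q :: R, y < s.pos) ∧
        ((total (M₂ ++ Q :: R)).n < 0 → (total (M₂ ++ Q :: R)).pos ≤ y)) ↔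
    RGood₂ L P (M₁ ++ M₂) Q R ∧ (∀ s ∈ M₁, s.pos ≤ y) ∧ ∀ s ∈ M₂, y < s.pos := by
  have e : L ++ P :: (M₁ ++ M₂ ++ Q :: R) = (L ++ P :: M₁) ++ (M₂ ++ Q :: R) := by simp
  have hg' := hg
  rw [e] at hg'
  have hn1 := hg'.left.n_ne (by simp)
  have hn2 := hg'.right.n_ne (by simp)
  have hnn : 0 < (total (L ++ P :: M₁)).n + (total (M₂ ++ Q :: R)).n := by rwa [e, n_append] at hn
  -- The total velocity vanishes at the outgoing point, so the two parts arrive with opposite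
  -- velocities.
  have hv : (total (L ++ P :: M₁)).vel y + (total (M₂ ++ Q :: R)).vel y = 0 := by
    rw [← vel_append, ← e, hy, StringState.vel_pos hn.ne']
  constructor
  · rintro ⟨⟨h1, h2, h3⟩, h4, h5, h6⟩
    have hlt : ∀ s ∈ L ++ [P], s.pos < y := by
      match L, h1, h2, hL, hg, hn, hy, hv with
      | x :: L, h1, h2, hL, hg, hn, hy, _ =>
        have hx : x.pos < y := lt_of_le_of_ne (h2 x (by simp)) (by
          rw [hy]; exact Generic.head_ne hg (by simp) (hL x (by simp)) hn)
        intro s hs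
        rw [List.cons_append, List.mem_cons] at hs
        rcases hs with rfl | hs
        · exact hx
        · exact ((List.pairwise_cons.mp h1.1).1 s hs).trans hx
      | [], h1, h2, _, hg, hn, hy, hv =>
        intro s hs
        obtain rfl : s = P := by simpa using hs
        refine lt_of_le_of_ne (h2 s (by simp)) fun hsy => ?_
        match M₁, h1, h2, hv, hg', hnn, hn1 with
        | t :: M₁, h1, h2, _, _, _, _ =>
          linarith [h1.2.1.lt_of_mem_tail (s := t) (by simp), h2 t (by simp)]
        | [], h1, h2, hv, hg', hnn, hn1 =>
          rw [List.nil_append, total_single, ← hsy, StringState.vel_pos hP.ne', zero_add,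
            vel_eq_zero_iff hn2] at hv
          by_cases hn2' : (total (M₂ ++ Q :: R)).n < 0
          · exact Generic.ne_of_pos (b := [s]) (c := M₂ ++ Q :: R) hg' (by
              rw [n_append]; simpa using hnn) (.inr hn2') (by simp) (by simp) (by simpa using hv)
          · have h7 : (0 : ℝ) < (total (M₂ ++ Q :: R)).n := by
              exact_mod_cast hg'.right.n_pos_of (by simp) hn2'
            have := h4.vel_le hM₂ hR hQ s.pos
            rw [hv, StringState.vel_pos hn2, ← hv] at this
            nlinarith [h5 Q (by simp)]
    have hgt : ∀ s ∈ Q :: R, y < s.pos := fun s hs => h5 s (by simp at hs ⊢; tauto)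
    refine ⟨⟨h1.1, ?_, h4.2.1, hy ▸ hlt, hy ▸ hgt⟩, fun s hs => h2 s (by simp [hs]),
      fun s hs => h5 s (by simp [hs])⟩
    rw [← List.cons_append, List.append_assoc, inc_append_iff]
    refine ⟨h1.2.1, h4.1, fun a ha b hb => lt_of_le_of_lt (h2 a ?_) (h5 b ?_)⟩
    · simp at ha ⊢; tauto
    · simp at hb ⊢; tauto
  · rintro ⟨⟨h1, h2, h3, h4, h5⟩, h6, h7⟩
    rw [← hy] at h4 h5
    rw [← List.cons_append, List.append_assoc, inc_append_iff] at h2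
    have hle : ∀ s ∈ L ++ P :: M₁, s.pos ≤ y := fun s hs => by
      have : s ∈ L ++ [P] ∨ s ∈ M₁ := by simp at hs ⊢; tauto
      rcases this with hs | hs
      exacts [(h4 s hs).le, h6 s hs]
    have hgt : ∀ s ∈ M₂ ++ Q :: R, y < s.pos := fun s hs => by
      rcases List.mem_append.mp hs with hs | hs
      exacts [h7 s hs, h5 s hs]
    -- If one part has negative `n`, the other has positive `n`. The estimate from its own input `P`
    -- or `Q` gives that part a velocity of strict sign at `y`, hence the first part the opposite
    -- one.
    have k1 : (total (L ++ P :: M₁)).n < 0 → y < (total (L ++ P :: M₁)).pos := fun hneg => by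
      have hpos : 0 < (total (M₂ ++ Q :: R)).n := by omega
      have hgood : LGood M₂ Q R := ⟨h2.2.1, h3, fun h => by omega⟩
      have := hgood.vel_le hM₂ hR hQ y
      have h8 : (0 : ℝ) < (total (M₂ ++ Q :: R)).n := by exact_mod_cast hpos
      rw [← vel_pos_iff_of_neg hneg]
      nlinarith [hgt Q (by simp)]
    have k2 : (total (M₂ ++ Q :: R)).n < 0 → (total (M₂ ++ Q :: R)).pos < y := fun hneg => by
      have hpos : 0 < (total (L ++ P :: M₁)).n := by omega
      have hgood : RGood L P M₁ := ⟨h1, h2.1, fun h => by omega⟩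
      have := hgood.le_vel hL hM₁ hP y
      have h8 : (0 : ℝ) < (total (L ++ P :: M₁)).n := by exact_mod_cast hpos
      rw [← vel_neg_iff_of_neg hneg]
      nlinarith [h4 P (by simp)]
    exact ⟨⟨⟨h1, h2.1, fun h s hs => lt_of_le_of_lt (hle s hs) (k1 h)⟩, hle, k1⟩,
      ⟨h2.2.1, h3, fun h s hs => (k2 h).trans (hgt s hs)⟩, hgt, fun h => (k2 h).le⟩

/-- This is not the literal reflection of `rGood₂_iff`: the functions are always evaluated just to
the right of `y`, so inputs at `y` still belong to the part coming from the left, which is now the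
second one. -/
theorem lGood₂_iff (hg : Generic (L ++ P :: (M₁ ++ M₂ ++ Q :: R)))
    (hn : 0 < (total (L ++ P :: (M₁ ++ M₂ ++ Q :: R))).n) (hL : AllNeg L) (hM₁ : AllNeg M₁)
    (hM₂ : AllNeg M₂) (hR : AllNeg R) (hP : 0 < P.n) (hQ : 0 < Q.n) {y : ℝ}
    (hy : y = (total (L ++ P :: (M₁ ++ M₂ ++ Q :: R))).pos) :
    (LGood L P M₁ ∧ (∀ s ∈ L ++ P :: M₁, y < s.pos) ∧
      ((total (L ++ P :: M₁)).n < 0 → (total (L ++ P :: M₁)).pos ≤ y)) ∧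
      (RGood M₂ Q R ∧ (∀ s ∈ M₂ ++ Q :: R, s.pos ≤ y) ∧
        ((total (M₂ ++ Q :: R)).n < 0 → y < (total (M₂ ++ Q :: R)).pos)) ↔
    LGood₂ L P (M₁ ++ M₂) Q R ∧ (∀ s ∈ M₁, y < s.pos) ∧ ∀ s ∈ M₂, s.pos ≤ y := by
  have e : L ++ P :: (M₁ ++ M₂ ++ Q :: R) = (L ++ P :: M₁) ++ (M₂ ++ Q :: R) := by simp
  have hg' := hg
  rw [e] at hg'
  have hn1 := hg'.left.n_ne (by simp)
  have hn2 := hg'.right.n_ne (by simp)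
  have hnn : 0 < (total (L ++ P :: M₁)).n + (total (M₂ ++ Q :: R)).n := by rwa [e, n_append] at hn
  have hv : (total (L ++ P :: M₁)).vel y + (total (M₂ ++ Q :: R)).vel y = 0 := by
    rw [← vel_append, ← e, hy, StringState.vel_pos hn.ne']
  constructor
  · rintro ⟨⟨h4, h5, h6⟩, h1, h2, h3⟩
    have hlt : ∀ s ∈ Q :: R, s.pos < y := by
      rcases List.eq_nil_or_concat' R with rfl | ⟨R, x, rfl⟩
      · intro s hs
        obtain rfl : s = Q := by simpa using hs
        refine lt_of_le_of_ne (h2 s (by simp)) fun hsy => ?_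
        match M₂, h1, h2, hv, hg', hnn, hn2 with
        | t :: M₂, h1, h2, _, _, _, _ =>
          linarith [h1.1.lt_of_mem (s := t) (by simp), h2 t (by simp)]
        | [], h1, h2, hv, hg', hnn, hn2 =>
          rw [List.nil_append, total_single, ← hsy, StringState.vel_pos hQ.ne', add_zero,
            vel_eq_zero_iff hn1] at hv
          by_cases hn1' : (total (L ++ P :: M₁)).n < 0
          · exact Generic.ne_of_pos (b := L ++ P :: M₁) (c := [s]) hg' (by
              rw [n_append]; simpa using hnn) (.inl hn1') (by simp) (by simp)
                (by simpa using hv.symm)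
          · have h7 : (0 : ℝ) < (total (L ++ P :: M₁)).n := by
              exact_mod_cast hg'.left.n_pos_of (by simp) hn1'
            have := h4.vel_le hL hM₁ hP s.pos
            rw [hv, StringState.vel_pos hn1, ← hv] at this
            nlinarith [h5 P (by simp)]
      · have hx : x.pos < y := lt_of_le_of_ne (h2 x (by simp)) (by
          have e' : L ++ P :: (M₁ ++ M₂ ++ Q :: (R ++ [x])) =
            (L ++ P :: (M₁ ++ M₂ ++ Q :: R)) ++ [x] := by simp
          rw [hy, e']
          exact Generic.last_ne (e' ▸ hg) (by simp) (hR x (by simp)) (e' ▸ hn))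
        intro s hs
        rw [← List.cons_append, List.mem_append, List.mem_singleton] at hs
        rcases hs with hs | rfl
        · exact ((inc_append_iff.mp (show Inc (Q :: R ++ [x]) from h1.2.1)).2.2 s hs x
            (by simp)).trans hx
        · exact hx
    have hgt : ∀ s ∈ L ++ [P], y < s.pos := fun s hs => h5 s (by simp at hs ⊢; tauto)
    refine ⟨⟨h4.1, ?_, h1.2.1, hy ▸ hgt, hy ▸ hlt⟩, fun s hs => h5 s (by simp [hs]),
      fun s hs => h2 s (by simp [hs])⟩
    rw [← List.cons_append, List.append_assoc, dec_append_iff]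
    refine ⟨h4.2.1, h1.1, fun a ha b hb => lt_of_le_of_lt (h2 b ?_) (h5 a ?_)⟩
    · simp at hb ⊢; tauto
    · simp at ha ⊢; tauto
  · rintro ⟨⟨h1, h2, h3, h4, h5⟩, h6, h7⟩
    rw [← hy] at h4 h5
    rw [← List.cons_append, List.append_assoc, dec_append_iff] at h2
    have hgt : ∀ s ∈ L ++ P :: M₁, y < s.pos := fun s hs => by
      have : s ∈ L ++ [P] ∨ s ∈ M₁ := by simp at hs ⊢; tauto
      rcases this with hs | hs
      exacts [h4 s hs, h6 s hs]
    have hle : ∀ s ∈ M₂ ++ Q :: R, s.pos ≤ y := fun s hs => by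
      rcases List.mem_append.mp hs with hs | hs
      exacts [h7 s hs, (h5 s hs).le]
    have k1 : (total (M₂ ++ Q :: R)).n < 0 → y < (total (M₂ ++ Q :: R)).pos := fun hneg => by
      have hpos : 0 < (total (L ++ P :: M₁)).n := by omega
      have hgood : LGood L P M₁ := ⟨h1, h2.1, fun h => by omega⟩
      have := hgood.vel_le hL hM₁ hP y
      have h8 : (0 : ℝ) < (total (L ++ P :: M₁)).n := by exact_mod_cast hpos
      rw [← vel_pos_iff_of_neg hneg]
      nlinarith [hgt P (by simp)]
    have k2 : (total (L ++ P :: M₁)).n < 0 → (total (L ++ P :: M₁)).pos < y := fun hneg => by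
      have hpos : 0 < (total (M₂ ++ Q :: R)).n := by omega
      have hgood : RGood M₂ Q R := ⟨h2.2.1, h3, fun h => by omega⟩
      have := hgood.le_vel hM₂ hR hQ y
      have h8 : (0 : ℝ) < (total (M₂ ++ Q :: R)).n := by exact_mod_cast hpos
      rw [← vel_neg_iff_of_neg hneg]
      nlinarith [h5 Q (by simp)]
    exact ⟨⟨⟨h1, h2.1, fun h s hs => (k2 h).trans (hgt s hs)⟩, hgt, fun h => (k2 h).le⟩,
      ⟨h2.2.1, h3, fun h s hs => lt_of_le_of_lt (hle s hs) (k1 h)⟩, hle, k1⟩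

end TwoPositive

/-- A list whose points increase is split once by a given point. -/
theorem splitSum_inc {M : List StringState} (hM : Inc M) (y : ℝ) (c : ℤ)
    (f : List StringState → List StringState → ℤ)
    (h1 : ∀ a b, a ++ b = M → (∀ s ∈ a, s.pos ≤ y) → (∀ s ∈ b, y < s.pos) → f a b = c)
    (h0 : ∀ a b, a ++ b = M → ¬ ((∀ s ∈ a, s.pos ≤ y) ∧ ∀ s ∈ b, y < s.pos) → f a b = 0) :
    splitSum f M = c := by
  induction M generalizing f with
  | nil => simpa using h1 [] [] rfl (by simp) (by simp)
  | cons x M ih =>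
    rw [splitSum_cons]
    have hx := List.pairwise_cons.mp hM
    rcases lt_or_ge y x.pos with hy | hy
    · rw [h1 [] (x :: M) rfl (by simp), splitSum_eq_zero, add_zero]
      · intro a b hab
        refine h0 (x :: a) b (by simp [hab]) fun h => ?_
        linarith [h.1 x (by simp)]
      · intro s hs
        rcases List.mem_cons.mp hs with rfl | hs
        exacts [hy, hy.trans (hx.1 s hs)]
    · rw [h0 [] (x :: M) rfl fun h => by linarith [h.2 x (by simp)], zero_add]
      refine ih hx.2 (fun a b => f (x :: a) b) (fun a b hab ha hb => ?_) fun a b hab h => ?_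
      · refine h1 _ _ (by simp [hab]) (fun s hs => ?_) hb
        rcases List.mem_cons.mp hs with rfl | hs
        exacts [hy, ha s hs]
      · exact h0 _ _ (by simp [hab]) fun h' => h ⟨fun s hs => h'.1 s (by simp [hs]), h'.2⟩

theorem splitSum_dec {M : List StringState} (hM : Dec M) (y : ℝ) (c : ℤ)
    (f : List StringState → List StringState → ℤ)
    (h1 : ∀ a b, a ++ b = M → (∀ s ∈ a, y < s.pos) → (∀ s ∈ b, s.pos ≤ y) → f a b = c)
    (h0 : ∀ a b, a ++ b = M → ¬ ((∀ s ∈ a, y < s.pos) ∧ ∀ s ∈ b, s.pos ≤ y) → f a b = 0) :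
    splitSum f M = c := by
  induction M generalizing f with
  | nil => simpa using h1 [] [] rfl (by simp) (by simp)
  | cons x M ih =>
    rw [splitSum_cons]
    have hx := List.pairwise_cons.mp hM
    rcases le_or_gt x.pos y with hy | hy
    · rw [h1 [] (x :: M) rfl (by simp), splitSum_eq_zero, add_zero]
      · intro a b hab
        refine h0 (x :: a) b (by simp [hab]) fun h => ?_
        linarith [h.1 x (by simp)]
      · intro s hs
        rcases List.mem_cons.mp hs with rfl | hs
        exacts [hy, (hx.1 s hs).le.trans hy]
    · rw [h0 [] (x :: M) rfl fun h => by linarith [h.2 x (by simp)], zero_add]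
      refine ih hx.2 (fun a b => f (x :: a) b) (fun a b hab ha hb => ?_) fun a b hab h => ?_
      · refine h1 _ _ (by simp [hab]) (fun s hs => ?_) hb
        rcases List.mem_cons.mp hs with rfl | hs
        exacts [hy, ha s hs]
      · exact h0 _ _ (by simp [hab]) fun h' => h ⟨fun s hs => h'.1 s (by simp [hs]), h'.2⟩

namespace LineModel

variable (r : StringState → ℕ) (N : ℕ) (hr : ∀ s, r s < N) {L M R : List StringState}
  {P Q : StringState}

/-- A tree sum has a nonzero value at a vertex only if it contains exactly one input with `n > 0`,
so the cut falls between `P` and `Q`. -/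
theorem Lam_two (hL : AllNeg L) (hP : 0 < P.n) (hQ : 0 < Q.n) (j : ℕ) :
    (Lam r N hr (L ++ P :: (M ++ Q :: R))).f j = splitSum (fun m₁ m₂ =>
      (G r N hr (L ++ P :: m₁)).f j * (G r N hr (m₂ ++ Q :: R)).f j) M := by
  rw [Lam_eq, Cochain.splitSum_f, splitSum_append_cons, splitSum_eq_zero, zero_add,
    splitSum_append_cons, splitSum_eq_zero (l := R), add_zero]
  · rfl
  · rintro c₁ c₂ -
    have : 2 ≤ numPos (L ++ P :: (M ++ Q :: c₁)) := by
      simp only [numPos_append, numPos_cons]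
      rw [if_neg (by omega), if_neg (by omega)]
      omega
    simp [(G_class r N hr _).1 this]
  · rintro a₁ a₂ rfl
    have : AllNeg a₁ := fun s hs => hL s (by simp [hs])
    simp [((G_class r N hr a₁).2.2 this.numPos).1]

/-- `CutR` at the vertex to the right of the outgoing point. -/
theorem cutR_iff {l : List StringState} (hc : Compat r l) (hl : l ≠ []) (hs : L ++ P :: R <:+: l) :
    CutR r L P R (r (total l) + 1) ↔ RGood L P R ∧ (∀ s ∈ L ++ P :: R, s.pos ≤ (total l).pos) ∧
      ((total (L ++ P :: R)).n < 0 → (total l).pos < (total (L ++ P :: R)).pos) := by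
  rw [CutR]
  refine and_congr_right fun _ => and_congr (forall₂_congr fun s h => ?_) (imp_congr_right fun _ => ?_)
  · rw [Nat.lt_add_one_iff, ← not_lt, ← not_lt, hc.total_lt (hs.subset h) (List.infix_refl _) hl]
  · rw [Nat.add_one_le_iff, hc l _ (List.infix_refl _) hs hl (by simp)]

theorem cutL_iff {l : List StringState} (hc : Compat r l) (hl : l ≠ []) (hs : L ++ P :: R <:+: l) :
    CutL r L P R (r (total l) + 1) ↔ LGood L P R ∧ (∀ s ∈ L ++ P :: R, (total l).pos < s.pos) ∧
      ((total (L ++ P :: R)).n < 0 → (total (L ++ P :: R)).pos ≤ (total l).pos) := by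
  rw [CutL]
  refine and_congr_right fun _ => and_congr (forall₂_congr fun s h => ?_) (imp_congr_right fun _ => ?_)
  · rw [Nat.add_one_le_iff, hc.total_lt (hs.subset h) (List.infix_refl _) hl]
  · rw [Nat.lt_add_one_iff, ← not_lt, ← not_lt, hc l _ (List.infix_refl _) hs hl (by simp)]

/-- The inequality at the evaluation vertex is weak, so velocity zero is possible, but only for a
bare `P` at the outgoing point. -/
theorem CutR.vel_nonneg {l : List StringState} (hc : Compat r l) (hl : l ≠ [])
    (hs : L ++ P :: R <:+: l) (hg : Generic l) (hL : AllNeg L) (hR : AllNeg R) (hP : 0 < P.n)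
    (h : CutR r L P R (r (total l) + 1)) : 0 ≤ (total (L ++ P :: R)).vel (total l).pos ∧
      ((total (L ++ P :: R)).vel (total l).pos = 0 → L = [] ∧ R = []) := by
  rw [cutR_iff r hc hl hs] at h
  obtain ⟨h1, h2, h3⟩ := h
  by_cases hn : (total (L ++ P :: R)).n < 0
  · have := (vel_pos_iff_of_neg hn).mpr (h3 hn)
    exact ⟨this.le, fun h => absurd h this.ne'⟩
  · have hn' : (0 : ℝ) < (total (L ++ P :: R)).n := by
      exact_mod_cast (hg.sub hs).n_pos_of (by simp) hn
    have := h1.le_vel hL hR hP (total l).pos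
    have hPl := h2 P (by simp)
    refine ⟨by nlinarith, fun h => ?_⟩
    have hPe : P.pos = (total l).pos := by nlinarith
    constructor
    · refine List.eq_nil_iff_forall_not_mem.mpr fun s hs => ?_
      linarith [h1.1.lt_of_mem hs, h2 s (by simp [hs])]
    · refine List.eq_nil_iff_forall_not_mem.mpr fun s hs => ?_
      linarith [h1.2.1.lt_of_mem_tail hs, h2 s (by simp [hs])]

/-- Here the inputs lie strictly beyond the outgoing point, so velocity zero is possible only with
`n < 0`. -/
theorem CutL.vel_nonpos {l : List StringState} (hc : Compat r l) (hl : l ≠ [])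
    (hs : L ++ P :: R <:+: l) (hg : Generic l) (hL : AllNeg L) (hR : AllNeg R) (hP : 0 < P.n)
    (h : CutL r L P R (r (total l) + 1)) : (total (L ++ P :: R)).vel (total l).pos ≤ 0 ∧
      (¬ (total (L ++ P :: R)).n < 0 → (total (L ++ P :: R)).vel (total l).pos < 0) := by
  rw [cutL_iff r hc hl hs] at h
  obtain ⟨h1, h2, h3⟩ := h
  have hpos : ¬ (total (L ++ P :: R)).n < 0 → (total (L ++ P :: R)).vel (total l).pos < 0 := by
    intro hn
    have hn' : (0 : ℝ) < (total (L ++ P :: R)).n := by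
      exact_mod_cast (hg.sub hs).n_pos_of (by simp) hn
    have := h1.vel_le hL hR hP (total l).pos
    nlinarith [h2 P (by simp)]
  refine ⟨?_, hpos⟩
  by_cases hn : (total (L ++ P :: R)).n < 0
  · exact not_lt.mp fun h => absurd ((vel_pos_iff_of_neg hn).mp h) (not_lt.mpr (h3 hn))
  · exact (hpos hn).le

open Classical in
/-- The coefficient of a list with two states with `n > 0`. -/
theorem coef_two (hg : Generic (L ++ P :: (M ++ Q :: R)))
    (hc : Compat r (L ++ P :: (M ++ Q :: R))) (hL : AllNeg L) (hM : AllNeg M) (hR : AllNeg R)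
    (hP : 0 < P.n) (hQ : 0 < Q.n) (hn : 0 < (total (L ++ P :: (M ++ Q :: R))).n) :
    coef r N hr (L ++ P :: (M ++ Q :: R)) = if L.length + M.length + R.length = 0 then 1
      else if RGood₂ L P M Q R then (-1) ^ M.length
      else if LGood₂ L P M Q R then (-1) ^ (L.length + R.length) else 0 := by
  rw [coef_eq, if_neg (by omega), Lam_two r N hr hL hP hQ]
  set l := L ++ P :: (M ++ Q :: R) with hl
  have hl0 : l ≠ [] := by simp [hl]
  set j := r (total l) + 1 with hj
  split_ifs with h0 hgr hgl
  · obtain rfl : L = [] := List.length_eq_zero_iff.mp (by omega)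
    obtain rfl : M = [] := List.length_eq_zero_iff.mp (by omega)
    obtain rfl : R = [] := List.length_eq_zero_iff.mp (by omega)
    simp only [splitSum_nil, List.nil_append]
    simp [lineData, Cochain.gen, not_lt.mpr hP.le, not_lt.mpr hQ.le]
  all_goals
    have key : ∀ m₁ m₂, m₁ ++ m₂ = M →
        (G r N hr (L ++ P :: m₁)).f j * (G r N hr (m₂ ++ Q :: R)).f j =
        (if RGood₂ L P M Q R ∧ (∀ s ∈ m₁, s.pos ≤ (total l).pos) ∧
          ∀ s ∈ m₂, (total l).pos < s.pos then (-1) ^ M.length else 0) +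
        if LGood₂ L P M Q R ∧ (∀ s ∈ m₁, (total l).pos < s.pos) ∧
          ∀ s ∈ m₂, s.pos ≤ (total l).pos then (-1) ^ (L.length + R.length) else 0 := by
      rintro m₁ m₂ rfl
      have hm₁ : AllNeg m₁ := fun s hs => hM s (by simp [hs])
      have hm₂ : AllNeg m₂ := fun s hs => hM s (by simp [hs])
      have hs₁ : L ++ P :: m₁ <:+: l := ⟨[], m₂ ++ Q :: R, by simp [hl]⟩
      have hs₂ : m₂ ++ Q :: R <:+: l := ⟨L ++ P :: m₁, [], by simp [hl]⟩
      have e : l = (L ++ P :: m₁) ++ (m₂ ++ Q :: R) := by simp [hl]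
      have hv : (total (L ++ P :: m₁)).vel (total l).pos +
          (total (m₂ ++ Q :: R)).vel (total l).pos = 0 := by
        rw [← vel_append, ← e, StringState.vel_pos hn.ne']
      have hnn : 0 < (total (L ++ P :: m₁)).n + (total (m₂ ++ Q :: R)).n := by
        rwa [e, n_append] at hn
      have h1 := rGood₂_iff hg hn hL hm₁ hm₂ hR hP hQ rfl
      have h2 := lGood₂_iff hg hn hL hm₁ hm₂ hR hP hQ rfl
      rw [← hl, ← cutR_iff r hc hl0 hs₁, ← cutL_iff r hc hl0 hs₂, ← hj] at h1
      rw [← hl, ← cutL_iff r hc hl0 hs₁, ← cutR_iff r hc hl0 hs₂, ← hj] at h2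
      -- Two nonnegative velocities with sum zero both vanish, so both parts are bare, contrary to
      -- `h0`.
      have h3 : ¬ (CutR r L P m₁ j ∧ CutR r m₂ Q R j) := fun ⟨ha, hb⟩ => by
        have ha' := CutR.vel_nonneg r hc hl0 hs₁ hg hL hm₁ hP ha
        have hb' := CutR.vel_nonneg r hc hl0 hs₂ hg hm₂ hR hQ hb
        obtain ⟨rfl, rfl⟩ := ha'.2 (by linarith)
        obtain ⟨rfl, rfl⟩ := hb'.2 (by linarith)
        simp at h0
      -- Both velocities are nonpositive, and since the total `n` is positive at least one part has
      -- `n > 0` and a negative velocity.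
      have h4 : ¬ (CutL r L P m₁ j ∧ CutL r m₂ Q R j) := fun ⟨ha, hb⟩ => by
        have ha' := CutL.vel_nonpos r hc hl0 hs₁ hg hL hm₁ hP ha
        have hb' := CutL.vel_nonpos r hc hl0 hs₂ hg hm₂ hR hQ hb
        by_cases hn1 : (total (L ++ P :: m₁)).n < 0
        · have := hb'.2 (by omega)
          linarith
        · have := ha'.2 hn1
          linarith
      rw [G_f_eq r N hr (hg.sub hs₁) (hc.sub hs₁) hL hm₁ hP,
        G_f_eq r N hr (hg.sub hs₂) (hc.sub hs₂) hm₂ hR hQ, closedForm, closedForm, ← if_congr h1 rfl rfl,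
        ← if_congr h2 rfl rfl]
      by_cases c1 : CutR r L P m₁ j <;> by_cases c2 : CutL r L P m₁ j <;>
        by_cases c3 : CutR r m₂ Q R j <;> by_cases c4 : CutL r m₂ Q R j <;>
        simp only [c1, c2, c3, c4, and_self, and_true, and_false, not_true_eq_false,
          not_false_eq_true] at h3 h4 <;>
        simp [c1, c2, c3, c4, pow_add]
    have hex : ¬ (RGood₂ L P M Q R ∧ LGood₂ L P M Q R) := fun ⟨h1, h2⟩ => by
      linarith [h1.2.2.2.1 P (by simp), h2.2.2.2.1 P (by simp)]
    rw [splitSum_congr key]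
  · have hi : Inc M := (inc_append_iff.mp ((List.pairwise_cons.mp
      (show (P :: (M ++ [Q])).Pairwise _ from hgr.2.1)).2)).1
    have hgl : ¬ LGood₂ L P M Q R := fun h => hex ⟨hgr, h⟩
    simp only [hgr, hgl, true_and, false_and, if_false, add_zero]
    refine splitSum_inc hi (total l).pos _ _ (fun a b _ ha hb => if_pos ⟨ha, hb⟩)
      fun a b _ h => if_neg h
  · have hi : Dec M := (dec_append_iff.mp ((List.pairwise_cons.mp
      (show (P :: (M ++ [Q])).Pairwise _ from hgl.2.1)).2)).1
    simp only [hgr, hgl, true_and, false_and, if_false, zero_add]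
    refine splitSum_dec hi (total l).pos _ _ (fun a b _ ha hb => if_pos ⟨ha, hb⟩)
      fun a b _ h => if_neg h
  · exact splitSum_eq_zero fun a b _ => by simp [hgr, hgl]

end LineModel

end

noncomputable section

open StringState

/-! ### Diagrams and their lists of inputs -/

namespace StringState

theorem propagates_iff {s : StringState} {a b : ℝ} :
    s.Propagates a b ↔ 0 ≤ (b - a) * s.vel a ∧ 0 ≤ (b - a) * s.vel b := Iff.rfl

theorem propagates_refl (s : StringState) (a : ℝ) : s.Propagates a a := by
  simp [Propagates]

/-- A state with `n < 0` does not leave its point. -/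
theorem propagates_pos_left_of_neg {s : StringState} (hs : s.n < 0) {y : ℝ} :
    s.Propagates s.pos y ↔ y = s.pos := by
  have hs' : (s.n : ℝ) < 0 := by exact_mod_cast hs
  refine ⟨fun h => ?_, fun h => h ▸ s.propagates_refl _⟩
  have h2 := (propagates_iff.mp h).2
  rw [vel_eq hs.ne] at h2
  by_contra hne
  have : 0 < (y - s.pos) ^ 2 := by
    have := sub_ne_zero.mpr hne
    positivity
  nlinarith

theorem propagates_pos_left_of_pos {s : StringState} (hs : 0 < s.n) (y : ℝ) :
    s.Propagates s.pos y := by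
  have hs' : (0 : ℝ) < s.n := by exact_mod_cast hs
  rw [propagates_iff, vel_pos hs.ne', vel_eq hs.ne']
  refine ⟨by simp, ?_⟩
  nlinarith [mul_nonneg hs'.le (sq_nonneg (y - s.pos))]

/-- A state with `n > 0` does not arrive at its point. -/
theorem propagates_pos_right_of_pos {s : StringState} (hs : 0 < s.n) {y : ℝ} :
    s.Propagates y s.pos ↔ y = s.pos := by
  have hs' : (0 : ℝ) < s.n := by exact_mod_cast hs
  refine ⟨fun h => ?_, fun h => h ▸ s.propagates_refl _⟩
  have h2 := (propagates_iff.mp h).1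
  rw [vel_eq hs.ne'] at h2
  by_contra hne
  have : 0 < (y - s.pos) ^ 2 := by
    have := sub_ne_zero.mpr hne
    positivity
  nlinarith

theorem propagates_pos_right_of_neg {s : StringState} (hs : s.n < 0) (y : ℝ) :
    s.Propagates y s.pos := by
  have hs' : (s.n : ℝ) < 0 := by exact_mod_cast hs
  rw [propagates_iff, vel_pos hs.ne, vel_eq hs.ne]
  refine ⟨?_, by simp⟩
  nlinarith [mul_nonneg (neg_nonneg.mpr hs'.le) (sq_nonneg (y - s.pos))]

end StringState

namespace FeynmanDiagram

theorem inputs_ne_nil (δ : FeynmanDiagram) : δ.inputs ≠ [] := by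
  induction δ with
  | ext s => simp [inputs]
  | join y A B hA hB => simp [inputs, hA]

theorem state_eq (δ : FeynmanDiagram) : δ.state = total δ.inputs := by
  induction δ with
  | ext s => simp [inputs, state]
  | join y A B hA hB => rw [state, inputs, total_append, hA, hB]

theorem interactions_eq (δ : FeynmanDiagram) : δ.interactions = δ.inputs.length - 1 := by
  induction δ with
  | ext s => simp [inputs, interactions]
  | join y A B hA hB =>
    rw [inputs, interactions, hA, hB, List.length_append]
    push_cast
    ring

theorem fixedInputs_eq (δ : FeynmanDiagram) :
    δ.fixedInputs = δ.inputs.length - numPos δ.inputs := by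
  induction δ with
  | ext s =>
    by_cases h : s.n < 0
    · simp [inputs, fixedInputs, numPos_cons, h]
    · simp [inputs, fixedInputs, numPos_cons, h]
  | join y A B hA hB =>
    rw [inputs, fixedInputs, hA, hB, List.length_append, numPos_append]
    push_cast
    ring

/-- The dimension is determined by the external states. -/
theorem dim_eq (δ : FeynmanDiagram) :
    δ.dim = numPos δ.inputs - 1 - if 0 < (total δ.inputs).n then 1 else 0 := by
  rw [dim, state_eq, interactions_eq, fixedInputs_eq]
  ring

theorem JoinsAt.start_eq {δ : FeynmanDiagram} {y : ℝ} (h : δ.JoinsAt y) : δ.start = y := by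
  cases δ with
  | ext s => exact h.elim
  | join y' A B => exact h

/-- The diagram obtained by the reflection of the configuration space. -/
def mirror : FeynmanDiagram → FeynmanDiagram
  | ext s => ext ⟨s.n, -s.m⟩
  | join y A B => join (-y) A.mirror B.mirror

end FeynmanDiagram

namespace StringState

/-- The state obtained by the reflection of the configuration space. -/
def mirror (s : StringState) : StringState := ⟨s.n, -s.m⟩

@[simp] theorem mirror_n (s : StringState) : s.mirror.n = s.n := rfl

@[simp] theorem mirror_mirror (s : StringState) : s.mirror.mirror = s := by simp [mirror]

@[simp] theorem mirror_pos (s : StringState) : s.mirror.pos = -s.pos := by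
  simp [mirror, pos, neg_div]

theorem mirror_vel (s : StringState) (y : ℝ) : s.mirror.vel y = -s.vel (-y) := by
  simp only [mirror, vel]; push_cast; ring

@[simp] theorem map_mirror_mirror (l : List StringState) : (l.map mirror).map mirror = l := by
  simp [List.map_map, Function.comp_def]

@[simp] theorem total_map_mirror (l : List StringState) : total (l.map mirror) = (total l).mirror := by
  induction l with
  | nil => simp [total, mirror]
  | cons s l ih =>
    rw [List.map_cons, ← List.singleton_append, total_append, ih, ← List.singleton_append (l := l),
      total_append, total_single, total_single]
    simp [fuse, mirror]
    ring

theorem mirror_deg (s : StringState) : s.mirror.deg = s.deg := rfl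

theorem Propagates.mirror {s : StringState} {a b : ℝ} (h : s.Propagates a b) :
    s.mirror.Propagates (-a) (-b) := by
  rw [propagates_iff, mirror_vel, mirror_vel, neg_neg, neg_neg]
  have := propagates_iff.mp h
  constructor <;> nlinarith

end StringState

theorem AllNeg.mirror {l : List StringState} (h : AllNeg l) : AllNeg (l.map StringState.mirror) := by
  intro s hs
  obtain ⟨t, ht, rfl⟩ := List.mem_map.mp hs
  exact h t ht

theorem Generic.mirror {l : List StringState} (h : Generic l) :
    Generic (l.map StringState.mirror) := by
  have key : ∀ b : List StringState, total b = (total (b.map StringState.mirror)).mirror := fun b => by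
    simp
  have key' : ∀ b : List StringState, (total b).pos = -(total (b.map StringState.mirror)).pos :=
    fun b => by simp
  constructor
  · intro a b c he hb
    rw [key b]
    have := congrArg (List.map StringState.mirror) he
    simp only [map_mirror_mirror, List.map_append] at this
    exact h.distinct _ _ _ this (by simpa using hb)
  · intro a b c e he hb hc
    rw [key b, key c, key (b ++ c), mirror_deg, mirror_deg, mirror_deg, mirror_pos, mirror_pos]
    have := congrArg (List.map StringState.mirror) he
    simp only [map_mirror_mirror, List.map_append] at this
    rw [List.map_append, neg_inj.ne]
    exact h.pos_ne _ _ _ _ this (by simpa using hb) (by simpa using hc)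

theorem inc_map_mirror {l : List StringState} : Inc (l.map StringState.mirror) ↔ Dec l := by
  simp [Inc, Dec, List.pairwise_map]

theorem dec_map_mirror {l : List StringState} : Dec (l.map StringState.mirror) ↔ Inc l := by
  simp [Inc, Dec, List.pairwise_map]

section Mirror

variable {L R : List StringState} {P : StringState}

theorem rGood_mirror : RGood (L.map StringState.mirror) P.mirror (R.map StringState.mirror) ↔
    LGood L P R := by
  have e : L.map StringState.mirror ++ P.mirror :: R.map StringState.mirror =
    (L ++ P :: R).map StringState.mirror := by simp
  rw [RGood, LGood, e, total_map_mirror, ← dec_map_mirror (l := L ++ [P]),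
    ← inc_map_mirror (l := P :: R)]
  refine and_congr (by simp) (and_congr (by simp) ?_)
  simp only [List.forall_mem_map, mirror_pos, neg_lt_neg_iff, mirror_n]

theorem rReach_mirror {y : ℝ} :
    RReach (L.map StringState.mirror) P.mirror (R.map StringState.mirror) (-y) ↔ LReach L P R y := by
  have e : L.map StringState.mirror ++ P.mirror :: R.map StringState.mirror =
    (L ++ P :: R).map StringState.mirror := by simp
  rw [RReach, LReach, rGood_mirror, e, total_map_mirror, mirror_vel, neg_neg, neg_pos]
  simp only [List.forall_mem_map, mirror_pos, neg_le_neg_iff]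

theorem lReach_mirror {y : ℝ} :
    LReach (L.map StringState.mirror) P.mirror (R.map StringState.mirror) (-y) ↔ RReach L P R y := by
  rw [← rReach_mirror, map_mirror_mirror, map_mirror_mirror, mirror_mirror, neg_neg]

theorem rGood₂_mirror {M : List StringState} {Q : StringState} :
    RGood₂ (L.map StringState.mirror) P.mirror (M.map StringState.mirror) Q.mirror
      (R.map StringState.mirror) ↔ LGood₂ L P M Q R := by
  have e : L.map StringState.mirror ++ P.mirror :: (M.map StringState.mirror ++ Q.mirror ::
    R.map StringState.mirror) = (L ++ P :: (M ++ Q :: R)).map StringState.mirror := by simp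
  have e1 : L.map StringState.mirror ++ [P.mirror] = (L ++ [P]).map StringState.mirror := by simp
  have e2 : P.mirror :: M.map StringState.mirror ++ [Q.mirror] =
    (P :: M ++ [Q]).map StringState.mirror := by simp
  have e3 : Q.mirror :: R.map StringState.mirror = (Q :: R).map StringState.mirror := by simp
  rw [RGood₂, LGood₂, e, total_map_mirror, e1, e2, e3, dec_map_mirror, inc_map_mirror, dec_map_mirror]
  simp only [List.forall_mem_map, mirror_pos, neg_lt_neg_iff]

end Mirror

namespace FeynmanDiagram

@[simp] theorem inputs_mirror (δ : FeynmanDiagram) :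
    δ.mirror.inputs = δ.inputs.map StringState.mirror := by
  induction δ with
  | ext s => rfl
  | join y A B hA hB => simp [mirror, inputs, hA, hB]

@[simp] theorem mirror_mirror (δ : FeynmanDiagram) : δ.mirror.mirror = δ := by
  induction δ with
  | ext s => simp [mirror]
  | join y A B hA hB => simp [mirror, hA, hB]

theorem start_mirror (δ : FeynmanDiagram) : δ.mirror.start = -δ.start := by
  cases δ with
  | ext s => exact s.mirror_pos
  | join y A B => rfl

theorem state_mirror (δ : FeynmanDiagram) : δ.mirror.state = δ.state.mirror := by
  rw [state_eq, state_eq, inputs_mirror, total_map_mirror]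

theorem JoinsAt.mirror {δ : FeynmanDiagram} {y : ℝ} (h : δ.JoinsAt y) : δ.mirror.JoinsAt (-y) := by
  cases δ with
  | ext s => exact h.elim
  | join y' A B => exact congrArg Neg.neg h

theorem Valid.mirror {δ : FeynmanDiagram} (h : δ.Valid) : δ.mirror.Valid := by
  induction δ with
  | ext s => trivial
  | join y A B hA hB =>
    refine ⟨hA h.1, hB h.2.1, ?_, ?_, fun h' => h.2.2.2.2 ?_⟩
    · rw [state_mirror, start_mirror]; exact h.2.2.1.mirror
    · rw [state_mirror, start_mirror]; exact h.2.2.2.1.mirror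
    · simpa using h'.mirror

/-! ### Diagrams with at most one state with `n > 0` -/

/-- States with `n < 0` cannot leave their points, and general position keeps neighbouring ones
apart, so they never interact with each other. -/
theorem Valid.eq_ext_of_allNeg {δ : FeynmanDiagram} (h : δ.Valid) (hg : Generic δ.inputs)
    (hn : AllNeg δ.inputs) : ∃ s, δ = ext s := by
  induction δ with
  | ext s => exact ⟨s, rfl⟩
  | join y A B hA hB =>
    obtain ⟨hvA, hvB, hpA, hpB, -⟩ := h
    obtain ⟨s, rfl⟩ := hA hvA hg.left fun s hs => hn s (by simp [inputs, hs])
    obtain ⟨t, rfl⟩ := hB hvB hg.right fun s hs => hn s (by simp [inputs, hs])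
    have hs := hn s (by simp [inputs])
    have ht := hn t (by simp [inputs])
    have e1 := (propagates_pos_left_of_neg hs).mp hpA
    have e2 := (propagates_pos_left_of_neg ht).mp hpB
    have := Generic.ne_of_neg (b := [s]) (c := [t]) hg (by simpa using hs) (by simpa using ht)
      (by simp) (by simp)
    simp [← e1, ← e2] at this

variable {δ : FeynmanDiagram} {L R : List StringState} {P : StringState}

/-- The last interaction of a diagram with one state `n > 0` absorbs an outermost state. -/
theorem Valid.cases_one (h : δ.Valid) (hg : Generic (L ++ P :: R)) (e : δ.inputs = L ++ P :: R)
    (hL : AllNeg L) (hR : AllNeg R) :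
    (L = [] ∧ R = [] ∧ δ = ext P) ∨
    (∃ x L' B, L = x :: L' ∧ δ = join x.pos (ext x) B ∧ B.Valid ∧ B.inputs = L' ++ P :: R ∧
      B.state.Propagates B.start x.pos ∧ ¬ B.JoinsAt x.pos) ∨
    ∃ z R' A, R = R' ++ [z] ∧ δ = join z.pos A (ext z) ∧ A.Valid ∧ A.inputs = L ++ P :: R' ∧
      A.state.Propagates A.start z.pos := by
  cases δ with
  | ext s =>
    left
    have := congrArg List.length e
    simp only [inputs, List.length_append, List.length_cons, List.length_nil] at this
    obtain rfl : L = [] := List.length_eq_zero_iff.mp (by omega)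
    obtain rfl : R = [] := List.length_eq_zero_iff.mp (by omega)
    simpa [inputs] using e
  | join y A B =>
    right
    obtain ⟨hvA, hvB, hpA, hpB, hj⟩ := h
    rw [inputs] at e
    have hg' := hg
    rw [← e] at hg'
    have left : ∀ a, L = A.inputs ++ a → B.inputs = a ++ P :: R → ∃ x L' B', L = x :: L' ∧
        join y A B = join x.pos (ext x) B' ∧ B'.Valid ∧ B'.inputs = L' ++ P :: R ∧
        B'.state.Propagates B'.start x.pos ∧ ¬ B'.JoinsAt x.pos := fun a h1 h2 => by
      obtain ⟨x, rfl⟩ := hvA.eq_ext_of_allNeg hg'.left fun s hs => hL s (by simp [h1, hs])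
      have hy := (propagates_pos_left_of_neg (hL x (by simp [h1, inputs]))).mp hpA
      subst hy
      exact ⟨x, a, B, h1, rfl, hvB, h2, hpB, hj⟩
    rcases List.append_eq_append_iff.mp e with ⟨a, h1, h2⟩ | ⟨c, h1, h2⟩
    · exact .inl (left a h1 h2)
    · rcases c with _ | ⟨q, c⟩
      · rw [List.append_nil] at h1
        exact .inl (left [] (by rw [h1, List.append_nil]) h2.symm)
      · obtain ⟨rfl, h3⟩ := List.cons_eq_cons.mp h2
        obtain ⟨z, rfl⟩ := hvB.eq_ext_of_allNeg hg'.right fun s hs => hR s (by simp [h3, hs])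
        have hy := (propagates_pos_left_of_neg (hR z (by simp [h3, inputs]))).mp hpB
        subst hy
        exact Or.inr ⟨z, c, A, h3, rfl, hvA, h1, hpA⟩

/-- What comes out of a vertex does not start with velocity `0`. -/
theorem Valid.start_ne (h : δ.Valid) (hg : Generic (L ++ P :: R)) (e : δ.inputs = L ++ P :: R)
    (hL : AllNeg L) (hR : AllNeg R) (hLR : L ≠ [] ∨ R ≠ []) (hn : 0 < (total (L ++ P :: R)).n) :
    δ.start ≠ (total (L ++ P :: R)).pos := by
  rcases h.cases_one hg e hL hR with ⟨rfl, rfl, -⟩ | ⟨x, L', B, rfl, rfl, -⟩ | ⟨z, R', A, rfl, rfl, -⟩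
  · simp at hLR
  · exact Generic.head_ne hg (by simp) (hL x (by simp)) hn
  · have e : L ++ P :: (R' ++ [z]) = (L ++ P :: R') ++ [z] := by simp
    rw [e] at hg hn ⊢
    exact hg.last_ne (by simp) (hR z (by simp)) hn

theorem Valid.exists_start_eq (h : δ.Valid) (hg : Generic (L ++ P :: R))
    (e : δ.inputs = L ++ P :: R) (hL : AllNeg L) (hR : AllNeg R) :
    ∃ s ∈ L ++ P :: R, δ.start = s.pos := by
  rcases h.cases_one hg e hL hR with ⟨rfl, rfl, rfl⟩ | ⟨x, L', B, rfl, rfl, -⟩ | ⟨z, R', A, rfl, rfl, -⟩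
  · exact ⟨P, by simp, rfl⟩
  · exact ⟨x, by simp, rfl⟩
  · exact ⟨z, by simp, rfl⟩

end FeynmanDiagram

theorem RReach.mono {L R : List StringState} {P : StringState} {x y : ℝ} (h : RReach L P R x)
    (hxy : x ≤ y) (hv : 0 < (total (L ++ P :: R)).vel y) : RReach L P R y :=
  ⟨h.1, fun s hs => (h.2.1 s hs).trans hxy, hv⟩

theorem LReach.mono {L R : List StringState} {P : StringState} {x y : ℝ} (h : LReach L P R x)
    (hxy : y ≤ x) (hv : (total (L ++ P :: R)).vel y < 0) : LReach L P R y :=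
  ⟨h.1, fun s hs => hxy.trans (h.2.1 s hs), hv⟩

namespace FeynmanDiagram

variable {δ : FeynmanDiagram} {L R : List StringState} {P : StringState}

/-- A state that arrives at a point with velocity different from `0` does not start with
velocity `0`. -/
theorem vel_start_ne {s : StringState} (hs : s.n ≠ 0) {x y : ℝ} (h : s.Propagates x y)
    (hv : s.vel y ≠ 0) (hx : 0 < s.n → x ≠ s.pos) : s.vel x ≠ 0 := by
  intro h0
  rw [vel_eq_zero_iff hs] at h0
  rcases lt_or_gt_of_ne hs with hn | hn
  · subst h0
    rw [(propagates_pos_left_of_neg hn).mp h, StringState.vel_pos hs] at hv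
    exact hv rfl
  · exact hx hn h0

/-- Along an edge the velocity points in the direction of motion, and an absorption at the point of
the absorbed state does not change it. The direction is thus constant through the whole diagram,
once `start_ne` excludes a start at velocity zero. -/
theorem Valid.reach (h : δ.Valid) (hg : Generic (L ++ P :: R)) (e : δ.inputs = L ++ P :: R)
    (hL : AllNeg L) (hR : AllNeg R) (hP : 0 < P.n) {y : ℝ} (hp : δ.state.Propagates δ.start y)
    (hv : (total (L ++ P :: R)).vel y ≠ 0) : RReach L P R y ∨ LReach L P R y := by
  induction k : L.length + R.length generalizing δ L R y with
  | zero =>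
    obtain rfl : L = [] := List.length_eq_zero_iff.mp (by omega)
    obtain rfl : R = [] := List.length_eq_zero_iff.mp (by omega)
    simp only [List.nil_append, total_single] at hv
    rcases lt_or_gt_of_ne hv with hv | hv
    · right
      have := (vel_neg_iff_of_pos hP).mp hv
      refine ⟨⟨by simp [Inc], by simp [Dec], fun h => ?_⟩, by simpa using this.le, by simpa using hv⟩
      simp at h; omega
    · left
      have := (vel_pos_iff_of_pos hP).mp hv
      refine ⟨⟨by simp [Dec], by simp [Inc], fun h => ?_⟩, by simpa using this.le, by simpa using hv⟩
      simp at h; omega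
  | succ k ih =>
    have hLR : L ≠ [] ∨ R ≠ [] := by
      by_contra h
      push Not at h
      obtain ⟨rfl, rfl⟩ := h
      simp at k
    have hne := h.start_ne hg e hL hR hLR
    rw [state_eq, e] at hp
    have hv0 := vel_start_ne (hg.n_ne (by simp)) hp hv hne
    have hp' := propagates_iff.mp hp
    -- it suffices to treat the starting point
    suffices hs : RReach L P R δ.start ∨ LReach L P R δ.start by
      rcases hs with hs | hs
      · left
        have h1 : δ.start ≤ y := by
          have := hs.2.2
          nlinarith [hp'.1]
        refine hs.mono h1 ?_
        rcases h1.eq_or_lt with h1 | h1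
        · exact h1 ▸ hs.2.2
        · refine lt_of_le_of_ne ?_ hv.symm
          have := hp'.2
          exact nonneg_of_mul_nonneg_right this (by linarith)
      · right
        have h1 : y ≤ δ.start := by
          have := hs.2.2
          nlinarith [hp'.1]
        refine hs.mono h1 ?_
        rcases h1.eq_or_lt with h1 | h1
        · exact h1 ▸ hs.2.2
        · refine lt_of_le_of_ne ?_ hv
          by_contra h2
          nlinarith [hp'.2]
    rcases h.cases_one hg e hL hR with ⟨rfl, rfl, rfl⟩ |
        ⟨x, L', B, rfl, rfl, hvB, eB, hpB, -⟩ | ⟨z, R', A, rfl, rfl, hvA, eA, hpA⟩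
    · simp at hLR
    · have hx := hL x (by simp)
      have hL' : AllNeg L' := fun s hs => hL s (by simp [hs])
      have hv1 : (total (L' ++ P :: R)).vel x.pos ≠ 0 := by
        intro h0
        refine hv0 ?_
        simp only [start]
        rw [List.cons_append, vel_cons, h0, StringState.vel_pos hx.ne, add_zero]
      rcases ih hvB hg.tail eB hL' hR hpB hv1 (by simp at k; omega) with h' | h'
      · exact .inl (h'.cons hg hx hL' hP)
      · exact .inr (h'.cons hg hx hL' hP)
    · have hz := hR z (by simp)
      have hR' : AllNeg R' := fun s hs => hR s (by simp [hs])
      have e' : L ++ P :: (R' ++ [z]) = (L ++ P :: R') ++ [z] := by simp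
      have hg' := hg
      rw [e'] at hg'
      have hv1 : (total (L ++ P :: R')).vel z.pos ≠ 0 := by
        intro h0
        refine hv0 ?_
        simp only [start]
        rw [e', vel_append, total_single, h0, StringState.vel_pos hz.ne, add_zero]
      rcases ih hvA hg'.left eA hL hR' hpA hv1 (by simp at k; omega) with h' | h'
      · exact .inl (h'.concat hg hz hR' hP)
      · exact .inr (h'.concat hg hz hR' hP)

end FeynmanDiagram

end

/-! ### Existence and uniqueness of the diagrams with one state with `n > 0`. -/

noncomputable section

open StringState LineModel

namespace StringState

theorem propagates_of_le {s : StringState} {a b : ℝ} (hab : a ≤ b) (ha : 0 ≤ s.vel a)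
    (hb : 0 ≤ s.vel b) : s.Propagates a b :=
  propagates_iff.mpr ⟨mul_nonneg (by linarith) ha, mul_nonneg (by linarith) hb⟩

end StringState

namespace FeynmanDiagram

variable {δ : FeynmanDiagram} {L R : List StringState} {P : StringState}

/-- A state absorbed on the left does not meet a composite state with velocity `0`. -/
theorem Valid.vel_ne_left {x : StringState} {B : FeynmanDiagram} (h : B.Valid)
    (hg : Generic (x :: L ++ P :: R)) (e : B.inputs = L ++ P :: R) (hx : x.n < 0) (hL : AllNeg L)
    (hR : AllNeg R) (hLR : L ≠ [] ∨ R ≠ []) (hp : B.state.Propagates B.start x.pos) :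
    (total (L ++ P :: R)).vel x.pos ≠ 0 := by
  have hg' : Generic (L ++ P :: R) := hg.tail
  have hne := hg'.n_ne (by simp)
  rw [Ne, vel_eq_zero_iff hne]
  intro h0
  rcases lt_or_gt_of_ne hne with hn | hn
  · exact Generic.ne_of_neg (b := [x]) (c := L ++ P :: R) hg (by simpa using hx) hn (by simp)
      (by simp) (by simpa using h0)
  · rw [state_eq, e, h0, propagates_pos_right_of_pos hn] at hp
    exact h.start_ne hg' e hL hR hLR hn hp

theorem Valid.vel_ne_right {z : StringState} {A : FeynmanDiagram} (h : A.Valid)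
    (hg : Generic (L ++ P :: (R ++ [z]))) (e : A.inputs = L ++ P :: R) (hz : z.n < 0)
    (hL : AllNeg L) (hR : AllNeg R) (hLR : L ≠ [] ∨ R ≠ [])
    (hp : A.state.Propagates A.start z.pos) : (total (L ++ P :: R)).vel z.pos ≠ 0 := by
  rw [show L ++ P :: (R ++ [z]) = (L ++ P :: R) ++ [z] by simp] at hg
  have hne := hg.left.n_ne (by simp)
  rw [Ne, vel_eq_zero_iff hne]
  intro h0
  rcases lt_or_gt_of_ne hne with hn | hn
  · exact hg.ne_of_neg hn (by simpa using hz) (by simp) (by simp) (by simpa using h0.symm)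
  · rw [state_eq, e, h0, propagates_pos_right_of_pos hn] at hp
    exact h.start_ne hg.left e hL hR hLR hn hp

/-- What moves to the right starts from its rightmost input. -/
theorem Valid.le_start (h : δ.Valid) (hg : Generic (L ++ P :: R)) (e : δ.inputs = L ++ P :: R)
    (hL : AllNeg L) (hR : AllNeg R) (hP : 0 < P.n) (hr : RGood L P R) :
    ∀ s ∈ L ++ P :: R, s.pos ≤ δ.start := by
  rcases h.cases_one hg e hL hR with ⟨rfl, rfl, rfl⟩ | ⟨x, L', B, rfl, rfl, hvB, eB, hpB, -⟩ |
    ⟨z, R', A, rfl, rfl, hvA, eA, hpA⟩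
  · simp [start]
  · have hx := hL x (by simp)
    have hL' : AllNeg L' := fun s hs => hL s (by simp [hs])
    by_cases hLR : L' ≠ [] ∨ R ≠ []
    · rcases hvB.reach hg.tail eB hL' hR hP hpB
        (hvB.vel_ne_left hg eB hx hL' hR hLR hpB) with h' | h'
      · exact (h'.cons hg hx hL' hP).2.1
      · exact (not_rGood_and_lGood (by simp) hr (h'.cons hg hx hL' hP).1).elim
    · push Not at hLR
      obtain ⟨rfl, rfl⟩ := hLR
      simpa [start] using (hr.1.lt_of_mem (s := x) (by simp)).le
  · have hz := hR z (by simp)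
    have hR' : AllNeg R' := fun s hs => hR s (by simp [hs])
    by_cases hLR : L ≠ [] ∨ R' ≠ []
    · have hg' := hg
      rw [show L ++ P :: (R' ++ [z]) = (L ++ P :: R') ++ [z] by simp] at hg'
      rcases hvA.reach hg'.left eA hL hR' hP hpA
        (hvA.vel_ne_right hg eA hz hL hR' hLR hpA) with h' | h'
      · exact (h'.concat hg hz hR' hP).2.1
      · exact (not_rGood_and_lGood (by simp) hr (h'.concat hg hz hR' hP).1).elim
    · push Not at hLR
      obtain ⟨rfl, rfl⟩ := hLR
      simpa [start] using (hr.2.1.lt_of_mem_tail (s := z) (by simp)).le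

/-- By `le_start`, an input at `y` would put the start of the diagram at `y`. It would then be a
vertex at `y`, which `hj` excludes, or an external state with velocity zero. -/
theorem Valid.lt_of_rReach (h : δ.Valid) (hg : Generic (L ++ P :: R)) (e : δ.inputs = L ++ P :: R)
    (hL : AllNeg L) (hR : AllNeg R) (hP : 0 < P.n) {y : ℝ} (hr : RReach L P R y)
    (hj : ¬ δ.JoinsAt y) : ∀ s ∈ L ++ P :: R, s.pos < y := by
  have h1 := h.le_start hg e hL hR hP hr.1
  intro s hs
  refine lt_of_le_of_ne (hr.2.1 s hs) fun hs' => ?_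
  obtain ⟨t, ht, ht'⟩ := h.exists_start_eq hg e hL hR
  have hy : δ.start = y := le_antisymm (ht' ▸ hr.2.1 t ht) (hs' ▸ h1 s hs)
  cases δ with
  | join y' A B => exact hj hy
  | ext u =>
    have hv := hr.2.2
    rw [← e, inputs, total_single, ← hy, start] at hv
    have hu : u.n ≠ 0 := hg.mem_n_ne (s := u) (by simp [← e, inputs])
    rw [StringState.vel_pos hu] at hv
    exact lt_irrefl _ hv

theorem Valid.lt_of_lReach (h : δ.Valid) (hg : Generic (L ++ P :: R)) (e : δ.inputs = L ++ P :: R)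
    (hL : AllNeg L) (hR : AllNeg R) (hP : 0 < P.n) {y : ℝ} (hr : LReach L P R y)
    (hj : ¬ δ.JoinsAt y) : ∀ s ∈ L ++ P :: R, y < s.pos := by
  have e' : L.map StringState.mirror ++ P.mirror :: R.map StringState.mirror =
    (L ++ P :: R).map StringState.mirror := by simp
  have := h.mirror.lt_of_rReach (e' ▸ hg.mirror) (by rw [inputs_mirror, e, e']) hL.mirror hR.mirror
    (P := P.mirror) hP (rReach_mirror.mpr hr) (fun h' => hj (by simpa using JoinsAt.mirror h'))
  intro s hs
  simpa using this s.mirror (e' ▸ List.mem_map_of_mem hs)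

/-- The classification of the diagrams whose last interaction absorbs a state on the left. -/
theorem Valid.cases_left {x : StringState} {B : FeynmanDiagram} (h : B.Valid)
    (hg : Generic (x :: L ++ P :: R)) (e : B.inputs = L ++ P :: R) (hx : x.n < 0) (hL : AllNeg L)
    (hR : AllNeg R) (hP : 0 < P.n) (hp : B.state.Propagates B.start x.pos)
    (hj : ¬ B.JoinsAt x.pos) : (L = [] ∧ R = []) ∨
      (RGood (x :: L) P R ∧ ∀ s ∈ L ++ P :: R, s.pos < x.pos) ∨
      (LGood (x :: L) P R ∧ ∀ s ∈ L ++ P :: R, x.pos < s.pos) := by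
  by_cases hLR : L ≠ [] ∨ R ≠ []
  · right
    rcases h.reach hg.tail e hL hR hP hp (h.vel_ne_left hg e hx hL hR hLR hp) with h' | h'
    · exact .inl ⟨(h'.cons hg hx hL hP).1, h.lt_of_rReach hg.tail e hL hR hP h' hj⟩
    · exact .inr ⟨(h'.cons hg hx hL hP).1, h.lt_of_lReach hg.tail e hL hR hP h' hj⟩
  · push Not at hLR
    exact .inl hLR

theorem Valid.cases_right {z : StringState} {A : FeynmanDiagram} (h : A.Valid)
    (hg : Generic (L ++ P :: (R ++ [z]))) (e : A.inputs = L ++ P :: R) (hz : z.n < 0)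
    (hL : AllNeg L) (hR : AllNeg R) (hP : 0 < P.n)
    (hp : A.state.Propagates A.start z.pos) : (L = [] ∧ R = []) ∨
      (RGood L P (R ++ [z]) ∧ ∀ s ∈ L ++ P :: R, s.pos ≤ z.pos) ∨
      (LGood L P (R ++ [z]) ∧ ∀ s ∈ L ++ P :: R, z.pos ≤ s.pos) := by
  by_cases hLR : L ≠ [] ∨ R ≠ []
  · right
    have hg' := hg
    rw [show L ++ P :: (R ++ [z]) = (L ++ P :: R) ++ [z] by simp] at hg'
    rcases h.reach hg'.left e hL hR hP hp (h.vel_ne_right hg e hz hL hR hLR hp) with h' | h'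
    · exact .inl ⟨(h'.concat hg hz hR hP).1, h'.2.1⟩
    · exact .inr ⟨(h'.concat hg hz hR hP).1, h'.2.1⟩
  · push Not at hLR
    exact .inl hLR

/-- The last interaction absorbs either a state on the left or a state on the right. -/
theorem Valid.not_left_and_right {x z : StringState} {A B : FeynmanDiagram}
    (hg : Generic (x :: L ++ P :: (R ++ [z]))) (hL : AllNeg (x :: L)) (hR : AllNeg (R ++ [z]))
    (hP : 0 < P.n) (hvB : B.Valid) (eB : B.inputs = L ++ P :: (R ++ [z]))
    (hpB : B.state.Propagates B.start x.pos) (hj : ¬ B.JoinsAt x.pos) (hvA : A.Valid)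
    (eA : A.inputs = x :: L ++ P :: R) (hpA : A.state.Propagates A.start z.pos) : False := by
  have hL' : AllNeg L := fun s hs => hL s (by simp [hs])
  have hR' : AllNeg R := fun s hs => hR s (by simp [hs])
  -- By the bracketing convention an absorption on the left puts the other inputs strictly behind
  -- `x`, one on the right only weakly behind `z`. With the same direction of motion `x` and `z`
  -- would each lie beyond the other.
  have h1 := hvB.cases_left hg eB (hL x (by simp)) hL' hR hP hpB hj
  have h2 := hvA.cases_right hg eA (hR z (by simp)) hL hR' hP hpA
  simp only [List.append_eq_nil_iff, reduceCtorEq, and_false, false_and, false_or] at h1 h2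
  have hm1 : z ∈ L ++ P :: (R ++ [z]) := by simp
  have hm2 : x ∈ x :: L ++ P :: R := by simp
  rcases h1 with ⟨h1, h3⟩ | ⟨h1, h3⟩ <;> rcases h2 with ⟨h2, h4⟩ | ⟨h2, h4⟩
  · linarith [h3 z hm1, h4 x hm2]
  · exact not_rGood_and_lGood (by simp) h1 h2
  · exact not_rGood_and_lGood (by simp) h2 h1
  · linarith [h3 z hm1, h4 x hm2]

/-- A diagram with one state `n > 0` is determined by its inputs. -/
theorem Valid.eq_of_one {δ' : FeynmanDiagram} (h : δ.Valid) (h' : δ'.Valid)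
    (hg : Generic (L ++ P :: R)) (e : δ.inputs = L ++ P :: R) (e' : δ'.inputs = L ++ P :: R)
    (hL : AllNeg L) (hR : AllNeg R) (hP : 0 < P.n) : δ = δ' := by
  induction k : L.length + R.length generalizing δ δ' L R with
  | zero =>
    obtain rfl : L = [] := List.length_eq_zero_iff.mp (by omega)
    obtain rfl : R = [] := List.length_eq_zero_iff.mp (by omega)
    have h1 := h.cases_one hg e hL hR
    have h2 := h'.cases_one hg e' hL hR
    simp only [reduceCtorEq, List.nil_eq, List.append_eq_nil_iff, and_false, false_and,
      exists_false, or_false, true_and] at h1 h2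
    rw [h1, h2]
  | succ k ih =>
    rcases h.cases_one hg e hL hR with ⟨h1, h2, rfl⟩ | ⟨x, L', B, rfl, rfl, hvB, eB, hpB, hj⟩ |
      ⟨z, R', A, rfl, rfl, hvA, eA, hpA⟩
    · simp [h1, h2] at k
    · rcases h'.cases_one hg e' hL hR with ⟨h1, -⟩ |
        ⟨x₂, L₂, B₂, h2, rfl, hvB₂, eB₂, -⟩ | ⟨z₂, R₂, A₂, rfl, rfl, hvA₂, eA₂, hpA₂⟩
      · simp at h1
      · obtain ⟨rfl, rfl⟩ := List.cons_eq_cons.mp h2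
        rw [ih hvB hvB₂ hg.tail eB eB₂ (fun s hs => hL s (by simp [hs])) hR
          (by simp at k; omega)]
      · exact (Valid.not_left_and_right hg hL hR hP hvB eB hpB hj hvA₂ eA₂ hpA₂).elim
    · rcases h'.cases_one hg e' hL hR with ⟨-, h1, -⟩ |
        ⟨x₂, L₂, B₂, rfl, rfl, hvB₂, eB₂, hpB₂, hj₂⟩ | ⟨z₂, R₂, A₂, h2, rfl, hvA₂, eA₂, -⟩
      · simp at h1
      · exact (Valid.not_left_and_right hg hL hR hP hvB₂ eB₂ hpB₂ hj₂ hvA eA hpA).elim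
      · obtain ⟨rfl, h2⟩ := List.append_inj' h2 rfl
        obtain rfl : z = z₂ := by simpa using h2
        rw [show L ++ P :: (R' ++ [z]) = (L ++ P :: R') ++ [z] by simp] at hg
        rw [ih hvA hvA₂ hg.left eA eA₂ hL (fun s hs => hR s (by simp [hs]))
          (by simp at k; omega)]

/-- The diagrams of the states that move to the right. -/
theorem exists_valid_of_rGood (hg : Generic (L ++ P :: R)) (hL : AllNeg L) (hR : AllNeg R)
    (hP : 0 < P.n) (h : RGood L P R) : ∃ δ : FeynmanDiagram, δ.Valid ∧ δ.inputs = L ++ P :: R ∧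
      ∀ y, RReach L P R y → δ.state.Propagates δ.start y := by
  induction k : L.length + R.length generalizing L R with
  | zero =>
    obtain rfl : L = [] := List.length_eq_zero_iff.mp (by omega)
    obtain rfl : R = [] := List.length_eq_zero_iff.mp (by omega)
    exact ⟨ext P, trivial, rfl, fun y _ => propagates_pos_left_of_pos hP y⟩
  | succ k ih =>
    have hLR : L ≠ [] ∨ R ≠ [] := by
      by_contra h
      push Not at h
      obtain ⟨rfl, rfl⟩ := h
      simp at k
    have right : ∀ z R', R = R' ++ [z] → (∀ s ∈ L ++ P :: R', s.pos ≤ z.pos) →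
        ∃ δ : FeynmanDiagram, δ.Valid ∧ δ.inputs = L ++ P :: R ∧
          ∀ y, RReach L P R y → δ.state.Propagates δ.start y := by
      rintro z R' rfl hz
      have hg' := hg
      rw [show L ++ P :: (R' ++ [z]) = (L ++ P :: R') ++ [z] by simp] at hg'
      have hr := h.of_concat hg hL hR hP hz
      obtain ⟨A, hvA, eA, hpA⟩ := ih hg'.left hL (fun s hs => hR s (by simp [hs])) hr.1
        (by simp at k; omega)
      refine ⟨join z.pos A (ext z), ⟨hvA, trivial, hpA _ hr, propagates_refl _ _, id⟩,
        by simp [inputs, eA], fun y hy => ?_⟩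
      rw [state_eq, show (join z.pos A (ext z)).inputs = L ++ P :: (R' ++ [z]) by simp [inputs, eA]]
      exact propagates_of_le (hy.2.1 z (by simp)) (h.vel_pos hg hL hR hP (by simp)).le hy.2.2.le
    -- The farthest input is absorbed last. If both ends are farthest, the bracketing to the left
    -- requires the right one to come last.
    rcases exists_extreme h.1 h.2.1 hLR with ⟨x, L', rfl, hx⟩ | ⟨x, L', z, R', rfl, hR', hxz, hx⟩ |
      ⟨z, R', hR', hz⟩
    · have hr := h.of_cons hg hL hR hP fun s hs => (hx s hs).le
      have hL' : AllNeg L' := fun s hs => hL s (by simp [hs])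
      obtain ⟨B, hvB, eB, hpB⟩ := ih hg.tail hL' hR hr.1 (by simp at k; omega)
      refine ⟨join x.pos (ext x) B, ⟨trivial, hvB, propagates_refl _ _, hpB _ hr, fun hj => ?_⟩,
        by simp [inputs, eB], fun y hy => ?_⟩
      · obtain ⟨s, hs, hs'⟩ := hvB.exists_start_eq hg.tail eB hL' hR
        rw [hj.start_eq] at hs'
        exact (hx s hs).ne' hs'
      · rw [state_eq, show (join x.pos (ext x) B).inputs = x :: L' ++ P :: R by simp [inputs, eB]]
        exact propagates_of_le (hy.2.1 x (by simp)) (h.vel_pos hg hL hR hP (by simp)).le hy.2.2.le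
    · refine right z R' hR' fun s hs => ?_
      rw [List.cons_append, List.mem_cons] at hs
      rcases hs with rfl | hs
      exacts [hxz.le, hxz ▸ (hx s hs).le]
    · exact right z R' hR' fun s hs => (hz s hs).le

theorem exists_valid_of_lGood (hg : Generic (L ++ P :: R)) (hL : AllNeg L) (hR : AllNeg R)
    (hP : 0 < P.n) (h : LGood L P R) : ∃ δ : FeynmanDiagram, δ.Valid ∧ δ.inputs = L ++ P :: R ∧
      ∀ y, LReach L P R y → δ.state.Propagates δ.start y := by
  have e : L.map StringState.mirror ++ P.mirror :: R.map StringState.mirror =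
    (L ++ P :: R).map StringState.mirror := by simp
  obtain ⟨δ, h1, h2, h3⟩ := exists_valid_of_rGood (P := P.mirror) (e ▸ hg.mirror) hL.mirror
    hR.mirror hP (rGood_mirror.mpr h)
  refine ⟨δ.mirror, h1.mirror, by rw [inputs_mirror, h2, e, map_mirror_mirror], fun y hy => ?_⟩
  have := (h3 _ (rReach_mirror.mpr hy)).mirror
  rwa [neg_neg, ← start_mirror, ← state_mirror] at this

/-- These are exactly the cases in which `coef_one` is nonzero. Two inputs always have a diagram,
even at a common point. -/
theorem exists_valid_one_iff (hg : Generic (L ++ P :: R)) (hL : AllNeg L) (hR : AllNeg R)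
    (hP : 0 < P.n) (hn : (total (L ++ P :: R)).n < 0) :
    (∃ δ : FeynmanDiagram, δ.Valid ∧ δ.inputs = L ++ P :: R) ↔
      L.length + R.length = 1 ∨ RGood L P R ∨ LGood L P R := by
  constructor
  · rintro ⟨δ, h, e⟩
    rcases h.cases_one hg e hL hR with ⟨rfl, rfl, rfl⟩ | ⟨x, L', B, rfl, rfl, hvB, eB, hpB, hj⟩ |
      ⟨z, R', A, rfl, rfl, hvA, eA, hpA⟩
    · simp at hn; omega
    · rcases hvB.cases_left hg eB (hL x (by simp)) (fun s hs => hL s (by simp [hs])) hR hP hpB hj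
        with ⟨rfl, rfl⟩ | ⟨h1, -⟩ | ⟨h1, -⟩
      exacts [.inl rfl, .inr (.inl h1), .inr (.inr h1)]
    · rcases hvA.cases_right hg eA (hR z (by simp)) hL (fun s hs => hR s (by simp [hs])) hP hpA
        with ⟨rfl, rfl⟩ | ⟨h1, -⟩ | ⟨h1, -⟩
      exacts [.inl rfl, .inr (.inl h1), .inr (.inr h1)]
  · rintro (h | h | h)
    · rcases Nat.add_eq_one_iff.mp h with ⟨h1, h2⟩ | ⟨h1, h2⟩
      · obtain rfl := List.length_eq_zero_iff.mp h1
        obtain ⟨z, rfl⟩ := List.length_eq_one_iff.mp h2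
        exact ⟨join z.pos (ext P) (ext z), ⟨trivial, trivial, propagates_pos_left_of_pos hP _,
          propagates_refl _ _, id⟩, rfl⟩
      · obtain rfl := List.length_eq_zero_iff.mp h2
        obtain ⟨x, rfl⟩ := List.length_eq_one_iff.mp h1
        exact ⟨join x.pos (ext x) (ext P), ⟨trivial, trivial, propagates_refl _ _,
          propagates_pos_left_of_pos hP _, id⟩, rfl⟩
    · obtain ⟨δ, h1, h2, -⟩ := exists_valid_of_rGood hg hL hR hP h
      exact ⟨δ, h1, h2⟩
    · obtain ⟨δ, h1, h2, -⟩ := exists_valid_of_lGood hg hL hR hP h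
      exact ⟨δ, h1, h2⟩

end FeynmanDiagram

end

noncomputable section

open StringState LineModel

/-! ### Diagrams with two states with `n > 0` -/

theorem exists_split_of_inc {l : List StringState} (h : Inc l) (y : ℝ) : ∃ a b, a ++ b = l ∧
    (∀ s ∈ a, s.pos ≤ y) ∧ ∀ s ∈ b, y < s.pos := by
  induction l with
  | nil => exact ⟨[], [], rfl, by simp, by simp⟩
  | cons s l ih =>
    obtain ⟨h1, h2⟩ := List.pairwise_cons.mp h
    by_cases hs : s.pos ≤ y
    · obtain ⟨a, b, rfl, ha, hb⟩ := ih h2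
      exact ⟨s :: a, b, rfl, by simpa using ⟨hs, ha⟩, hb⟩
    · push Not at hs
      exact ⟨[], s :: l, rfl, by simp, by simpa using ⟨hs, fun t ht => hs.trans (h1 t ht)⟩⟩

theorem append_split_unique {X : Type*} {p : X → Prop} {a b c d : List X} (h : a ++ b = c ++ d)
    (ha : ∀ s ∈ a, p s) (hb : ∀ s ∈ b, ¬ p s) (hc : ∀ s ∈ c, p s) (hd : ∀ s ∈ d, ¬ p s) :
    a = c ∧ b = d := by
  rcases List.append_eq_append_iff.mp h with ⟨e, rfl, rfl⟩ | ⟨e, rfl, rfl⟩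
  · match e with
    | [] => simp
    | x :: e => exact (hb x (by simp) (hc x (by simp))).elim
  · match e with
    | [] => simp
    | x :: e => exact (hd x (by simp) (ha x (by simp))).elim

namespace FeynmanDiagram

variable {δ : FeynmanDiagram} {L M R : List StringState} {P Q : StringState} {y : ℝ}

/-- By `head_ne` and `last_ne` no single state with `n < 0` is absorbed at the outgoing point, so
each factor of the last interaction contains one of `P`, `Q`. -/
theorem Valid.cases_two (h : δ.Valid) (hg : Generic (L ++ P :: (M ++ Q :: R)))
    (e : δ.inputs = L ++ P :: (M ++ Q :: R)) (hL : AllNeg L) (hR : AllNeg R)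
    (hn : 0 < (total (L ++ P :: (M ++ Q :: R))).n)
    (hy : y = (total (L ++ P :: (M ++ Q :: R))).pos) (hs : δ.start = y) :
    ∃ M₁ M₂ A B, M = M₁ ++ M₂ ∧ δ = join y A B ∧ A.Valid ∧ B.Valid ∧ A.inputs = L ++ P :: M₁ ∧
      B.inputs = M₂ ++ Q :: R ∧ A.state.Propagates A.start y ∧ B.state.Propagates B.start y ∧
      ¬ B.JoinsAt y := by
  cases δ with
  | ext s =>
    have := congrArg List.length e
    simp [inputs] at this
    omega
  | join y' A B =>
    obtain rfl : y' = y := hs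
    obtain ⟨hvA, hvB, hpA, hpB, hj⟩ := h
    rw [inputs] at e
    have hg' := hg
    have hn' := hn
    have hy' := hy
    rw [← e] at hg' hn' hy'
    have hA : ¬ AllNeg A.inputs := fun hA => by
      obtain ⟨x, rfl⟩ := hvA.eq_ext_of_allNeg hg'.left hA
      have h1 := (propagates_pos_left_of_neg (hA x (by simp [inputs]))).mp hpA
      exact Generic.head_ne (x := x) hg' B.inputs_ne_nil (hA x (by simp [inputs])) hn'
        (h1.symm.trans hy')
    have hB : ¬ AllNeg B.inputs := fun hB => by
      obtain ⟨x, rfl⟩ := hvB.eq_ext_of_allNeg hg'.right hB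
      have h1 := (propagates_pos_left_of_neg (hB x (by simp [inputs]))).mp hpB
      exact hg'.last_ne A.inputs_ne_nil (hB x (by simp [inputs])) hn' (h1.symm.trans hy')
    rcases List.append_eq_append_iff.mp e with ⟨a, h1, h2⟩ | ⟨c, h1, h2⟩
    · exact (hA fun s hs => hL s (by simp [h1, hs])).elim
    · rcases c with _ | ⟨q, c⟩
      · rw [List.append_nil] at h1
        exact (hA (h1 ▸ hL)).elim
      · obtain ⟨rfl, h3⟩ := List.cons_eq_cons.mp h2
        rcases List.append_eq_append_iff.mp h3.symm with ⟨a, h4, h5⟩ | ⟨d, h4, h5⟩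
        · exact ⟨c, a, A, B, h4, rfl, hvA, hvB, h1, h5, hpA, hpB, hj⟩
        · rcases d with _ | ⟨q', d⟩
          · rw [List.append_nil] at h4
            exact ⟨c, [], A, B, by simp [h4], rfl, hvA, hvB, h1, h5.symm, hpA, hpB, hj⟩
          · obtain ⟨rfl, h6⟩ := List.cons_eq_cons.mp h5
            exact (hB fun s hs => hR s (by simp [h6, hs])).elim

/-- Two states that meet at their common point do not come from an interaction. -/
theorem Valid.eq_nil_of_vel_eq_zero {A : FeynmanDiagram} (h : A.Valid)
    (hg : Generic (L ++ P :: R)) (e : A.inputs = L ++ P :: R) (hL : AllNeg L) (hR : AllNeg R)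
    (hn : 0 < (total (L ++ P :: R)).n) (hp : A.state.Propagates A.start y)
    (hv : (total (L ++ P :: R)).vel y = 0) : L = [] ∧ R = [] := by
  rw [vel_eq_zero_iff hn.ne'] at hv
  rw [state_eq, e, hv, propagates_pos_right_of_pos hn] at hp
  by_contra hLR
  exact h.start_ne hg e hL hR (by tauto) hn hp

theorem rGood₂_of_reach {M₁ M₂ : List StringState} {B : FeynmanDiagram} (hvB : B.Valid)
    (eB : B.inputs = M₂ ++ Q :: R) (hg : Generic (L ++ P :: (M₁ ++ M₂ ++ Q :: R))) (hL : AllNeg L)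
    (hM₁ : AllNeg M₁) (hM₂ : AllNeg M₂) (hR : AllNeg R) (hP : 0 < P.n) (hQ : 0 < Q.n)
    (hn : 0 < (total (L ++ P :: (M₁ ++ M₂ ++ Q :: R))).n)
    (hy : y = (total (L ++ P :: (M₁ ++ M₂ ++ Q :: R))).pos) (hj : ¬ B.JoinsAt y)
    (hA : RReach L P M₁ y) (hB : LReach M₂ Q R y) : RGood₂ L P (M₁ ++ M₂) Q R ∧
      (∀ s ∈ M₁, s.pos ≤ y) ∧ ∀ s ∈ M₂, y < s.pos := by
  have hs₂ : M₂ ++ Q :: R <:+: L ++ P :: (M₁ ++ M₂ ++ Q :: R) := ⟨L ++ P :: M₁, [], by simp⟩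
  refine (rGood₂_iff hg hn hL hM₁ hM₂ hR hP hQ hy).mp ⟨⟨hA.1, hA.2.1, fun hn => ?_⟩, hB.1,
    hvB.lt_of_lReach (hg.sub hs₂) eB hM₂ hR hQ hB hj, fun hn => ?_⟩
  · exact (vel_pos_iff_of_neg hn).mp hA.2.2
  · exact ((vel_neg_iff_of_neg hn).mp hB.2.2).le

/-- If the opposite velocities of the factors vanish at `y`, both factors have `n > 0` by general
position and are external. Otherwise they come from opposite sides; the second orientation is the
reflection of the first, since the bracketing convention is invariant under reflection. -/
theorem Valid.good_of_two {M₁ M₂ : List StringState} {A B : FeynmanDiagram} (hvA : A.Valid)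
    (hvB : B.Valid) (eA : A.inputs = L ++ P :: M₁) (eB : B.inputs = M₂ ++ Q :: R)
    (hg : Generic (L ++ P :: (M₁ ++ M₂ ++ Q :: R))) (hL : AllNeg L)
    (hM₁ : AllNeg M₁) (hM₂ : AllNeg M₂) (hR : AllNeg R) (hP : 0 < P.n) (hQ : 0 < Q.n)
    (hn : 0 < (total (L ++ P :: (M₁ ++ M₂ ++ Q :: R))).n)
    (hy : y = (total (L ++ P :: (M₁ ++ M₂ ++ Q :: R))).pos) (hpA : A.state.Propagates A.start y)
    (hpB : B.state.Propagates B.start y) (hj : ¬ B.JoinsAt y) :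
    (L = [] ∧ M₁ ++ M₂ = [] ∧ R = []) ∨
    (RGood₂ L P (M₁ ++ M₂) Q R ∧ (∀ s ∈ M₁, s.pos ≤ y) ∧ ∀ s ∈ M₂, y < s.pos) ∨
    (LGood₂ L P (M₁ ++ M₂) Q R ∧ (∀ s ∈ M₁, y ≤ s.pos) ∧ ∀ s ∈ M₂, s.pos < y) := by
  have e : L ++ P :: (M₁ ++ M₂ ++ Q :: R) = (L ++ P :: M₁) ++ (M₂ ++ Q :: R) := by simp
  have hg' := hg
  rw [e] at hg'
  have hn1 := hg'.left.n_ne (by simp)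
  have hn2 := hg'.right.n_ne (by simp)
  have hnn := hn
  rw [e, n_append] at hnn
  have hv : (total (L ++ P :: M₁)).vel y + (total (M₂ ++ Q :: R)).vel y = 0 := by
    rw [← vel_append, ← e, hy, StringState.vel_pos hn.ne']
  by_cases h0 : (total (L ++ P :: M₁)).vel y = 0
  · left
    have h0' : (total (M₂ ++ Q :: R)).vel y = 0 := by linarith
    have hne : ¬ ((total (L ++ P :: M₁)).n < 0 ∨ (total (M₂ ++ Q :: R)).n < 0) := fun h =>
      hg'.ne_of_pos (e ▸ hn) h (by simp) (by simp)
        (((vel_eq_zero_iff hn1).mp h0).symm.trans ((vel_eq_zero_iff hn2).mp h0'))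
    obtain ⟨rfl, rfl⟩ := hvA.eq_nil_of_vel_eq_zero hg'.left eA hL hM₁ (by omega) hpA h0
    obtain ⟨rfl, rfl⟩ := hvB.eq_nil_of_vel_eq_zero hg'.right eB hM₂ hR (by omega) hpB h0'
    simp
  · right
    have hA := hvA.reach hg'.left eA hL hM₁ hP hpA h0
    have hB := hvB.reach hg'.right eB hM₂ hR hQ hpB (fun h => h0 (by linarith))
    rcases hA with hA | hA
    · left
      have hB := hB.resolve_left fun hB => by linarith [hA.2.2, hB.2.2]
      exact rGood₂_of_reach hvB eB hg hL hM₁ hM₂ hR hP hQ hn hy hj hA hB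
    · right
      have hB := hB.resolve_right fun hB => by linarith [hA.2.2, hB.2.2]
      have e' : L.map StringState.mirror ++ P.mirror :: (M₁.map StringState.mirror ++ M₂.map StringState.mirror ++
        Q.mirror :: R.map StringState.mirror) = (L ++ P :: (M₁ ++ M₂ ++ Q :: R)).map StringState.mirror := by simp
      have := rGood₂_of_reach (y := -y) hvB.mirror (M₂ := M₂.map StringState.mirror) (Q := Q.mirror)
        (R := R.map StringState.mirror) (by simp [eB]) (L := L.map StringState.mirror) (P := P.mirror)
        (M₁ := M₁.map StringState.mirror) (by rw [e']; exact hg.mirror) hL.mirror hM₁.mirror hM₂.mirror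
        hR.mirror hP hQ (by rw [e', total_map_mirror]; exact hn)
        (by rw [e', total_map_mirror, mirror_pos, hy]) (fun h => hj (by simpa using JoinsAt.mirror h))
        (rReach_mirror.mpr hA) (lReach_mirror.mpr hB)
      rw [← List.map_append, rGood₂_mirror] at this
      simpa only [List.forall_mem_map, mirror_pos, neg_le_neg_iff, neg_lt_neg_iff] using this

theorem exists_of_rGood₂ (hg : Generic (L ++ P :: (M ++ Q :: R))) (hL : AllNeg L) (hM : AllNeg M)
    (hR : AllNeg R) (hP : 0 < P.n) (hQ : 0 < Q.n)
    (hn : 0 < (total (L ++ P :: (M ++ Q :: R))).n)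
    (hy : y = (total (L ++ P :: (M ++ Q :: R))).pos) (h : RGood₂ L P M Q R) :
    ∃ δ : FeynmanDiagram, δ.Valid ∧ δ.inputs = L ++ P :: (M ++ Q :: R) ∧ δ.start = y := by
  have hM' : Inc M := ((inc_append_iff.mp h.2.1).1).of_cons
  obtain ⟨M₁, M₂, rfl, h1, h2⟩ := exists_split_of_inc hM' y
  have hm₁ : AllNeg M₁ := fun s hs => hM s (by simp [hs])
  have hm₂ : AllNeg M₂ := fun s hs => hM s (by simp [hs])
  obtain ⟨⟨h3, h4, h5⟩, h6, h7, h8⟩ :=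
    (rGood₂_iff hg hn hL hm₁ hm₂ hR hP hQ hy).mpr ⟨h, h1, h2⟩
  have e : L ++ P :: (M₁ ++ M₂ ++ Q :: R) = (L ++ P :: M₁) ++ (M₂ ++ Q :: R) := by simp
  have hg' := hg
  rw [e] at hg'
  have hv : (total (L ++ P :: M₁)).vel y + (total (M₂ ++ Q :: R)).vel y = 0 := by
    rw [← vel_append, ← e, hy, StringState.vel_pos hn.ne']
  have hvA : 0 < (total (L ++ P :: M₁)).vel y := by
    by_cases hn1 : (total (L ++ P :: M₁)).n < 0
    · exact (vel_pos_iff_of_neg hn1).mpr (h5 hn1)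
    · have hn' : (0 : ℝ) < (total (L ++ P :: M₁)).n := by
        exact_mod_cast hg'.left.n_pos_of (by simp) hn1
      have h9 := h3.le_vel hL hm₁ hP y
      have h10 := h.2.2.2.1 P (by simp)
      rw [← hy] at h10
      nlinarith
  obtain ⟨A, vA, eA, pA⟩ := exists_valid_of_rGood hg'.left hL hm₁ hP h3
  obtain ⟨B, vB, eB, pB⟩ := exists_valid_of_lGood hg'.right hm₂ hR hQ h6
  refine ⟨join y A B, ⟨vA, vB, pA y ⟨h3, h4, hvA⟩, pB y ⟨h6, fun s hs => (h7 s hs).le, by linarith⟩,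
    fun hj => ?_⟩, by simp [inputs, eA, eB], rfl⟩
  obtain ⟨s, hs, hs'⟩ := vB.exists_start_eq hg'.right eB hm₂ hR
  rw [hj.start_eq] at hs'
  exact (h7 s hs).ne hs'

theorem exists_of_lGood₂ (hg : Generic (L ++ P :: (M ++ Q :: R))) (hL : AllNeg L) (hM : AllNeg M)
    (hR : AllNeg R) (hP : 0 < P.n) (hQ : 0 < Q.n)
    (hn : 0 < (total (L ++ P :: (M ++ Q :: R))).n)
    (hy : y = (total (L ++ P :: (M ++ Q :: R))).pos) (h : LGood₂ L P M Q R) :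
    ∃ δ : FeynmanDiagram, δ.Valid ∧ δ.inputs = L ++ P :: (M ++ Q :: R) ∧ δ.start = y := by
  have e' : L.map StringState.mirror ++ P.mirror :: (M.map StringState.mirror ++
    Q.mirror :: R.map StringState.mirror) = (L ++ P :: (M ++ Q :: R)).map StringState.mirror := by simp
  obtain ⟨δ, h1, h2, h3⟩ := exists_of_rGood₂ (y := -y) (P := P.mirror) (Q := Q.mirror)
    (e' ▸ hg.mirror) hL.mirror hM.mirror hR.mirror hP hQ
    (by rw [e', total_map_mirror]; exact hn) (by rw [e', total_map_mirror, mirror_pos, hy])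
    (rGood₂_mirror.mpr h)
  exact ⟨δ.mirror, h1.mirror, by rw [inputs_mirror, h2, e', map_mirror_mirror],
    by rw [start_mirror, h3, neg_neg]⟩

theorem exists_valid_two_iff (hg : Generic (L ++ P :: (M ++ Q :: R))) (hL : AllNeg L)
    (hM : AllNeg M) (hR : AllNeg R) (hP : 0 < P.n) (hQ : 0 < Q.n)
    (hn : 0 < (total (L ++ P :: (M ++ Q :: R))).n)
    (hy : y = (total (L ++ P :: (M ++ Q :: R))).pos) :
    (∃ δ : FeynmanDiagram, δ.Valid ∧ δ.inputs = L ++ P :: (M ++ Q :: R) ∧ δ.start = y) ↔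
      L.length + M.length + R.length = 0 ∨ RGood₂ L P M Q R ∨ LGood₂ L P M Q R := by
  constructor
  · rintro ⟨δ, h, e, hs⟩
    obtain ⟨M₁, M₂, A, B, rfl, rfl, hvA, hvB, eA, eB, hpA, hpB, hj⟩ :=
      h.cases_two hg e hL hR hn hy hs
    rcases hvA.good_of_two hvB eA eB hg hL (fun s hs => hM s (by simp [hs]))
      (fun s hs => hM s (by simp [hs])) hR hP hQ hn hy hpA hpB hj with ⟨h1, h2, h3⟩ | ⟨h1, -⟩ | ⟨h1, -⟩
    · left; simp [h1, h2, h3]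
    · exact .inr (.inl h1)
    · exact .inr (.inr h1)
  · rintro (h | h | h)
    · obtain rfl : L = [] := List.length_eq_zero_iff.mp (by omega)
      obtain rfl : M = [] := List.length_eq_zero_iff.mp (by omega)
      obtain rfl : R = [] := List.length_eq_zero_iff.mp (by omega)
      exact ⟨join y (ext P) (ext Q), ⟨trivial, trivial, propagates_pos_left_of_pos hP _,
        propagates_pos_left_of_pos hQ _, id⟩, rfl, rfl⟩
    · exact exists_of_rGood₂ hg hL hM hR hP hQ hn hy h
    · exact exists_of_lGood₂ hg hL hM hR hP hQ hn hy h

/-- The inputs determine the direction, the direction and `y` determine the splitting of `M`, and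
each half is unique by `eq_of_one`. -/
theorem Valid.eq_of_two {δ' : FeynmanDiagram} (h : δ.Valid) (h' : δ'.Valid)
    (hg : Generic (L ++ P :: (M ++ Q :: R))) (hL : AllNeg L)
    (hM : AllNeg M) (hR : AllNeg R) (hP : 0 < P.n) (hQ : 0 < Q.n)
    (hn : 0 < (total (L ++ P :: (M ++ Q :: R))).n)
    (hy : y = (total (L ++ P :: (M ++ Q :: R))).pos) (e : δ.inputs = L ++ P :: (M ++ Q :: R))
    (e' : δ'.inputs = L ++ P :: (M ++ Q :: R)) (hs : δ.start = y) (hs' : δ'.start = y) :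
    δ = δ' := by
  obtain ⟨M₁, M₂, A, B, rfl, rfl, hvA, hvB, eA, eB, hpA, hpB, hj⟩ :=
    h.cases_two hg e hL hR hn hy hs
  obtain ⟨N₁, N₂, A', B', hN, rfl, hvA', hvB', eA', eB', hpA', hpB', hj'⟩ :=
    h'.cases_two hg e' hL hR hn hy hs'
  have hm₁ : AllNeg M₁ := fun s hs => hM s (by simp [hs])
  have hm₂ : AllNeg M₂ := fun s hs => hM s (by simp [hs])
  have key : M₁ = N₁ ∧ M₂ = N₂ := by
    have h1 := hvA.good_of_two hvB eA eB hg hL hm₁ hm₂ hR hP hQ hn hy hpA hpB hj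
    have h2 := hvA'.good_of_two hvB' eA' eB' (hN ▸ hg) hL (fun s hs => hM s (by simp [hN, hs]))
      (fun s hs => hM s (by simp [hN, hs])) hR hP hQ (hN ▸ hn) (hN ▸ hy) hpA' hpB' hj'
    rw [← hN] at h2
    have contra : RGood₂ L P (M₁ ++ M₂) Q R → LGood₂ L P (M₁ ++ M₂) Q R → False := fun h3 h4 => by
      have := h3.2.2.2.1 P (by simp)
      have := h4.2.2.2.1 P (by simp)
      linarith
    have triv : M₁ ++ M₂ = [] → M₁ = N₁ ∧ M₂ = N₂ := fun h3 => by
      have h4 := h3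
      rw [hN] at h4
      rw [List.append_eq_nil_iff] at h3 h4
      rw [h3.1, h3.2, h4.1, h4.2]
      exact ⟨rfl, rfl⟩
    rcases h1 with ⟨-, h1, -⟩ | ⟨h1, h3, h4⟩ | ⟨h1, h3, h4⟩
    · exact triv h1
    · rcases h2 with ⟨-, h2, -⟩ | ⟨h2, h5, h6⟩ | ⟨h2, h5, h6⟩
      · exact triv h2
      · exact append_split_unique (p := fun s => s.pos ≤ y) hN h3 (by simpa using h4) h5
          (by simpa using h6)
      · exact (contra h1 h2).elim
    · rcases h2 with ⟨-, h2, -⟩ | ⟨h2, h5, h6⟩ | ⟨h2, h5, h6⟩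
      · exact triv h2
      · exact (contra h2 h1).elim
      · exact append_split_unique (p := fun s => y ≤ s.pos) hN h3 (by simpa using h4) h5
          (by simpa using h6)
  obtain ⟨rfl, rfl⟩ := key
  have e : L ++ P :: (M₁ ++ M₂ ++ Q :: R) = (L ++ P :: M₁) ++ (M₂ ++ Q :: R) := by simp
  rw [e] at hg
  rw [hvA.eq_of_one hvA' hg.left eA eA' hL hm₁ hP, hvB.eq_of_one hvB' hg.right eB eB' hm₂ hR hQ]

end FeynmanDiagram

end

noncomputable section

open StringState LineModel FeynmanDiagram

/-! ### The zero-dimensional diagrams -/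

/-- The number of leading states with `n < 0`. -/
def leadingNeg (l : List StringState) : ℕ := (l.takeWhile fun s => s.n < 0).length

/-- The number of trailing states with `n < 0`. -/
def trailingNeg (l : List StringState) : ℕ := leadingNeg l.reverse

/-- The first state with `n > 0` moves to the right. -/
def MovesRight (l : List StringState) : Prop :=
  ∃ P R, (l.dropWhile fun s => s.n < 0) = P :: R ∧ ∃ s ∈ l, P.pos < s.pos

open Classical in
/-- The sign of the zero-dimensional diagram with the inputs `l`. -/
def signExponent (l : List StringState) : ℕ :=
  if MovesRight l then
    -- When there are two states with `n > 0`, the last expression is congruent modulo 2 to the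
    -- number of states between them.
    if numPos l = 1 then trailingNeg l + 1 else l.length + leadingNeg l + trailingNeg l
  else if numPos l = 1 then leadingNeg l else leadingNeg l + trailingNeg l

open Classical in
/-- The signed number of zero-dimensional diagrams with the inputs `l`. -/
def signedCount (l : List StringState) : ℤ :=
  if (FeynmanOfDim 0 l).Nonempty then (-1) ^ signExponent l else 0

section

variable {L M R : List StringState} {P Q : StringState}

theorem takeWhile_neg (hL : AllNeg L) (hP : 0 < P.n) :
    ((L ++ P :: R).takeWhile fun s => s.n < 0) = L := by
  rw [List.takeWhile_append_of_pos (by simpa [AllNeg] using hL), List.takeWhile_cons_of_neg (by simp; omega),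
    List.append_nil]

theorem dropWhile_neg (hL : AllNeg L) (hP : 0 < P.n) :
    ((L ++ P :: R).dropWhile fun s => s.n < 0) = P :: R := by
  rw [List.dropWhile_append_of_pos (by simpa [AllNeg] using hL), List.dropWhile_cons_of_neg (by simp; omega)]

theorem leadingNeg_eq (hL : AllNeg L) (hP : 0 < P.n) : leadingNeg (L ++ P :: R) = L.length := by
  rw [leadingNeg, takeWhile_neg hL hP]

theorem trailingNeg_eq (hR : AllNeg R) (hP : 0 < P.n) : trailingNeg (L ++ P :: R) = R.length := by
  rw [trailingNeg, List.reverse_append, List.reverse_cons, List.append_assoc,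
    List.singleton_append, leadingNeg_eq (fun s hs => hR s (by simpa using hs)) hP,
    List.length_reverse]

theorem movesRight_iff (hL : AllNeg L) (hP : 0 < P.n) :
    MovesRight (L ++ P :: R) ↔ ∃ s ∈ L ++ P :: R, P.pos < s.pos := by
  rw [MovesRight, dropWhile_neg hL hP]
  constructor
  · rintro ⟨P', R', h, h'⟩
    obtain ⟨rfl, rfl⟩ := List.cons_eq_cons.mp h
    exact h'
  · exact fun h => ⟨P, R, rfl, h⟩

theorem RGood.movesRight (h : RGood L P R) (hL : AllNeg L) (hP : 0 < P.n) (hLR : L ≠ [] ∨ R ≠ []) :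
    MovesRight (L ++ P :: R) := by
  rw [movesRight_iff hL hP]
  match L, R, hLR with
  | t :: L, _, _ => exact ⟨t, by simp, h.1.lt_of_mem (by simp)⟩
  | [], t :: R, _ => exact ⟨t, by simp, h.2.1.lt_of_mem_tail (by simp)⟩
  | [], [], h => simp at h

theorem LGood.not_movesRight (h : LGood L P R) (hL : AllNeg L) (hP : 0 < P.n) :
    ¬ MovesRight (L ++ P :: R) := by
  rw [movesRight_iff hL hP]
  rintro ⟨s, hs, hs'⟩
  have : s ∈ L ∨ s = P ∨ s ∈ R := by simpa using hs
  rcases this with hs | rfl | hs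
  · exact hs'.asymm (h.1.lt_of_mem hs)
  · exact lt_irrefl _ hs'
  · exact hs'.asymm (h.2.1.lt_of_mem_tail hs)

theorem RGood₂.movesRight (h : RGood₂ L P M Q R) (hL : AllNeg L) (hP : 0 < P.n) :
    MovesRight (L ++ P :: (M ++ Q :: R)) := by
  rw [movesRight_iff hL hP]
  exact ⟨Q, by simp, (inc_append_iff.mp h.2.1).2.2 P (by simp) Q (by simp)⟩

theorem LGood₂.not_movesRight (h : LGood₂ L P M Q R) (hL : AllNeg L) (hP : 0 < P.n) :
    ¬ MovesRight (L ++ P :: (M ++ Q :: R)) := by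
  rw [movesRight_iff hL hP]
  rintro ⟨s, hs, hs'⟩
  have : s ∈ L ∨ s = P ∨ s ∈ M ++ [Q] ∨ s ∈ Q :: R := by simp at hs ⊢; tauto
  rcases this with hs | rfl | hs | hs
  · exact hs'.asymm (h.1.lt_of_mem hs)
  · exact lt_irrefl _ hs'
  · exact hs'.asymm ((List.pairwise_cons.mp h.2.1).1 s hs)
  · exact hs'.asymm ((h.2.2.2.2 s hs).trans (h.2.2.2.1 P (by simp)))

end

theorem Generic.cases_numPos {l : List StringState} (hg : Generic l) (h : numPos l = 1) :
    ∃ L P R, l = L ++ P :: R ∧ AllNeg L ∧ 0 < P.n ∧ AllNeg R := by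
  obtain ⟨L, P, R, rfl, hL, hP, hR⟩ := exists_of_numPos_eq_one h
  have := hg.mem_n_ne (s := P) (by simp)
  exact ⟨L, P, R, rfl, hL, by omega, hR⟩

theorem Generic.cases_numPos_two {l : List StringState} (hg : Generic l) (h : numPos l = 2) :
    ∃ L P M Q R, l = L ++ P :: (M ++ Q :: R) ∧ AllNeg L ∧ 0 < P.n ∧ AllNeg M ∧ 0 < Q.n ∧
      AllNeg R := by
  obtain ⟨L, P, M, Q, R, rfl, hL, hP, hM, hQ, hR⟩ := exists_of_numPos_eq_two h
  have h1 := hg.mem_n_ne (s := P) (by simp)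
  have h2 := hg.mem_n_ne (s := Q) (by simp)
  exact ⟨L, P, M, Q, R, rfl, hL, by omega, hM, by omega, hR⟩

/-- The dimension depends only on `numPos` and the sign of the outgoing `n`. An outgoing state with
`n < 0` reaches its point from anywhere, one with `n > 0` only if it is already there. -/
theorem mem_feynmanOfDim_zero_iff {l : List StringState} (hg : Generic l) {δ : FeynmanDiagram} :
    δ ∈ FeynmanOfDim 0 l ↔
      (numPos l = 1 ∧ (total l).n < 0 ∧ δ.Valid ∧ δ.inputs = l) ∨
      (numPos l = 2 ∧ 0 < (total l).n ∧ δ.Valid ∧ δ.inputs = l ∧ δ.start = (total l).pos) := by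
  constructor
  · rintro ⟨⟨rfl, h1, h2⟩, h3⟩
    rw [dim_eq] at h3
    rw [state_eq] at h2
    rcases lt_or_gt_of_ne (hg.n_ne δ.inputs_ne_nil) with hn | hn
    · rw [if_neg (by omega)] at h3
      exact .inl ⟨by omega, hn, h1, rfl⟩
    · rw [if_pos hn] at h3
      rw [propagates_pos_right_of_pos hn] at h2
      exact .inr ⟨by omega, hn, h1, rfl, h2⟩
  · rintro (⟨h1, h2, h3, rfl⟩ | ⟨h1, h2, h3, rfl, h4⟩)
    · refine ⟨⟨rfl, h3, ?_⟩, ?_⟩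
      · rw [state_eq]
        exact propagates_pos_right_of_neg h2 _
      · rw [dim_eq, h1, if_neg (by omega)]
        rfl
    · refine ⟨⟨rfl, h3, ?_⟩, ?_⟩
      · rw [h4]
        exact propagates_refl _ _
      · rw [dim_eq, h1, if_pos h2]
        rfl

theorem feynmanOfDim_zero_subsingleton {l : List StringState} (hg : Generic l) :
    (FeynmanOfDim 0 l).Subsingleton := by
  intro δ hδ δ' hδ'
  rw [mem_feynmanOfDim_zero_iff hg] at hδ hδ'
  rcases hδ with ⟨h1, h2, h3, h4⟩ | ⟨h1, h2, h3, h4, h5⟩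
  · rcases hδ' with ⟨-, -, h3', h4'⟩ | ⟨h1', -⟩
    · obtain ⟨L, P, R, rfl, hL, hP, hR⟩ := hg.cases_numPos h1
      exact h3.eq_of_one h3' hg h4 h4' hL hR hP
    · omega
  · rcases hδ' with ⟨h1', -⟩ | ⟨-, -, h3', h4', h5'⟩
    · omega
    · obtain ⟨L, P, M, Q, R, rfl, hL, hP, hM, hQ, hR⟩ := hg.cases_numPos_two h1
      exact h3.eq_of_two h3' hg hL hM hR hP hQ h2 rfl h4 h4' h5 h5'

/-- The bridge from geometry to algebra: the criterion for a diagram to exist and the closed form of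
the coefficient coincide case by case, the chosen sign being the value of the coefficient. -/
theorem signedCount_eq_coef {r : StringState → ℕ} {N : ℕ} (hr : ∀ s, r s < N)
    {l : List StringState} (hg : Generic l) (hc : Compat r l) :
    signedCount l = coef r N hr l := by
  classical
  by_cases h1 : numPos l = 1 ∧ (total l).n < 0
  · obtain ⟨h1, hn⟩ := h1
    have hne : (FeynmanOfDim 0 l).Nonempty ↔ ∃ δ : FeynmanDiagram, δ.Valid ∧ δ.inputs = l :=
      exists_congr fun δ => by rw [mem_feynmanOfDim_zero_iff hg]; simp [h1, hn]
    rw [signedCount]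
    simp only [hne]
    obtain ⟨L, P, R, rfl, hL, hP, hR⟩ := hg.cases_numPos h1
    rw [coef_one r N hr hg hc hL hR hP hn, exists_valid_one_iff hg hL hR hP hn]
    rw [signExponent, if_pos h1, if_pos h1, leadingNeg_eq hL hP, trailingNeg_eq hR hP]
    by_cases h0 : L.length + R.length = 1
    · rw [if_pos (.inl h0), if_pos h0]
      -- For two inputs the exponents for either direction have the same parity, so the direction,
      -- which is undefined at a tie, does not matter.
      rcases Nat.add_eq_one_iff.mp h0 with ⟨h2, h3⟩ | ⟨h2, h3⟩ <;> rw [h2, h3] <;> split_ifs <;> rfl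
    · rw [if_neg h0]
      have hLR : L ≠ [] ∨ R ≠ [] := by
        by_contra h
        push Not at h
        obtain ⟨rfl, rfl⟩ := h
        simp at hn
        omega
      by_cases hr : RGood L P R
      · rw [if_pos (.inr (.inl hr)), if_pos hr, if_pos (hr.movesRight hL hP hLR), pow_succ]
        ring
      · rw [if_neg hr]
        by_cases hl : LGood L P R
        · rw [if_pos (.inr (.inr hl)), if_pos hl, if_neg (hl.not_movesRight hL hP)]
        · rw [if_neg (by tauto), if_neg hl]
  by_cases h2 : numPos l = 2 ∧ ¬ (total l).n < 0
  · obtain ⟨h2, hn⟩ := h2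
    have hl : l ≠ [] := by rintro rfl; simp at h2
    replace hn := hg.n_pos_of hl hn
    have hne : (FeynmanOfDim 0 l).Nonempty ↔ ∃ δ : FeynmanDiagram, δ.Valid ∧ δ.inputs = l ∧
        δ.start = (total l).pos :=
      exists_congr fun δ => by rw [mem_feynmanOfDim_zero_iff hg]; simp [h2, hn]
    rw [signedCount]
    simp only [hne]
    obtain ⟨L, P, M, Q, R, rfl, hL, hP, hM, hQ, hR⟩ := hg.cases_numPos_two h2
    have e : L ++ P :: (M ++ Q :: R) = (L ++ P :: M) ++ Q :: R := by simp
    have ht : trailingNeg (L ++ P :: (M ++ Q :: R)) = R.length := by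
      rw [e, trailingNeg_eq hR hQ]
    rw [coef_two r N hr hg hc hL hM hR hP hQ hn, exists_valid_two_iff hg hL hM hR hP hQ hn rfl]
    rw [signExponent, if_neg (c := numPos _ = 1) (by omega), if_neg (c := numPos _ = 1) (by omega),
      leadingNeg_eq hL hP, ht]
    have hlen : (L ++ P :: (M ++ Q :: R)).length + L.length + R.length =
        2 * (L.length + R.length + 1) + M.length := by
      simp; ring
    rw [hlen]
    by_cases h0 : L.length + M.length + R.length = 0
    · rw [if_pos (.inl h0), if_pos h0, show L.length + R.length = 0 by omega,
        show M.length = 0 by omega]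
      split_ifs <;> rfl
    · rw [if_neg h0]
      by_cases hr : RGood₂ L P M Q R
      · rw [if_pos (.inr (.inl hr)), if_pos hr, if_pos (hr.movesRight hL hP), pow_add, pow_mul]
        simp
      · rw [if_neg hr]
        by_cases hl : LGood₂ L P M Q R
        · rw [if_pos (.inr (.inr hl)), if_pos hl, if_neg (hl.not_movesRight hL hP)]
        · rw [if_neg (by tauto), if_neg hl]
  · rw [coef_eq_zero r N hr h1 h2, signedCount, if_neg]
    rintro ⟨δ, hδ⟩
    rw [mem_feynmanOfDim_zero_iff hg] at hδ
    rcases hδ with ⟨h, h', -⟩ | ⟨h, h', -⟩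
    · exact h1 ⟨h, h'⟩
    · exact h2 ⟨h, by omega⟩

/-! ### The relation for one lift -/

/-- `r s` counts the points of the finite set `S` to the left of `s`. Since `S` contains the points
of all blocks, the count is strictly monotone on these. -/
theorem exists_compat (l : List StringState) :
    ∃ (r : StringState → ℕ) (N : ℕ), (∀ s, r s < N) ∧ Compat r l := by
  classical
  let S : Finset ℝ := (l.sublists.map fun b => (total b).pos).toFinset
  refine ⟨fun s => (S.filter (· < s.pos)).card, S.card + 1,
    fun s => Nat.lt_succ_of_le (Finset.card_filter_le _ _), fun b c hb hc _ _ => ?_⟩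
  have hbS : (total b).pos ∈ S := by
    rw [List.mem_toFinset]
    exact List.mem_map.mpr ⟨b, List.mem_sublists.mpr hb.sublist, rfl⟩
  constructor
  · intro h
    by_contra h'
    push Not at h'
    exact h.not_ge (Finset.card_le_card fun x hx => by
      simp only [Finset.mem_filter] at hx ⊢
      exact ⟨hx.1, hx.2.trans_le h'⟩)
  · intro h
    refine Finset.card_lt_card ⟨fun x hx => ?_, fun h' => ?_⟩
    · simp only [Finset.mem_filter] at hx ⊢
      exact ⟨hx.1, hx.2.trans h⟩
    · have := h' (Finset.mem_filter.mpr ⟨hbS, h⟩)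
      simp at this

theorem total_map_total (B : List (List StringState)) : total (B.map total) = total B.flatten := by
  induction B with
  | nil => rfl
  | cons b B ih =>
    rw [List.map_cons, List.flatten_cons, ← List.singleton_append, total_append, total_append, ih,
      total_single]

theorem flatten_ne_nil_of_forall {B : List (List StringState)} (hB : ∀ b ∈ B, b ≠ [])
    (h : B ≠ []) : B.flatten ≠ [] := by
  match B, h with
  | b :: B, _ => simp [hB b (by simp)]

/-- A block of blocks flattens to a block of the original list with the same total, so every
condition on the contracted list is one on the original. -/
theorem Generic.map_total {B : List (List StringState)} (hg : Generic B.flatten)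
    (hB : ∀ b ∈ B, b ≠ []) : Generic (B.map total) := by
  constructor
  · intro a b c h hb
    obtain ⟨X, Z, rfl, h1, rfl⟩ := List.map_eq_append_iff.mp h
    obtain ⟨X, Y, rfl, rfl, rfl⟩ := List.map_eq_append_iff.mp h1
    rw [total_map_total]
    exact hg.distinct X.flatten Y.flatten Z.flatten (by simp)
      (flatten_ne_nil_of_forall (fun b hb => hB b (by simp [hb])) (by simpa using hb))
  · intro a b c e h hb hc
    obtain ⟨X, V, rfl, h1, rfl⟩ := List.map_eq_append_iff.mp h
    obtain ⟨X, Z, rfl, h2, rfl⟩ := List.map_eq_append_iff.mp h1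
    obtain ⟨X, Y, rfl, rfl, rfl⟩ := List.map_eq_append_iff.mp h2
    rw [← List.map_append, total_map_total, total_map_total, total_map_total, List.flatten_append]
    exact hg.pos_ne X.flatten Y.flatten Z.flatten V.flatten (by simp)
      (flatten_ne_nil_of_forall (fun b hb => hB b (by simp [hb])) (by simpa using hb))
      (flatten_ne_nil_of_forall (fun b hb => hB b (by simp [hb])) (by simpa using hc))

theorem Compat.map_total {r : StringState → ℕ} {B : List (List StringState)}
    (hc : Compat r B.flatten) (hB : ∀ b ∈ B, b ≠ []) : Compat r (B.map total) := by
  have key : ∀ b, b <:+: B.map total → b ≠ [] →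
      ∃ b' : List StringState, b' <:+: B.flatten ∧ b' ≠ [] ∧ total b = total b' := by
    rintro b ⟨a, c, h⟩ hb
    obtain ⟨X, Z, rfl, h1, rfl⟩ := List.map_eq_append_iff.mp h.symm
    obtain ⟨X, Y, rfl, rfl, rfl⟩ := List.map_eq_append_iff.mp h1
    exact ⟨Y.flatten, ⟨X.flatten, Z.flatten, by simp⟩,
      flatten_ne_nil_of_forall (fun b hb => hB b (by simp [hb])) (by simpa using hb),
      total_map_total Y⟩
  intro b c hb hc' hb0 hc0
  obtain ⟨b', h1, h2, h3⟩ := key b hb hb0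
  obtain ⟨c', h4, h5, h6⟩ := key c hc' hc0
  rw [h3, h6]
  exact hc b' c' h1 h4 h2 h5

/-- The blocks of `a ++ b ++ c` with `b` as one block. -/
def blocks (a b c : List StringState) : List (List StringState) :=
  a.map (fun s => [s]) ++ b :: c.map (fun s => [s])

theorem flatten_blocks (a b c : List StringState) : (blocks a b c).flatten = a ++ b ++ c := by
  have h : ∀ a : List StringState, (a.map fun s => [s]).flatten = a := fun a => by
    induction a with
    | nil => rfl
    | cons s a ih => simp [ih]
  simp [blocks, h]

theorem map_total_blocks (a b c : List StringState) :
    (blocks a b c).map total = a ++ total b :: c := by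
  simp [blocks, Function.comp_def]

theorem ne_nil_of_mem_blocks {a b c : List StringState} (hb : b ≠ []) : ∀ x ∈ blocks a b c, x ≠ [] := by
  intro x hx
  simp only [blocks, List.mem_append, List.mem_map, List.mem_cons] at hx
  rcases hx with ⟨s, -, rfl⟩ | rfl | ⟨s, -, rfl⟩ <;> simp [hb]

theorem Generic.subst {a b c : List StringState} (hg : Generic (a ++ b ++ c)) (hb : b ≠ []) :
    Generic (a ++ total b :: c) := by
  rw [← map_total_blocks]
  exact Generic.map_total (by rwa [flatten_blocks]) (ne_nil_of_mem_blocks hb)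

theorem Compat.subst {r : StringState → ℕ} {a b c : List StringState}
    (hg : Compat r (a ++ b ++ c)) (hb : b ≠ []) : Compat r (a ++ total b :: c) := by
  rw [← map_total_blocks]
  exact Compat.map_total (by rwa [flatten_blocks]) (ne_nil_of_mem_blocks hb)

/-- The sign of the states to the left of the inner operation. -/
def passSign (a : List StringState) : ℤ := (a.map fun s => if s.n < 0 then (1 : ℤ) else -1).prod

theorem signedCount_nil : signedCount [] = 0 := by
  rw [signedCount, if_neg]
  rintro ⟨δ, ⟨h, -⟩, -⟩
  exact δ.inputs_ne_nil h

/-- The quadratic relation for the numbers of diagrams of one lift. -/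
theorem signedCount_relation {l : List StringState} (hg : Generic l) (hl : l ≠ []) :
    splitSum (fun a t => splitSum (fun b c =>
      passSign a * signedCount b * signedCount (a ++ total b :: c)) t) l = 0 := by
  obtain ⟨r, N, hr, hc⟩ := exists_compat l
  have := (lineData r N hr).substSum_coeff l hl
  rw [← this, HomotopyData.substSum]
  refine splitSum_congr fun a t ht => splitSum_congr fun b c hb => ?_
  subst hb
  subst ht
  rcases eq_or_ne b [] with rfl | hb
  · rw [signedCount_nil, HomotopyData.coeff_nil]
    simp
  · rw [← List.append_assoc] at hg hc
    have h1 := signedCount_eq_coef hr (hg.sub (b := b) ⟨a, c, rfl⟩) (hc.sub ⟨a, c, rfl⟩)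
    have h2 := signedCount_eq_coef hr (hg.subst hb) (hc.subst hb)
    rw [h1, h2]
    rfl

end

noncomputable section

open StringState LineModel FeynmanDiagram

/-! ### Translations of the configuration space -/

namespace StringState

/-- The translate of a state by an integer. -/
def shift (k : ℤ) (s : StringState) : StringState := ⟨s.n, s.m - s.n * k⟩

@[simp] theorem shift_n (k : ℤ) (s : StringState) : (s.shift k).n = s.n := rfl

theorem shift_m (k : ℤ) (s : StringState) : (s.shift k).m = s.m - s.n * k := rfl

@[simp] theorem shift_zero (s : StringState) : s.shift 0 = s := by simp [shift]

theorem shift_shift (j k : ℤ) (s : StringState) : (s.shift k).shift j = s.shift (k + j) := by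
  ext
  · rfl
  · simp [shift]; ring

theorem shift_pos (k : ℤ) {s : StringState} (h : s.n ≠ 0) : (s.shift k).pos = s.pos - k := by
  have : (s.n : ℝ) ≠ 0 := by exact_mod_cast h
  simp only [shift, pos]
  push_cast
  field_simp

theorem shift_vel (k : ℤ) (s : StringState) (y : ℝ) : (s.shift k).vel (y - k) = s.vel y := by
  simp only [shift, vel]
  push_cast
  ring

theorem total_map_shift (k : ℤ) (l : List StringState) :
    total (l.map (shift k)) = (total l).shift k := by
  induction l with
  | nil => simp [total, shift]
  | cons s l ih =>
    rw [List.map_cons, ← List.singleton_append, total_append, ih, ← List.singleton_append (l := l),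
      total_append, total_single, total_single]
    ext
    · rfl
    · simp [fuse, shift]
      ring

theorem Propagates.shift {s : StringState} {a b : ℝ} (k : ℤ) (h : s.Propagates a b) :
    (s.shift k).Propagates (a - k) (b - k) := by
  rw [propagates_iff, shift_vel, shift_vel]
  simpa using propagates_iff.mp h

theorem map_shift_shift (j k : ℤ) (l : List StringState) :
    (l.map (shift k)).map (shift j) = l.map (shift (k + j)) := by
  rw [List.map_map]
  exact List.map_congr_left fun s _ => shift_shift j k s

theorem map_shift_zero (l : List StringState) : l.map (shift 0) = l := by
  conv_rhs => rw [← List.map_id l]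
  exact List.map_congr_left fun s _ => shift_zero s

end StringState

namespace FeynmanDiagram

/-- The translate of a diagram by an integer. -/
def shift (k : ℤ) : FeynmanDiagram → FeynmanDiagram
  | ext s => ext (s.shift k)
  | join y A B => join (y - k) (A.shift k) (B.shift k)

theorem inputs_shift (k : ℤ) (δ : FeynmanDiagram) :
    (δ.shift k).inputs = δ.inputs.map (StringState.shift k) := by
  induction δ with
  | ext s => rfl
  | join y A B hA hB => simp [shift, inputs, hA, hB]

theorem state_shift (k : ℤ) (δ : FeynmanDiagram) : (δ.shift k).state = δ.state.shift k := by
  rw [state_eq, state_eq, inputs_shift, total_map_shift]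

theorem start_shift (k : ℤ) {δ : FeynmanDiagram} (h : ∀ s ∈ δ.inputs, s.n ≠ 0) :
    (δ.shift k).start = δ.start - k := by
  cases δ with
  | ext s => exact StringState.shift_pos k (h s (by simp [inputs]))
  | join y A B => rfl

theorem Valid.shift (k : ℤ) {δ : FeynmanDiagram} (hv : δ.Valid) (h : ∀ s ∈ δ.inputs, s.n ≠ 0) :
    (δ.shift k).Valid := by
  induction δ with
  | ext s => trivial
  | join y A B hA hB =>
    have h1 : ∀ s ∈ A.inputs, s.n ≠ 0 := fun s hs => h s (by simp [inputs, hs])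
    have h2 : ∀ s ∈ B.inputs, s.n ≠ 0 := fun s hs => h s (by simp [inputs, hs])
    refine ⟨hA hv.1 h1, hB hv.2.1 h2, ?_, ?_, fun hj => hv.2.2.2.2 ?_⟩
    · rw [state_shift, start_shift k h1]
      exact hv.2.2.1.shift k
    · rw [state_shift, start_shift k h2]
      exact hv.2.2.2.1.shift k
    · cases B with
      | ext s => exact hj.elim
      | join y' C D => exact sub_left_injective hj

end FeynmanDiagram

theorem numPos_map_shift (k : ℤ) (l : List StringState) :
    numPos (l.map (StringState.shift k)) = numPos l := by
  simp only [numPos, List.countP_map, Function.comp_def, shift_n]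
  rfl

theorem leadingNeg_map_shift (k : ℤ) (l : List StringState) :
    leadingNeg (l.map (StringState.shift k)) = leadingNeg l := by
  simp only [leadingNeg, List.takeWhile_map, Function.comp_def, shift_n, List.length_map]
  rfl

theorem FeynmanOfDim.nonempty_shift (k : ℤ) {l : List StringState} (h : ∀ s ∈ l, s.n ≠ 0)
    (hl : (total l).n ≠ 0) (hne : (FeynmanOfDim 0 l).Nonempty) :
    (FeynmanOfDim 0 (l.map (StringState.shift k))).Nonempty := by
  obtain ⟨δ, ⟨rfl, hv, hp⟩, hd⟩ := hne
  refine ⟨δ.shift k, ⟨inputs_shift k δ, hv.shift k h, ?_⟩, ?_⟩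
  · rw [start_shift k h, state_shift, total_map_shift, StringState.shift_pos k hl]
    exact hp.shift k
  · rw [dim_eq] at hd ⊢
    rw [inputs_shift, numPos_map_shift, total_map_shift]
    exact hd

theorem MovesRight.shift (k : ℤ) {l : List StringState} (h : ∀ s ∈ l, s.n ≠ 0)
    (hm : MovesRight l) : MovesRight (l.map (StringState.shift k)) := by
  obtain ⟨P, R, hP, s, hs, hlt⟩ := hm
  refine ⟨P.shift k, R.map (StringState.shift k), ?_, s.shift k, List.mem_map_of_mem hs, ?_⟩
  · rw [List.dropWhile_map]
    exact congrArg _ hP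
  · have hPl : P ∈ l := (List.dropWhile_sublist _).subset (by rw [hP]; simp)
    rw [StringState.shift_pos k (h P hPl), StringState.shift_pos k (h s hs)]
    linarith

theorem signedCount_map_shift (k : ℤ) {l : List StringState} (hl : ∀ s ∈ l, s.n ≠ 0)
    (hl' : (total l).n ≠ 0) : signedCount (l.map (StringState.shift k)) = signedCount l := by
  have h0 : ∀ s ∈ l.map (StringState.shift k), s.n ≠ 0 := by
    simpa using hl
  have h1 : (FeynmanOfDim 0 (l.map (StringState.shift k))).Nonempty ↔
      (FeynmanOfDim 0 l).Nonempty := by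
    refine ⟨fun h => ?_, FeynmanOfDim.nonempty_shift k hl hl'⟩
    have := FeynmanOfDim.nonempty_shift (-k) h0 (by rwa [total_map_shift]) h
    rwa [map_shift_shift, add_neg_cancel, map_shift_zero] at this
  have h2 : MovesRight (l.map (StringState.shift k)) ↔ MovesRight l := by
    refine ⟨fun h => ?_, MovesRight.shift k hl⟩
    have := MovesRight.shift (-k) h0 h
    rwa [map_shift_shift, add_neg_cancel, map_shift_zero] at this
  have h3 : signExponent (l.map (StringState.shift k)) = signExponent l := by
    rw [signExponent, signExponent, propext h2, numPos_map_shift, leadingNeg_map_shift, trailingNeg,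
      ← List.map_reverse, leadingNeg_map_shift, List.length_map, trailingNeg]
  rw [signedCount, signedCount, propext h1, h3]

/-! ### The weight of a sequence of states -/

/-- The area `∑ mᵢ² / nᵢ - (∑ mᵢ)² / ∑ nᵢ` swept by a diagram with the inputs `l`. -/
def area (l : List StringState) : ℝ :=
  (l.map fun s => (s.m : ℝ) ^ 2 / s.n).sum - ((total l).m : ℝ) ^ 2 / (total l).n

/-- The correlation function of the diagrams with the inputs `l`. -/
def weight (τ : ℂ) (l : List StringState) : ℂ :=
  Complex.exp (Real.pi * Complex.I * τ * (area l : ℂ))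

/-- The increment is exactly the exponent in the product rule of `corr`. -/
theorem area_append {a b : List StringState} (ha : (total a).n ≠ 0) (hb : (total b).n ≠ 0)
    (hab : (total a).n + (total b).n ≠ 0) : area (a ++ b) = area a + area b +
      (((total b).n : ℝ) * (total a).m - ((total a).n : ℝ) * (total b).m) ^ 2 /
        (((total a).n : ℝ) * (total b).n * ((total a).n + (total b).n)) := by
  have h1 : ((total a).n : ℝ) ≠ 0 := by exact_mod_cast ha
  have h2 : ((total b).n : ℝ) ≠ 0 := by exact_mod_cast hb
  have h3 : ((total a).n : ℝ) + (total b).n ≠ 0 := by exact_mod_cast hab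
  rw [area, area, area, total_append, List.map_append, List.sum_append]
  simp only [fuse]
  push_cast
  field_simp
  ring

/-- The term `m² / n` of the contracted block enters once with each sign and cancels. -/
theorem area_subst (a b c : List StringState) :
    area (a ++ b ++ c) = area b + area (a ++ total b :: c) := by
  have : total (a ++ total b :: c) = total (a ++ b ++ c) := by
    rw [total_append, total_append, total_append, ← List.singleton_append, total_append,
      total_single]
    ext <;> simp [fuse] <;> ring
  rw [area, area, area, this]
  simp only [List.map_append, List.map_cons, List.sum_append, List.sum_cons]
  ring

theorem weight_subst (τ : ℂ) (a b c : List StringState) :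
    weight τ (a ++ b ++ c) = weight τ b * weight τ (a ++ total b :: c) := by
  rw [weight, weight, weight, ← Complex.exp_add, area_subst]
  push_cast
  ring_nf

theorem area_map_shift (k : ℤ) {l : List StringState} (hl : ∀ s ∈ l, s.n ≠ 0)
    (hl' : (total l).n ≠ 0) : area (l.map (StringState.shift k)) = area l := by
  have h1 : ((l.map (StringState.shift k)).map fun s => (s.m : ℝ) ^ 2 / s.n).sum =
      (l.map fun s => (s.m : ℝ) ^ 2 / s.n).sum - 2 * (k : ℝ) * (total l).m +
        (k : ℝ) ^ 2 * (total l).n := by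
    clear hl'
    induction l with
    | nil => simp [total]
    | cons s l ih =>
      have hs : (s.n : ℝ) ≠ 0 := by exact_mod_cast hl s (by simp)
      rw [List.map_cons, List.map_cons, List.sum_cons, ih fun t ht => hl t (by simp [ht]),
        List.map_cons, List.sum_cons, ← List.singleton_append, total_append, total_single]
      simp only [fuse, StringState.shift]
      push_cast
      field_simp
      ring
  have h2 : ((total l).n : ℝ) ≠ 0 := by exact_mod_cast hl'
  rw [area, area, h1, total_map_shift, shift_n, shift_m]
  push_cast
  field_simp
  ring

theorem weight_map_shift (τ : ℂ) (k : ℤ) {l : List StringState} (hl : ∀ s ∈ l, s.n ≠ 0)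
    (hl' : (total l).n ≠ 0) : weight τ (l.map (StringState.shift k)) = weight τ l := by
  rw [weight, weight, area_map_shift k hl hl']

theorem norm_weight (τ : ℂ) (l : List StringState) :
    ‖weight τ l‖ = Real.exp (-(Real.pi * τ.im * area l)) := by
  rw [weight, Complex.norm_exp]
  congr 1
  simp [Complex.mul_re, Complex.mul_im]

/-- The exponents at the interactions telescope to the area, so the correlation function does not
depend on the shape of the diagram. -/
theorem FeynmanDiagram.corr_eq (τ : ℂ) {δ : FeynmanDiagram} (h : DistinctDegrees δ.inputs) :
    δ.corr τ = weight τ δ.inputs := by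
  induction δ with
  | ext s =>
    simp [corr, weight, inputs, area]
  | join y A B hA hB =>
    rw [inputs] at h
    have hA' : DistinctDegrees A.inputs := fun a b c e =>
      h a b (c ++ B.inputs) (by rw [e]; simp)
    have hB' : DistinctDegrees B.inputs := fun a b c e =>
      h (A.inputs ++ a) b c (by rw [e]; simp)
    have h1 := h [] A.inputs B.inputs (by simp) A.inputs_ne_nil
    have h2 := h A.inputs B.inputs [] (by simp) B.inputs_ne_nil
    have h3 := h [] (A.inputs ++ B.inputs) [] (by simp) (by simp [A.inputs_ne_nil])
    rw [n_append] at h3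
    rw [corr, hA hA', hB hB', weight, weight, weight, inputs, area_append h1 h2 h3,
      ← Complex.exp_add, ← Complex.exp_add, state_eq, state_eq]
    push_cast
    ring_nf

/-! ### The energy of a diagram -/

/-- The energy `∑ nᵢ (y - pᵢ)²`. -/
def energy (l : List StringState) (y : ℝ) : ℝ :=
  (l.map fun s => (s.n : ℝ) * (y - s.pos) ^ 2).sum

theorem energy_append (a b : List StringState) (y : ℝ) :
    energy (a ++ b) y = energy a y + energy b y := by
  simp [energy]

theorem energy_sub {l : List StringState} (hl : ∀ s ∈ l, s.n ≠ 0) (x y : ℝ) :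
    energy l y - energy l x = (y - x) * ((total l).vel x + (total l).vel y) := by
  induction l with
  | nil => simp [energy, total, vel]
  | cons s l ih =>
    have h1 := ih fun t ht => hl t (by simp [ht])
    have hs := hl s (by simp)
    rw [vel_cons, vel_cons, ← List.singleton_append, energy_append, energy_append, vel_eq hs,
      vel_eq hs]
    have : ∀ z, energy [s] z = (s.n : ℝ) * (z - s.pos) ^ 2 := fun z => by simp [energy]
    rw [this, this]
    linear_combination h1

/-- The energy is a quadratic polynomial in `y` with derivative twice the total velocity. Its
critical point is the outgoing point, and the critical value is the area. -/
theorem energy_total {l : List StringState} (hl : ∀ s ∈ l, s.n ≠ 0) (hl' : (total l).n ≠ 0) :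
    energy l (total l).pos = area l := by
  have h0 : energy l 0 = (l.map fun s => (s.m : ℝ) ^ 2 / s.n).sum := by
    rw [energy]
    congr 1
    refine List.map_congr_left fun s hs => ?_
    have hs : (s.n : ℝ) ≠ 0 := by exact_mod_cast hl s hs
    rw [pos]
    field_simp
    ring
  have h1 := energy_sub hl 0 (total l).pos
  have h2 : ((total l).n : ℝ) ≠ 0 := by exact_mod_cast hl'
  rw [StringState.vel_pos hl', h0] at h1
  rw [area]
  have h3 : (total l).pos * (total l).vel 0 = -((total l).m : ℝ) ^ 2 / (total l).n := by
    rw [pos, vel]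
    field_simp
    ring
  linear_combination h1 + h3

/-- A propagation over the distance `d` needs at least the energy `d²`. -/
theorem energy_add_sq_le {l : List StringState} (hl : ∀ s ∈ l, s.n ≠ 0) (hl' : (total l).n ≠ 0)
    {x y : ℝ} (h : (total l).Propagates x y) : energy l x + (y - x) ^ 2 ≤ energy l y := by
  have h1 := energy_sub hl x y
  obtain ⟨h2, h3⟩ := propagates_iff.mp h
  have h4 : (total l).vel y - (total l).vel x = ((total l).n : ℝ) * (y - x) := by
    simp only [vel]; ring
  -- The end velocities differ by `n (y - x)`, and both have the direction of `y - x`. So one of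
  -- them is at least `|n| |y - x|` in absolute value, and `|n| ≥ 1`.
  rcases lt_or_gt_of_ne hl' with hn | hn
  · have : ((total l).n : ℝ) ≤ -1 := by exact_mod_cast (by omega : (total l).n ≤ -1)
    have h5 : (y - x) * (total l).vel x = (y - x) * (total l).vel y -
      ((total l).n : ℝ) * (y - x) ^ 2 := by linear_combination -(y - x) * h4
    nlinarith [sq_nonneg (y - x)]
  · have : (1 : ℝ) ≤ ((total l).n : ℝ) := by exact_mod_cast hn
    have h5 : (y - x) * (total l).vel y = (y - x) * (total l).vel x +
      ((total l).n : ℝ) * (y - x) ^ 2 := by linear_combination (y - x) * h4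
    nlinarith [sq_nonneg (y - x)]

/-- At a vertex the energies of the factors add, and each edge adds at least its squared length.
Cauchy–Schwarz along the path from an input to `y` bounds the distance. -/
theorem FeynmanDiagram.Valid.sq_le_energy {δ : FeynmanDiagram} (h : δ.Valid)
    (hd : DistinctDegrees δ.inputs) {y : ℝ} (hp : δ.state.Propagates δ.start y) :
    0 ≤ energy δ.inputs y ∧
      ∀ s ∈ δ.inputs, (y - s.pos) ^ 2 ≤ δ.inputs.length * energy δ.inputs y := by
  have hl : ∀ s ∈ δ.inputs, s.n ≠ 0 := fun s hs => by
    obtain ⟨u, v, e⟩ := List.append_of_mem hs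
    have := hd u [s] v (by simp [e]) (by simp)
    rwa [total_single] at this
  have hl' := hd [] δ.inputs [] (by simp) δ.inputs_ne_nil
  rw [state_eq] at hp
  have he := energy_add_sq_le hl hl' hp
  induction δ generalizing y with
  | ext s =>
    have h0 : energy [s] s.pos = 0 := by simp [energy]
    simp only [inputs, start] at he ⊢
    rw [h0] at he
    refine ⟨by nlinarith [sq_nonneg (y - s.pos)], ?_⟩
    simpa using he
  | join x A B hA hB =>
    obtain ⟨hvA, hvB, hpA, hpB, -⟩ := h
    rw [inputs] at hd hl hl'
    have hdA : DistinctDegrees A.inputs := fun a b c e => hd a b (c ++ B.inputs) (by rw [e]; simp)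
    have hdB : DistinctDegrees B.inputs := fun a b c e =>
      hd (A.inputs ++ a) b c (by rw [e]; simp)
    have hlA : ∀ s ∈ A.inputs, s.n ≠ 0 := fun s hs => hl s (by simp [hs])
    have hlB : ∀ s ∈ B.inputs, s.n ≠ 0 := fun s hs => hl s (by simp [hs])
    have hA' := hdA [] A.inputs [] (by simp) A.inputs_ne_nil
    have hB' := hdB [] B.inputs [] (by simp) B.inputs_ne_nil
    rw [state_eq] at hpA hpB
    obtain ⟨eA, sA⟩ := hA hvA hdA hpA hlA hA' (energy_add_sq_le hlA hA' hpA)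
    obtain ⟨eB, sB⟩ := hB hvB hdB hpB hlB hB' (energy_add_sq_le hlB hB' hpB)
    simp only [inputs, start] at he ⊢
    rw [energy_append, energy_append] at he
    rw [energy_append]
    have key : ∀ (k : ℝ) (e p : ℝ), 1 ≤ k → k + 1 ≤ ((A.inputs ++ B.inputs).length : ℝ) →
        e ≤ energy A.inputs x + energy B.inputs x → (x - p) ^ 2 ≤ k * e →
        (y - p) ^ 2 ≤ (A.inputs ++ B.inputs).length *
          (energy A.inputs y + energy B.inputs y) := by
      intro k e p hk hk' he' hp
      -- This is `(a + b)² ≤ (k + 1) (a² + b² / k)`, with `a = y - x`, `b = x - p` and `b² ≤ k e`.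
      have h1 : (y - p) ^ 2 ≤ (k + 1) * ((y - x) ^ 2 + e) := by
        have h2 : k * (y - p) ^ 2 ≤ k * ((k + 1) * ((y - x) ^ 2 + e)) := by
          nlinarith [sq_nonneg (k * (y - x) - (x - p))]
        exact le_of_mul_le_mul_left h2 (by linarith)
      refine h1.trans (mul_le_mul hk' (by linarith) ?_ (by linarith))
      nlinarith [sq_nonneg (y - x), sq_nonneg (x - p)]
    have lA : 1 ≤ A.inputs.length := List.length_pos_of_ne_nil A.inputs_ne_nil
    have lB : 1 ≤ B.inputs.length := List.length_pos_of_ne_nil B.inputs_ne_nil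
    refine ⟨by nlinarith [sq_nonneg (y - x)], fun s hs => ?_⟩
    rcases List.mem_append.mp hs with hs | hs
    · refine key A.inputs.length (energy A.inputs x) s.pos (by exact_mod_cast lA) ?_ (by linarith)
        (sA s hs)
      rw [List.length_append]
      exact_mod_cast (by omega)
    · refine key B.inputs.length (energy B.inputs x) s.pos (by exact_mod_cast lB) ?_ (by linarith)
        (sB s hs)
      rw [List.length_append]
      exact_mod_cast (by omega)

theorem sq_le_area {l : List StringState} (hg : DistinctDegrees l) (h : (Feynman l).Nonempty) :
    ∀ s ∈ l, ((total l).pos - s.pos) ^ 2 ≤ l.length * area l := by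
  obtain ⟨δ, rfl, hv, hp⟩ := h
  have hl : ∀ s ∈ δ.inputs, s.n ≠ 0 := fun s hs => by
    obtain ⟨u, v, e⟩ := List.append_of_mem hs
    have := hg u [s] v (by simp [e]) (by simp)
    rwa [total_single] at this
  have := (hv.sq_le_energy hg hp).2
  rwa [energy_total hl (hg [] δ.inputs [] (by simp) δ.inputs_ne_nil)] at this

end

noncomputable section

open StringState LineModel FeynmanDiagram

/-! ### Lifts -/

theorem isLift_refl (l : List StringState) : IsLift l l := by
  induction l with
  | nil => exact .nil
  | cons s l ih => exact .cons ⟨rfl, 0, by simp⟩ ih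

theorem IsLift.map_shift (k : ℤ) {l' l : List StringState} (h : IsLift l' l) :
    IsLift (l'.map (StringState.shift k)) l := by
  induction h with
  | nil => exact .nil
  | cons hs _ ih =>
    obtain ⟨h1, α, h2⟩ := hs
    refine .cons ⟨h1, α + k, ?_⟩ ih
    rw [shift_m, h2, h1]
    ring

theorem IsLift.total_n {l' l : List StringState} (h : IsLift l' l) :
    (total l').n = (total l).n := by
  induction h with
  | nil => rfl
  | cons hs _ ih => rw [n_cons, n_cons, hs.1, ih]

theorem IsLift.append {a a' b b' : List StringState} (h : IsLift a' a) (h' : IsLift b' b) :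
    IsLift (a' ++ b') (a ++ b) := List.rel_append h h'

theorem IsLift.exists_append {a b l' : List StringState} (h : IsLift l' (a ++ b)) :
    ∃ a' b', l' = a' ++ b' ∧ IsLift a' a ∧ IsLift b' b :=
  ⟨_, _, (List.take_append_drop a.length l').symm, List.forall₂_take_append _ _ _ h,
    List.forall₂_drop_append _ _ _ h⟩

theorem IsLift.length_eq {l' l : List StringState} (h : IsLift l' l) : l'.length = l.length :=
  List.Forall₂.length_eq h

theorem IsLift.ne_nil {l' l : List StringState} (h : IsLift l' l) (hl : l ≠ []) : l' ≠ [] := by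
  have := h.length_eq
  have := List.length_pos_iff.mpr hl
  exact List.ne_nil_of_length_pos (by omega)

/-- All lifts of `l` are generic. -/
def LiftGeneric (l : List StringState) : Prop := ∀ l', IsLift l' l → Generic l'

theorem DistinctDegrees.liftGeneric {l : List StringState} (h : DistinctDegrees l)
    (h' : GeneralPosition l) : LiftGeneric l := by
  refine fun l' hl' => ⟨?_, h' l' hl'⟩
  rintro a b c rfl hb
  have key : ∀ k, IsLift ((a ++ b ++ c).take k) (l.take k) := fun k => List.forall₂_take k hl'
  have h3 : IsLift b ((l.take (a ++ b).length).drop a.length) := by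
    have := List.forall₂_drop a.length (key (a ++ b).length)
    rwa [List.take_left, List.drop_left] at this
  rw [h3.total_n]
  refine h (l.take a.length) _ (l.drop (a ++ b).length) ?_ fun h0 => ?_
  · have : l.take a.length = (l.take (a ++ b).length).take a.length := by
      rw [List.take_take, Nat.min_eq_left (by simp)]
    rw [this, List.take_append_drop, List.take_append_drop]
  · rw [h0] at h3
    exact hb (List.forall₂_nil_right_iff.mp h3)

theorem LiftGeneric.generic {l : List StringState} (h : LiftGeneric l) : Generic l :=
  h l (isLift_refl l)

theorem LiftGeneric.sub {a b c : List StringState} (h : LiftGeneric (a ++ b ++ c)) :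
    LiftGeneric b := fun b' hb' =>
  (h (a ++ b' ++ c) (((isLift_refl a).append hb').append (isLift_refl c))).sub ⟨a, c, rfl⟩

/-- A lift of the state `total b'` is the total of a translate of `b'`, so every lift of the
contracted list is the contraction of a lift of the original. -/
theorem LiftGeneric.subst {a b b' c : List StringState} (h : LiftGeneric (a ++ b ++ c))
    (hb : b ≠ []) (hb' : IsLift b' b) : LiftGeneric (a ++ [total b'] ++ c) := by
  intro l' hl'
  obtain ⟨t, w, rfl, ht, hw⟩ := IsLift.exists_append hl'
  obtain ⟨u, v, rfl, hu, hv⟩ := IsLift.exists_append ht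
  obtain ⟨s, v, ⟨h1, α, h2⟩, hv', rfl⟩ := List.forall₂_cons_right_iff.mp hv
  obtain rfl := List.forall₂_nil_right_iff.mp hv'
  have hs : s = total (b'.map (StringState.shift α)) := by
    rw [total_map_shift]
    ext
    · rw [h1, shift_n]
    · rw [h2, shift_m]
  have := Generic.subst (h _ ((hu.append (hb'.map_shift α)).append hw))
    (by simpa using hb'.ne_nil hb)
  rw [← hs] at this
  simpa using this

/-! ### Convergence -/

/-- Up to a constant factor, the terms are the norms of the terms of a Jacobi theta series with
purely imaginary arguments. -/
theorem summable_exp_neg_sq {c : ℝ} (hc : 0 < c) {n : ℤ} (hn : n ≠ 0) (y : ℝ) :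
    Summable fun m : ℤ => Real.exp (-(c * ((m : ℝ) / n - y) ^ 2)) := by
  have hn' : (n : ℝ) ≠ 0 := by exact_mod_cast hn
  have h := (summable_jacobiTheta₂_term_iff (((-(c * y / (Real.pi * n)) : ℝ) : ℂ) * Complex.I)
    (((c / (Real.pi * n ^ 2) : ℝ) : ℂ) * Complex.I)).mpr (by
      rw [Complex.im_ofReal_mul, Complex.I_im, mul_one]
      have := Real.pi_pos
      positivity)
  refine (h.norm.mul_left (Real.exp (-(c * y ^ 2)))).congr fun m => ?_
  rw [norm_jacobiTheta₂_term, ← Real.exp_add, Complex.im_ofReal_mul, Complex.im_ofReal_mul,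
    Complex.I_im]
  congr 1
  field_simp
  ring

/-- The Gaussian factorises over the inputs, whose lifts are independent. -/
theorem summable_lift {c : ℝ} (hc : 0 < c) {l : List StringState} (hl : ∀ s ∈ l, s.n ≠ 0) (y : ℝ) :
    Summable fun l' : {l' // IsLift l' l} =>
      Real.exp (-(c * (l'.1.map fun s => (s.pos - y) ^ 2).sum)) := by
  induction l with
  | nil =>
    have : Finite {l' // IsLift l' []} := by
      refine Finite.of_injective (β := Unit) (fun _ => ()) fun x x' _ => Subtype.ext ?_
      rw [List.forall₂_nil_right_iff.mp x.2, List.forall₂_nil_right_iff.mp x'.2]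
    exact Summable.of_finite
  | cons s l ih =>
    have h1 := ih fun t ht => hl t (by simp [ht])
    have h2 := (summable_exp_neg_sq hc (hl s (by simp)) y).mul_of_nonneg h1
      (fun _ => (Real.exp_pos _).le) fun _ => (Real.exp_pos _).le
    have key : ∀ x : {l' // IsLift l' (s :: l)}, ∃ (t : StringState) (l' : {l' // IsLift l' l}),
        x.1 = t :: l'.1 ∧ t.n = s.n := by
      rintro ⟨x, hx⟩
      obtain ⟨t, l', h3, h4, rfl⟩ := List.forall₂_cons_right_iff.mp hx
      exact ⟨t, ⟨l', h4⟩, rfl, h3.1⟩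
    choose t l' h3 h4 using key
    have hi : Function.Injective fun x => ((t x).m, l' x) := by
      intro x x' h
      obtain ⟨h5, h6⟩ := Prod.mk.inj h
      refine Subtype.ext ?_
      rw [h3, h3, h6, StringState.ext ((h4 x).trans (h4 x').symm) h5]
    refine (h2.comp_injective hi).congr fun x => ?_
    simp only [Function.comp]
    rw [← Real.exp_add, h3, List.map_cons, List.sum_cons, pos, h4]
    congr 1
    ring

/-- The contribution of a lift to the coefficients of the operations. -/
def amplitude (τ : ℂ) (l : List StringState) : ℂ := signedCount l * weight τ l

theorem amplitude_map_shift (τ : ℂ) (k : ℤ) {l : List StringState} (hg : Generic l) (hl : l ≠ []) :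
    amplitude τ (l.map (StringState.shift k)) = amplitude τ l := by
  have h1 : ∀ s ∈ l, s.n ≠ 0 := fun s hs => hg.mem_n_ne hs
  rw [amplitude, amplitude, signedCount_map_shift k h1 (hg.n_ne hl),
    weight_map_shift τ k h1 (hg.n_ne hl)]

/-- Compare through the outgoing point: `(a - b)² ≤ 2 a² + 2 b²` gives `4 * length * area` for each
input, and summation over the inputs gives the other factor `length`. -/
theorem sum_sq_le_area {s : StringState} {l : List StringState} (hg : Generic (s :: l))
    (h : (FeynmanOfDim 0 (s :: l)).Nonempty) :
    ((s :: l).map fun t => (t.pos - s.pos) ^ 2).sum ≤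
      4 * ((s :: l).length : ℝ) ^ 2 * area (s :: l) := by
  obtain ⟨δ, hδ⟩ := h
  have h1 := sq_le_area hg.distinct ⟨δ, hδ.1⟩
  have h2 : ∀ t ∈ s :: l, (t.pos - s.pos) ^ 2 ≤ 4 * ((s :: l).length * area (s :: l)) :=
    fun t ht => by
      have h3 := h1 t ht
      have h4 := h1 s (by simp)
      nlinarith [sq_nonneg ((total (s :: l)).pos - t.pos + ((total (s :: l)).pos - s.pos))]
  have h5 := List.sum_le_card_nsmul ((s :: l).map fun t => (t.pos - s.pos) ^ 2) _ (by
    simpa only [List.forall_mem_map] using h2)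
  rw [List.length_map, nsmul_eq_mul] at h5
  linarith

/-- Gaussian decay in the distances from the first input, the one that is held fixed in `Lifts`. -/
theorem norm_amplitude_le {τ : ℂ} (hτ : 0 < τ.im) {s : StringState} {l : List StringState}
    (hg : Generic (s :: l)) : ‖amplitude τ (s :: l)‖ ≤
      Real.exp (-(Real.pi * τ.im / (4 * ((s :: l).length : ℝ) ^ 2) *
        ((s :: l).map fun t => (t.pos - s.pos) ^ 2).sum)) := by
  by_cases h : (FeynmanOfDim 0 (s :: l)).Nonempty
  · rw [amplitude, norm_mul, signedCount, if_pos h, norm_weight]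
    simp only [Int.cast_pow, Int.cast_neg, Int.cast_one, norm_pow, norm_neg, norm_one, one_pow,
      one_mul, Real.exp_le_exp, neg_le_neg_iff]
    have h1 := sum_sq_le_area hg h
    have h2 : (0 : ℝ) < 4 * ((s :: l).length : ℝ) ^ 2 := by
      have : (0 : ℝ) < (s :: l).length := by exact_mod_cast (by simp)
      positivity
    rw [div_mul_eq_mul_div, div_le_iff₀ h2]
    have := mul_le_mul_of_nonneg_left h1 (mul_pos Real.pi_pos hτ).le
    linarith
  · rw [amplitude, signedCount, if_neg h]
    simpa using (Real.exp_pos _).le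

theorem summable_amplitude {τ : ℂ} (hτ : 0 < τ.im) {l : List StringState} (hg : LiftGeneric l)
    (hl : l ≠ []) : Summable fun l' : Lifts l => ‖amplitude τ l'‖ := by
  obtain ⟨s, l, rfl⟩ := List.exists_cons_of_ne_nil hl
  have hc : 0 < Real.pi * τ.im / (4 * ((s :: l).length : ℝ) ^ 2) := by
    have : (0 : ℝ) < (s :: l).length := by exact_mod_cast (by simp)
    have := Real.pi_pos
    positivity
  have h1 := summable_lift hc (fun t ht => hg.generic.mem_n_ne ht) s.pos
  have hi : Function.Injective fun l' : Lifts (s :: l) =>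
      (⟨l'.1, l'.2.1⟩ : {l' // IsLift l' (s :: l)}) := fun x x' h =>
    Subtype.ext (Subtype.mk.inj h)
  refine (h1.comp_injective hi).of_nonneg_of_le (fun _ => norm_nonneg _) ?_
  rintro ⟨l', h2, h3⟩
  obtain ⟨t, m, -, -, rfl⟩ := List.forall₂_cons_right_iff.mp h2
  obtain rfl : t = s := by simpa using h3
  have := norm_amplitude_le hτ (hg _ h2)
  have hlen : ((t :: m).length : ℝ) = (t :: l).length := by exact_mod_cast h2.length_eq
  rw [hlen] at this
  exact this

/-! ### The operations -/

/-- The choice of the signs. -/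
def diagramSign (δ : FeynmanDiagram) : ℤ := signExponent δ.inputs

theorem mTerm_eq (τ : ℂ) {l : List StringState} (hg : Generic l) :
    mTerm diagramSign τ l = amplitude τ l • basisElt (((total l).pos : ℝ) : UnitAddCircle) := by
  rw [mTerm, amplitude, signedCount]
  rcases (feynmanOfDim_zero_subsingleton hg).eq_empty_or_singleton with h | ⟨δ, h⟩
  · rw [h]
    simp
  · have h1 : δ ∈ FeynmanOfDim 0 l := by rw [h]; rfl
    obtain ⟨⟨rfl, -⟩, -⟩ := h1
    rw [if_pos ⟨δ, by rw [h]; rfl⟩]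
    rw [h, finsum_mem_singleton, corr_eq τ hg.distinct, diagramSign]
    simp

/-- The coefficient of `θ_n[z]` in the contribution of a lift. -/
def liftCoeff (τ : ℂ) (z : UnitAddCircle) (l : List StringState) : ℂ :=
  amplitude τ l * basisElt (((total l).pos : ℝ) : UnitAddCircle) z

theorem norm_basisElt_le (p z : UnitAddCircle) : ‖basisElt p z‖ ≤ 1 := by
  rw [basisElt, Pi.single_apply]
  split_ifs <;> simp

theorem summable_norm_liftCoeff {τ : ℂ} (hτ : 0 < τ.im) {l : List StringState} (hg : LiftGeneric l)
    (hl : l ≠ []) (z : UnitAddCircle) : Summable fun l' : Lifts l => ‖liftCoeff τ z l'‖ :=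
  (summable_amplitude hτ hg hl).of_nonneg_of_le (fun _ => norm_nonneg _) fun l' => by
    rw [liftCoeff, norm_mul]
    exact mul_le_of_le_one_right (norm_nonneg _) (norm_basisElt_le _ _)

theorem summable_mTerm {τ : ℂ} (hτ : 0 < τ.im) {l : List StringState} (hg : LiftGeneric l)
    (hl : l ≠ []) : Summable fun l' : Lifts l => mTerm diagramSign τ l' := by
  refine Pi.summable.mpr fun z => (summable_norm_liftCoeff hτ hg hl z).of_norm.congr fun l' => ?_
  rw [mTerm_eq τ (hg _ l'.2.1)]
  rfl

theorem mOp_apply {τ : ℂ} (hτ : 0 < τ.im) {l : List StringState} (hg : LiftGeneric l)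
    (hl : l ≠ []) (z : UnitAddCircle) :
    mOp diagramSign τ l z = ∑' l' : Lifts l, liftCoeff τ z l' := by
  rw [mOp, tsum_apply (summable_mTerm hτ hg hl)]
  refine tsum_congr fun l' => ?_
  rw [mTerm_eq τ (hg _ l'.2.1)]
  rfl

theorem liftCoeff_map_shift (τ : ℂ) (z : UnitAddCircle) (k : ℤ) {l : List StringState}
    (hg : Generic l) (hl : l ≠ []) :
    liftCoeff τ z (l.map (StringState.shift k)) = liftCoeff τ z l := by
  rw [liftCoeff, liftCoeff, amplitude_map_shift τ k hg hl, total_map_shift,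
    StringState.shift_pos k (hg.n_ne hl)]
  congr 2
  have : ((k : ℝ) : UnitAddCircle) = 0 := by
    rw [AddCircle.coe_eq_zero_iff]
    exact ⟨k, by simp⟩
  rw [AddCircle.coe_sub, this, sub_zero]

end

noncomputable section

open StringState LineModel FeynmanDiagram

/-! ### Lifts modulo translations -/

/-- A set of lifts of `l` that contains one translate of each lift. -/
structure IsSection (l : List StringState) (N : Set (List StringState)) : Prop where
  isLift : ∀ l' ∈ N, IsLift l' l
  existsUnique : ∀ l', IsLift l' l → ∃! k : ℤ, l'.map (StringState.shift k) ∈ N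

namespace IsSection

variable {l : List StringState} {N N' : Set (List StringState)}

/-- The translation that brings a lift into the section. -/
def offset (h : IsSection l N) {l' : List StringState} (hl : IsLift l' l) : ℤ :=
  (h.existsUnique l' hl).choose

theorem offset_mem (h : IsSection l N) {l' : List StringState} (hl : IsLift l' l) :
    l'.map (StringState.shift (h.offset hl)) ∈ N := (h.existsUnique l' hl).choose_spec.1

theorem map_shift_eq (h : IsSection l N) {l' : List StringState} (hl : l' ∈ N) {k : ℤ}
    (hk : l'.map (StringState.shift k) ∈ N) : l'.map (StringState.shift k) = l' := by
  have : k = 0 := (h.existsUnique l' (h.isLift l' hl)).unique hk (by rwa [map_shift_zero])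
  rw [this, map_shift_zero]

/-- Two sections are in bijection. -/
def equiv (h : IsSection l N) (h' : IsSection l N') : N ≃ N' where
  toFun x := ⟨_, h'.offset_mem (h.isLift x.1 x.2)⟩
  invFun x := ⟨_, h.offset_mem (h'.isLift x.1 x.2)⟩
  left_inv x := Subtype.ext (by
    have h1 := h.offset_mem (h'.isLift _ (h'.offset_mem (h.isLift x.1 x.2)))
    simp only [map_shift_shift] at h1 ⊢
    exact h.map_shift_eq x.2 h1)
  right_inv x := Subtype.ext (by
    have h1 := h'.offset_mem (h.isLift _ (h.offset_mem (h'.isLift x.1 x.2)))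
    simp only [map_shift_shift] at h1 ⊢
    exact h'.map_shift_eq x.2 h1)

variable {F : List StringState → ℂ}

theorem equiv_apply (h : IsSection l N) (h' : IsSection l N')
    (hF : ∀ l', IsLift l' l → ∀ k, F (l'.map (StringState.shift k)) = F l') (x : N) :
    F (h.equiv h' x) = F x := hF _ (h.isLift x.1 x.2) _

theorem tsum_eq (h : IsSection l N) (h' : IsSection l N')
    (hF : ∀ l', IsLift l' l → ∀ k, F (l'.map (StringState.shift k)) = F l') :
    ∑' x : N, F x = ∑' x : N', F x := by
  rw [← (h.equiv h').tsum_eq]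
  exact tsum_congr fun x => (h.equiv_apply h' hF x).symm

theorem summable_norm (h : IsSection l N) (h' : IsSection l N')
    (hF : ∀ l', IsLift l' l → ∀ k, F (l'.map (StringState.shift k)) = F l')
    (hs : Summable fun x : N => ‖F x‖) : Summable fun x : N' => ‖F x‖ := by
  rw [← (h.equiv h').summable_iff]
  exact hs.congr fun x => by rw [Function.comp, h.equiv_apply h' hF x]

end IsSection

theorem isSection_lifts {l : List StringState} (hl : ∀ s ∈ l, s.n ≠ 0) (hl' : l ≠ []) :
    IsSection l (Lifts l) := by
  refine ⟨fun l' h => h.1, fun l' h => ?_⟩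
  obtain ⟨s, l, rfl⟩ := List.exists_cons_of_ne_nil hl'
  obtain ⟨t, l', ⟨h1, α, h2⟩, h3, rfl⟩ := List.forall₂_cons_right_iff.mp h
  have hs := hl s (by simp)
  refine ⟨-α, ⟨h.map_shift _, ?_⟩, fun k hk => ?_⟩
  · rw [List.map_cons, List.head?_cons, List.head?_cons, Option.some_inj]
    ext
    · exact h1
    · rw [shift_m, h1, h2]
      ring
  · have := hk.2
    rw [List.map_cons, List.head?_cons, List.head?_cons, Option.some_inj] at this
    have := congrArg StringState.m this
    rw [shift_m, h1, h2] at this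
    have : s.n * (k + α) = 0 := by linarith
    have := (mul_eq_zero.mp this).resolve_left hs
    omega

theorem existsUnique_reduced {n : ℤ} (hn : n ≠ 0) (m : ℤ) :
    ∃! k : ℤ, 0 ≤ m - n * k ∧ m - n * k < |n| := by
  refine ⟨m / n, ?_, ?_⟩
  · have h := Int.emod_def m n
    have h1 := Int.emod_nonneg m hn
    have h2 := Int.emod_lt_abs m hn
    rw [h] at h1 h2
    exact ⟨h1, h2⟩
  · rintro k ⟨h1, h2⟩
    have h3 : (m - n * k) % n = m - n * k := by
      rw [← Int.emod_abs, Int.emod_eq_of_lt h1 h2]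
    rw [Int.sub_mul_emod_self_left, Int.emod_def] at h3
    have : n * (m / n - k) = 0 := by linarith
    have := (mul_eq_zero.mp this).resolve_left hn
    omega

/-- The lifts of `b` whose total state is `θ_n[m/n]` with `0 ≤ m < |n|`. -/
def Reduced (b : List StringState) : Set (List StringState) :=
  {b' | IsLift b' b ∧ 0 ≤ (total b').m ∧ (total b').m < |(total b).n|}

theorem isSection_reduced {b : List StringState} (hb : (total b).n ≠ 0) :
    IsSection b (Reduced b) := by
  refine ⟨fun l' h => h.1, fun l' h => ?_⟩
  refine (existsUnique_congr fun k => ?_).mpr (existsUnique_reduced hb (total l').m)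
  rw [Reduced, Set.mem_ofPred_eq, total_map_shift, shift_m, h.total_n]
  simp [h.map_shift k]

/-- The lifts of `a`. -/
abbrev AllLifts (a : List StringState) : Type := {a' // IsLift a' a}

/-- Normalising the total of the middle block fixes the common translation just as normalising the
first input does, and leaves `a` and `c` free. This is the index set that arises from composing two
operations. -/
theorem isSection_append {a b c : List StringState} (hb : (total b).n ≠ 0) :
    IsSection (a ++ b ++ c) (Set.range fun x : Reduced b × (AllLifts a × AllLifts c) =>
      x.2.1.1 ++ x.1.1 ++ x.2.2.1) := by
  refine ⟨?_, fun l' h => ?_⟩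
  · rintro _ ⟨x, rfl⟩
    exact (x.2.1.2.append x.1.2.1).append x.2.2.2
  · obtain ⟨t, c', rfl, ht, hc⟩ := IsLift.exists_append h
    obtain ⟨a', b', rfl, ha, hb'⟩ := IsLift.exists_append ht
    refine (existsUnique_congr fun k => ?_).mpr ((isSection_reduced hb).existsUnique b' hb')
    constructor
    · rintro ⟨⟨⟨v, hv⟩, ⟨u, hu⟩, ⟨w, hw⟩⟩, e⟩
      simp only [List.map_append] at e
      have h1 := hu.length_eq.trans ha.length_eq.symm
      have h2 := hv.1.length_eq.trans hb'.length_eq.symm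
      obtain ⟨e1, -⟩ := List.append_inj e (by simp [h1, h2])
      obtain ⟨-, rfl⟩ := List.append_inj e1 (by simp [h1])
      exact hv
    · intro hk
      exact ⟨⟨⟨_, hk⟩, ⟨_, ha.map_shift k⟩, ⟨_, hc.map_shift k⟩⟩, by simp⟩

theorem append_injective (a b c : List StringState) : Function.Injective
    fun x : Reduced b × (AllLifts a × AllLifts c) => x.2.1.1 ++ x.1.1 ++ x.2.2.1 := by
  rintro ⟨⟨v, hv⟩, ⟨u, hu⟩, ⟨w, hw⟩⟩ ⟨⟨v', hv'⟩, ⟨u', hu'⟩, ⟨w', hw'⟩⟩ e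
  have h1 := hu.length_eq.trans hu'.length_eq.symm
  have h2 := hv.1.length_eq.trans hv'.1.length_eq.symm
  obtain ⟨e1, rfl⟩ := List.append_inj e (by simp [h1, h2])
  obtain ⟨rfl, rfl⟩ := List.append_inj e1 h1
  rfl

section Reindex

variable {a b c : List StringState} {F : List StringState → ℂ}

theorem tsum_append (hl : ∀ s ∈ a ++ b ++ c, s.n ≠ 0) (hb : b ≠ []) (hb' : (total b).n ≠ 0)
    (hF : ∀ l', IsLift l' (a ++ b ++ c) → ∀ k, F (l'.map (StringState.shift k)) = F l') :
    ∑' x : Reduced b × (AllLifts a × AllLifts c), F (x.2.1.1 ++ x.1.1 ++ x.2.2.1) =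
      ∑' l' : Lifts (a ++ b ++ c), F l' := by
  rw [(isSection_lifts hl (by simp [hb])).tsum_eq (isSection_append hb') hF]
  exact ((Equiv.ofInjective _ (append_injective a b c)).tsum_eq (fun x => F x.1))

theorem summable_append_iff (hl : ∀ s ∈ a ++ b ++ c, s.n ≠ 0) (hb : b ≠ [])
    (hb' : (total b).n ≠ 0)
    (hF : ∀ l', IsLift l' (a ++ b ++ c) → ∀ k, F (l'.map (StringState.shift k)) = F l') :
    (Summable fun x : Reduced b × (AllLifts a × AllLifts c) =>
      ‖F (x.2.1.1 ++ x.1.1 ++ x.2.2.1)‖) ↔ Summable fun l' : Lifts (a ++ b ++ c) => ‖F l'‖ := by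
  have h1 := isSection_lifts hl (by simp [hb])
  have h2 := isSection_append (a := a) (c := c) hb'
  have h3 := (Equiv.ofInjective _ (append_injective a b c)).summable_iff (f := fun x => ‖F x.1‖)
  exact h3.trans ⟨h2.summable_norm h1 hF, h1.summable_norm h2 hF⟩

theorem reduced_single {s : StringState} (h0 : 0 ≤ s.m) (h1 : s.m < |s.n|) :
    Reduced [s] = {[s]} := by
  have hn : s.n ≠ 0 := by rintro h; rw [h, abs_zero] at h1; omega
  ext v
  constructor
  · rintro ⟨hv, h2, h3⟩
    obtain ⟨t, u, ⟨h4, α, h5⟩, hu, rfl⟩ := List.forall₂_cons_right_iff.mp hv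
    obtain rfl := List.forall₂_nil_right_iff.mp hu
    rw [total_single] at h2 h3
    rw [total_single] at h3
    have := (existsUnique_reduced hn s.m).unique (y₁ := 0) (y₂ := α)
      ⟨by simpa using h0, by simpa using h1⟩ ⟨by rwa [← h5], by rwa [← h5]⟩
    have : t = s := by
      ext
      · exact h4
      · rw [h5, ← this]; ring
    rw [this]
    rfl
  · rintro rfl
    exact ⟨isLift_refl _, by simpa using h0, by simpa using h1⟩

theorem tsum_append_single {s : StringState} (h0 : 0 ≤ s.m) (h1 : s.m < |s.n|)
    (hl : ∀ t ∈ a ++ [s] ++ c, t.n ≠ 0)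
    (hF : ∀ l', IsLift l' (a ++ [s] ++ c) → ∀ k, F (l'.map (StringState.shift k)) = F l') :
    ∑' x : AllLifts a × AllLifts c, F (x.1.1 ++ [s] ++ x.2.1) =
      ∑' l' : Lifts (a ++ [s] ++ c), F l' := by
  rw [← tsum_append hl (by simp) (by simpa using hl s (by simp)) hF, reduced_single h0 h1]
  exact (Equiv.uniqueProd (AllLifts a × AllLifts c)
    ({[s]} : Set (List StringState))).symm.tsum_eq fun x => F (x.2.1.1 ++ x.1.1 ++ x.2.2.1)

theorem summable_append_single_iff {s : StringState} (h0 : 0 ≤ s.m) (h1 : s.m < |s.n|)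
    (hl : ∀ t ∈ a ++ [s] ++ c, t.n ≠ 0)
    (hF : ∀ l', IsLift l' (a ++ [s] ++ c) → ∀ k, F (l'.map (StringState.shift k)) = F l') :
    (Summable fun x : AllLifts a × AllLifts c => ‖F (x.1.1 ++ [s] ++ x.2.1)‖) ↔
      Summable fun l' : Lifts (a ++ [s] ++ c) => ‖F l'‖ := by
  rw [← summable_append_iff hl (by simp) (by simpa using hl s (by simp)) hF, reduced_single h0 h1]
  rw [← (Equiv.uniqueProd (AllLifts a × AllLifts c)
    ({[s]} : Set (List StringState))).symm.summable_iff]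
  rfl

end Reindex

/-! ### Composition of the operations -/

theorem coe_pos_eq_iff {s t : StringState} (hs : s.n ≠ 0) (h : t.n = s.n) (h0 : 0 ≤ s.m)
    (h1 : s.m < |s.n|) (h0' : 0 ≤ t.m) (h1' : t.m < |s.n|) :
    ((s.pos : ℝ) : UnitAddCircle) = (t.pos : ℝ) ↔ s.m = t.m := by
  have hs' : (s.n : ℝ) ≠ 0 := by exact_mod_cast hs
  constructor
  · intro e
    rw [← sub_eq_zero, ← AddCircle.coe_sub, AddCircle.coe_eq_zero_iff] at e
    obtain ⟨k, hk⟩ := e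
    rw [zsmul_eq_mul, mul_one, pos, pos, h] at hk
    have hk' : (s.m : ℝ) = t.m + s.n * k := by
      field_simp at hk
      linarith
    have hk'' : s.m = t.m + s.n * k := by exact_mod_cast hk'
    have := (existsUnique_reduced hs s.m).unique (y₁ := 0) (y₂ := k)
      ⟨by simpa using h0, by simpa using h1⟩ ⟨by linarith, by linarith⟩
    rw [hk'', ← this]
    ring
  · intro e
    rw [StringState.ext h.symm e]

variable {a b c : List StringState}

theorem liftCoeff_reduced (τ : ℂ) (hb : (total b).n ≠ 0) {r : ℕ} (hr : r < (total b).n.natAbs)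
    {b' : List StringState} (hb' : b' ∈ Reduced b) :
    liftCoeff τ (((⟨(total b).n, r⟩ : StringState).pos : ℝ) : UnitAddCircle) b' =
      if (total b').m = r then amplitude τ b' else 0 := by
  have h1 : ((r : ℤ)) < |(total b).n| := by
    rw [Int.abs_eq_natAbs]
    exact_mod_cast hr
  have h2 := hb'.1.total_n
  have := coe_pos_eq_iff (s := ⟨(total b).n, r⟩) (t := total b') hb h2 (by positivity) h1
    hb'.2.1 hb'.2.2
  rw [liftCoeff, basisElt, Pi.single_apply]
  simp only [this]
  simp only [eq_comm (a := (r : ℤ)), mul_ite, mul_one, mul_zero]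

/-- The product of one term of the inner operation with one term of the outer operation. -/
def pairCoeff (τ : ℂ) (z : UnitAddCircle) (a b c : List StringState) : ℂ :=
  amplitude τ b * liftCoeff τ z (a ++ [total b] ++ c)

/-- For each residue `r` the inner series runs over the reduced lifts of `b` with total `m = r`, and
the outer one over all lifts of `a` and `c` around the fixed state `r / n`. Both converge
absolutely, so their product is a double series, and summing over `r` frees the total of `b`. -/
theorem mInsert_apply {τ : ℂ} (hτ : 0 < τ.im) (hg : LiftGeneric (a ++ b ++ c)) (hb : b ≠ [])
    (z : UnitAddCircle) :
    (Summable fun x : Reduced b × (AllLifts a × AllLifts c) =>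
      ‖pairCoeff τ z x.2.1.1 x.1.1 x.2.2.1‖) ∧
    mInsert diagramSign τ a (total b).n (mOp diagramSign τ b) c z =
      ∑' x : Reduced b × (AllLifts a × AllLifts c), pairCoeff τ z x.2.1.1 x.1.1 x.2.2.1 := by
  have hn := hg.sub.generic.n_ne hb
  set n := (total b).n with hn_def
  let f : ℕ → Reduced b → ℂ := fun r b' => if (total b'.1).m = r then amplitude τ b' else 0
  let g : ℕ → AllLifts a × AllLifts c → ℂ := fun r y =>
    liftCoeff τ z (y.1.1 ++ [(⟨n, r⟩ : StringState)] ++ y.2.1)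
  have hF : ∀ z' l', IsLift l' b → ∀ k, liftCoeff τ z' (l'.map (StringState.shift k)) =
      liftCoeff τ z' l' := fun z' l' h k => liftCoeff_map_shift τ z' k (hg.sub _ h) (h.ne_nil hb)
  have hsec := isSection_lifts (fun s hs => hg.sub.generic.mem_n_ne hs) hb
  have hf : ∀ r < n.natAbs, (Summable fun b' => ‖f r b'‖) ∧
      mOp diagramSign τ b (((⟨n, r⟩ : StringState).pos : ℝ) : UnitAddCircle) = ∑' b', f r b' := by
    intro r hr
    have e : ∀ b' : Reduced b, liftCoeff τ (((⟨n, r⟩ : StringState).pos : ℝ) : UnitAddCircle) b' =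
      f r b' := fun b' => liftCoeff_reduced τ hn hr b'.2
    constructor
    · simp only [← e]
      exact hsec.summable_norm (isSection_reduced hn) (hF _)
        (summable_norm_liftCoeff hτ hg.sub hb _)
    · simp only [← e]
      rw [mOp_apply hτ hg.sub hb, hsec.tsum_eq (isSection_reduced hn) (hF _)]
  have key : ∀ r < n.natAbs, (Summable fun x : Reduced b × (AllLifts a × AllLifts c) =>
      ‖f r x.1 * g r x.2‖) ∧
      mOp diagramSign τ b (((⟨n, r⟩ : StringState).pos : ℝ) : UnitAddCircle) *
        mOp diagramSign τ (a ++ [(⟨n, r⟩ : StringState)] ++ c) z =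
          ∑' x : Reduced b × (AllLifts a × AllLifts c), f r x.1 * g r x.2 := by
    intro r hr
    obtain ⟨hf1, hf2⟩ := hf r hr
    -- If no lift of `b` has this residue, the outer input need not be in general position and
    -- nothing is known about its series, but it is multiplied by zero.
    by_cases hex : ∃ b' : Reduced b, (total b'.1).m = r
    · obtain ⟨b', hb'⟩ := hex
      have hs : total b'.1 = ⟨n, r⟩ := StringState.ext b'.2.1.total_n hb'
      have hg' := hg.subst hb b'.2.1
      rw [hs] at hg'
      have h1 : (r : ℤ) < |n| := by
        rw [Int.abs_eq_natAbs]
        exact_mod_cast hr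
      have hF' : ∀ l', IsLift l' (a ++ [(⟨n, r⟩ : StringState)] ++ c) → ∀ k,
          liftCoeff τ z (l'.map (StringState.shift k)) = liftCoeff τ z l' := fun l' h k =>
        liftCoeff_map_shift τ z k (hg' _ h) (h.ne_nil (by simp))
      have hne : ∀ t ∈ a ++ [(⟨n, r⟩ : StringState)] ++ c, t.n ≠ 0 := fun t ht =>
        hg'.generic.mem_n_ne ht
      have hs' := (summable_append_single_iff (s := ⟨n, r⟩) (by positivity) h1 hne hF').mpr
        (summable_norm_liftCoeff hτ hg' (by simp) z)
      refine ⟨hf1.mul_norm hs', ?_⟩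
      rw [hf2, mOp_apply hτ hg' (by simp), ← tsum_append_single (s := ⟨n, r⟩) (by positivity) h1 hne hF']
      exact tsum_mul_tsum_of_summable_norm hf1 hs'
    · push Not at hex
      have h0 : ∀ b', f r b' = 0 := fun b' => if_neg (hex b')
      rw [hf2]
      simp only [h0, zero_mul, tsum_zero, norm_zero]
      exact ⟨summable_zero, trivial⟩
  -- A reduced lift has exactly one residue, so a single `r` contributes.
  have hsum : ∀ x : Reduced b × (AllLifts a × AllLifts c),
      ∑ r ∈ Finset.range n.natAbs, f r x.1 * g r x.2 = pairCoeff τ z x.2.1.1 x.1.1 x.2.2.1 := by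
    rintro ⟨⟨b', hb'⟩, ⟨a', ha'⟩, c', hc'⟩
    obtain ⟨m, hm⟩ := Int.eq_ofNat_of_zero_le hb'.2.1
    have hm' : m < n.natAbs := by
      have := hb'.2.2
      rw [hm, Int.abs_eq_natAbs] at this
      exact_mod_cast this
    have hs : total b' = ⟨n, m⟩ := StringState.ext hb'.1.total_n hm
    rw [Finset.sum_eq_single_of_mem m (Finset.mem_range.mpr hm')]
    · simp only [f, g, pairCoeff, hs, if_true]
    · intro r _ hr
      simp only [f, hm]
      rw [if_neg (by exact_mod_cast hr.symm), zero_mul]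
  constructor
  · have h1 : Summable fun x : Reduced b × (AllLifts a × AllLifts c) =>
        ∑ r ∈ Finset.range n.natAbs, ‖f r x.1 * g r x.2‖ :=
      summable_sum fun r hr => (key r (Finset.mem_range.mp hr)).1
    refine h1.of_nonneg_of_le (fun _ => norm_nonneg _) fun x => ?_
    rw [← hsum x]
    exact norm_sum_le _ _
  · rw [mInsert, Finset.sum_apply]
    simp only [Pi.smul_apply, smul_eq_mul]
    rw [Finset.sum_congr rfl fun r hr => (key r (Finset.mem_range.mp hr)).2,
      ← Summable.tsum_finsetSum fun r hr => (key r (Finset.mem_range.mp hr)).1.of_norm]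
    exact tsum_congr hsum

/-- The contribution of a lift to the composition of the operations, where the inner operation acts on
`j` states after the first `i` states. -/
def splitCoeff (τ : ℂ) (z : UnitAddCircle) (i j : ℕ) (l : List StringState) : ℂ :=
  pairCoeff τ z (l.take i) ((l.drop i).take j) (l.drop (i + j))

theorem splitCoeff_append (τ : ℂ) (z : UnitAddCircle) {i j : ℕ} (ha : a.length = i)
    (hb : b.length = j) : splitCoeff τ z i j (a ++ b ++ c) = pairCoeff τ z a b c := by
  subst ha
  subst hb
  rw [splitCoeff, ← List.length_append, List.drop_left, List.append_assoc, List.take_left,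
    List.drop_left, List.take_left]

theorem pairCoeff_map_shift (τ : ℂ) (z : UnitAddCircle) (k : ℤ) (hg : Generic (a ++ b ++ c))
    (hb : b ≠ []) : pairCoeff τ z (a.map (StringState.shift k)) (b.map (StringState.shift k))
      (c.map (StringState.shift k)) = pairCoeff τ z a b c := by
  rw [pairCoeff, pairCoeff, amplitude_map_shift τ k (hg.sub ⟨a, c, rfl⟩) hb, total_map_shift]
  congr 1
  have h1 : Generic (a ++ [total b] ++ c) := by simpa using hg.subst hb
  rw [← liftCoeff_map_shift τ z k h1 (by simp)]
  simp

/-- Simultaneous translation leaves the terms invariant, so the double series may be re-indexed by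
lifts normalised at the first input. That index set is the same for every position and length of the
inner block. -/
theorem mInsert_eq {τ : ℂ} (hτ : 0 < τ.im) (hg : LiftGeneric (a ++ b ++ c)) (hb : b ≠ [])
    (z : UnitAddCircle) :
    (Summable fun l' : Lifts (a ++ b ++ c) => splitCoeff τ z a.length b.length l') ∧
    mInsert diagramSign τ a (total b).n (mOp diagramSign τ b) c z =
      ∑' l' : Lifts (a ++ b ++ c), splitCoeff τ z a.length b.length l' := by
  obtain ⟨h1, h2⟩ := mInsert_apply hτ hg hb z
  have e : ∀ x : Reduced b × (AllLifts a × AllLifts c), pairCoeff τ z x.2.1.1 x.1.1 x.2.2.1 =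
      splitCoeff τ z a.length b.length (x.2.1.1 ++ x.1.1 ++ x.2.2.1) := fun x =>
    (splitCoeff_append τ z x.2.1.2.length_eq x.1.2.1.length_eq).symm
  have hF : ∀ l', IsLift l' (a ++ b ++ c) → ∀ k, splitCoeff τ z a.length b.length
      (l'.map (StringState.shift k)) = splitCoeff τ z a.length b.length l' := by
    intro l' h k
    have hl' := hg _ h
    obtain ⟨t, c', rfl, ht, hc⟩ := IsLift.exists_append h
    obtain ⟨a', b', rfl, ha, hb'⟩ := IsLift.exists_append ht
    rw [List.map_append, List.map_append, splitCoeff_append τ z (by simpa using ha.length_eq)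
      (by simpa using hb'.length_eq), splitCoeff_append τ z ha.length_eq hb'.length_eq,
      pairCoeff_map_shift τ z k hl' (hb'.ne_nil hb)]
  have hne : ∀ s ∈ a ++ b ++ c, s.n ≠ 0 := fun s hs => hg.generic.mem_n_ne hs
  have hn := hg.sub.generic.n_ne hb
  simp only [e] at h1 h2
  exact ⟨((summable_append_iff hne hb hn hF).mp h1).of_norm,
    h2.trans (tsum_append hne hb hn hF)⟩

end

noncomputable section

open StringState LineModel FeynmanDiagram

/-! ### The A-infinity relation -/

/-- Empty middle blocks contribute zero, so starting at `p = 1` loses nothing. -/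
theorem sum_blocks_eq_splitSum {X A : Type*} [AddCommMonoid A] (f : List X → List X → List X → A)
    (h : ∀ a c, f a [] c = 0) (l : List X) :
    ∑ p ∈ Finset.Icc 1 l.length, ∑ q ∈ Finset.range (l.length - p + 1),
      f (l.take q) ((l.drop q).take p) (l.drop (q + p)) =
    splitSum (fun a t => splitSum (fun b c => f a b c) t) l := by
  rw [splitSum, Finset.sum_comm' (t' := Finset.range (l.length + 1))
    (s' := fun q => Finset.Icc 1 (l.length - q))]
  · refine Finset.sum_congr rfl fun q _ => ?_
    rw [splitSum, Finset.sum_range_succ', List.take_zero, h, add_zero, List.length_drop,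
      Finset.range_eq_Ico, Finset.sum_Ico_add' (fun p => f (l.take q) ((l.drop q).take p)
        ((l.drop q).drop p)) 0 (l.length - q) 1]
    refine Finset.sum_congr ?_ fun p _ => by rw [List.drop_drop]
    ext p
    simp only [Finset.mem_Ico, Finset.mem_Icc]
    omega
  · intro p q
    simp only [Finset.mem_Icc, Finset.mem_range]
    omega

theorem passSign_eq (l : List StringState) (q : ℕ) (hq : l.length = q) :
    (-1 : ℂ) ^ ((l.map StringState.deg).sum - (q : ℤ)) = passSign l := by
  subst hq
  induction l with
  | nil => simp [passSign]
  | cons s l ih =>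
    have e : ((s :: l).map StringState.deg).sum - ((s :: l).length : ℤ) =
        (s.deg - 1) + ((l.map StringState.deg).sum - (l.length : ℤ)) := by
      simp
      ring
    rw [e, zpow_add₀ (by norm_num), ih, passSign, passSign, List.map_cons, List.prod_cons,
      Int.cast_mul]
    congr 1
    by_cases hs : s.n < 0
    · simp [deg, hs]
    · simp [deg, hs]

theorem passSign_eq_of_isLift {l' l : List StringState} (h : IsLift l' l) :
    passSign l' = passSign l := by
  induction h with
  | nil => rfl
  | cons hs _ ih =>
    rw [passSign, passSign] at ih
    rw [passSign, passSign, List.map_cons, List.map_cons, List.prod_cons, List.prod_cons, hs.1, ih]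

/-- By additivity of the area, and since contraction keeps the total, the weight and the basis
element depend only on the whole list. They factor out of the sum over splittings and leave the
integers of `signedCount_relation`. -/
theorem pairCoeff_eq (τ : ℂ) (z : UnitAddCircle) (a b c : List StringState) :
    pairCoeff τ z a b c = ((signedCount b * signedCount (a ++ total b :: c) : ℤ) : ℂ) *
      (weight τ (a ++ b ++ c) *
        basisElt (((total (a ++ b ++ c)).pos : ℝ) : UnitAddCircle) z) := by
  have h : a ++ [total b] ++ c = a ++ total b :: c := by simp
  rw [pairCoeff, liftCoeff, amplitude, amplitude, h, total_subst, weight_subst τ a b c]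
  push_cast
  ring

theorem sum_splitCoeff (τ : ℂ) (z : UnitAddCircle) {l : List StringState} (hg : Generic l)
    (hl : l ≠ []) : ∑ p ∈ Finset.Icc 1 l.length, ∑ q ∈ Finset.range (l.length - p + 1),
      (passSign (l.take q) : ℂ) * splitCoeff τ z q p l = 0 := by
  set W := weight τ l * basisElt (((total l).pos : ℝ) : UnitAddCircle) z with hW
  have h1 : ∀ p q, (passSign (l.take q) : ℂ) * splitCoeff τ z q p l =
      ((passSign (l.take q) * signedCount ((l.drop q).take p) *
        signedCount (l.take q ++ total ((l.drop q).take p) :: l.drop (q + p)) : ℤ) : ℂ) * W := by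
    intro p q
    have e : l.take q ++ (l.drop q).take p ++ l.drop (q + p) = l := by
      rw [List.append_assoc, ← List.drop_drop, List.take_append_drop, List.take_append_drop]
    rw [splitCoeff, pairCoeff_eq, e, hW]
    push_cast
    ring
  simp only [h1, ← Finset.sum_mul, ← Int.cast_sum]
  rw [sum_blocks_eq_splitSum (fun a b c => passSign a * signedCount b *
      signedCount (a ++ total b :: c)) (fun a c => by rw [signedCount_nil, mul_zero, zero_mul]),
    signedCount_relation hg hl, Int.cast_zero, zero_mul]

/-- The A-infinity relation for the coefficients. -/
theorem sum_mInsert {τ : ℂ} (hτ : 0 < τ.im) {l : List StringState} (hg : LiftGeneric l)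
    (hl : l ≠ []) :
    ∑ p ∈ Finset.Icc 1 l.length, ∑ q ∈ Finset.range (l.length - p + 1),
      (-1 : ℂ) ^ (((l.take q).map StringState.deg).sum - (q : ℤ)) •
        mInsert diagramSign τ (l.take q) (total ((l.drop q).take p)).n
          (mOp diagramSign τ ((l.drop q).take p)) (l.drop (q + p)) = 0 := by
  funext z
  have key : ∀ p ∈ Finset.Icc 1 l.length, ∀ q ∈ Finset.range (l.length - p + 1),
      (Summable fun l' : Lifts l => (passSign (l'.1.take q) : ℂ) * splitCoeff τ z q p l') ∧
      (-1 : ℂ) ^ (((l.take q).map StringState.deg).sum - (q : ℤ)) *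
        mInsert diagramSign τ (l.take q) (total ((l.drop q).take p)).n
          (mOp diagramSign τ ((l.drop q).take p)) (l.drop (q + p)) z =
        ∑' l' : Lifts l, (passSign (l'.1.take q) : ℂ) * splitCoeff τ z q p l' := by
    intro p hp q hq
    rw [Finset.mem_Icc] at hp
    rw [Finset.mem_range] at hq
    have e : l.take q ++ (l.drop q).take p ++ l.drop (q + p) = l := by
      rw [List.append_assoc, ← List.drop_drop, List.take_append_drop, List.take_append_drop]
    have h1 : (l.take q).length = q := by rw [List.length_take]; omega
    have h2 : ((l.drop q).take p).length = p := by
      rw [List.length_take, List.length_drop]; omega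
    have h3 : (l.drop q).take p ≠ [] := List.ne_nil_of_length_pos (by omega)
    obtain ⟨h4, h5⟩ := mInsert_eq hτ (a := l.take q) (b := (l.drop q).take p) (c := l.drop (q + p))
      (by rwa [e]) h3 z
    have h6 : ∀ l' : Lifts l, passSign (l'.1.take q) = passSign (l.take q) := fun l' =>
      passSign_eq_of_isLift (List.forall₂_take q l'.2.1)
    rw [e, h1, h2] at h4 h5
    rw [h5, passSign_eq _ q h1]
    simp only [h6]
    exact ⟨h4.mul_left _, tsum_mul_left.symm⟩
  rw [Finset.sum_apply]
  simp only [Finset.sum_apply, Pi.smul_apply, smul_eq_mul, Pi.zero_apply]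
  rw [Finset.sum_congr rfl fun p hp => Finset.sum_congr rfl fun q hq => (key p hp q hq).2,
    Finset.sum_congr rfl fun p hp => (Summable.tsum_finsetSum fun q hq => (key p hp q hq).1).symm,
    ← Summable.tsum_finsetSum fun p hp => summable_sum fun q hq => (key p hp q hq).1]
  -- The finite sums now stand inside the series, and each lift contributes zero by itself.
  rw [← tsum_zero (α := ℂ) (β := Lifts l)]
  refine tsum_congr fun l' => ?_
  have := sum_splitCoeff τ z (hg _ l'.2.1) (l'.2.1.ne_nil hl)
  rwa [l'.2.1.length_eq] at this

theorem toSection_zero (τ : ℂ) (n : ℤ) (z : ℂ) : toSection τ n 0 z = 0 := by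
  simp [toSection]

theorem toSection_smul (τ : ℂ) (n : ℤ) (c : ℂ) (x : UnitAddCircle → ℂ) (z : ℂ) :
    toSection τ n (c • x) z = c * toSection τ n x z := by
  simp only [toSection, Pi.smul_apply, smul_eq_mul, Finset.mul_sum, mul_assoc]

theorem toSection_sum (τ : ℂ) (n : ℤ) {ι : Type*} (s : Finset ι) (x : ι → UnitAddCircle → ℂ)
    (z : ℂ) : toSection τ n (∑ i ∈ s, x i) z = ∑ i ∈ s, toSection τ n (x i) z := by
  simp only [toSection, Finset.sum_apply, Finset.sum_mul]
  exact Finset.sum_comm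

theorem mainTheorem3 :
    ∃ σ : FeynmanDiagram → ℤ, ∀ τ : ℂ, 0 < τ.im → ∀ l : List StringState, l ≠ [] →
      DistinctDegrees l → GeneralPosition l →
        (∀ l' ∈ Lifts l, (FeynmanOfDim 0 l').Finite) ∧
        Summable (fun l' : Lifts l => mTerm σ τ l') ∧
        (∑ p ∈ Finset.Icc 1 l.length, ∑ q ∈ Finset.range (l.length - p + 1),
          (-1 : ℂ) ^ (((l.take q).map StringState.deg).sum - (q : ℤ)) •
            mInsert σ τ (l.take q) (StringState.total ((l.drop q).take p)).n
              (mOp σ τ ((l.drop q).take p)) (l.drop (q + p))) = 0 ∧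
        ∀ z : ℂ, ∑ p ∈ Finset.Icc 1 l.length, ∑ q ∈ Finset.range (l.length - p + 1),
          (-1 : ℂ) ^ (((l.take q).map StringState.deg).sum - (q : ℤ)) *
            toSection τ (StringState.total l).n
              (mInsert σ τ (l.take q) (StringState.total ((l.drop q).take p)).n
                (mOp σ τ ((l.drop q).take p)) (l.drop (q + p))) z = 0 := by
  refine ⟨diagramSign, fun τ hτ l hl hd hp => ?_⟩
  have hg := hd.liftGeneric hp
  have h := sum_mInsert hτ hg hl
  refine ⟨fun l' hl' => (feynmanOfDim_zero_subsingleton (hg _ hl'.1)).finite,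
    summable_mTerm hτ hg hl, h, fun z => ?_⟩
  have h' := congrArg (fun x => toSection τ (total l).n x z) h
  simpa only [toSection_sum, toSection_smul, toSection_zero] using h'

end
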